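/- For $b,c$ in a field let $E(b,c): Y^2+(1-c)XY-bY=X^3-bX^2$ be the Tate normal form. Let $X_1(17)$ be the modular curve over $\mathbb{Q}$ whose non-cuspidal points parametrize pairs (elliptic curve, point of exact order $17$). Let $x,y$ be functions with $$f_{17}(x,y)=y^4+(x^3+x^2-x+2)y^3+(x^3-3x+1)y^2-(x^4+2x)y+x^3+x^2=0,$$ put $$r=\frac{x^2+x-y}{x^2+xy+x-y^2-y},\qquad s=\frac{x+1}{x+y+1},\qquad c=s(r-1),\qquad b=cr .$$ **(Model.)** $\mathbb{Q}(x,y)$ is the function field of $X_1(17)$ with universal pair $(E(b,c),(0,0))$: the curve $E(b,c)$ over $\mathbb{Q}(x,y)$ is an elliptic curve on which $(0,0)$ has exact order $17$, $b$ and $c$ are not both algebraic over $\mathbb Q$, and $\mathbb{Q}(b,c)=\mathbb{Q}(x,y)$. Moreover, with $D=bc^4+c^5-3b^2c^2+3bc^3+b^3-2b^2c+bc^2\neq 0$, $$x=-\frac{(-c^2+b-c)(-c^3+b^2-bc)}{D},\qquad y=-\frac{(-c^2+b-c)(-bc^2+2b^2-3bc+c^2)}{D}.$$ Let $E_{17}: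 v^2+uv+v=u^3-u^2-6u-4$ (the curve 17A2), and let $\phi_{17}:X_1(17)\to E_{17}$ be the morphism of smooth projective curves given by $$\phi_{17}(x,y)=\left(\frac{x^2+xy-y^2+x-2y-1}{(y+1)^2},\ \frac{x^3y^2-x^4+2x^3y+2x^2y^2-x^3+x^2y+y^3-xy+y^2}{(y+1)^2(x-y)}\right).$$ **(Fibres.)** The points $P_1=(3,-2)$ and $P_2=(-5/4,1/8)$ are rational points of order $2$ on $E_{17}$. The polynomial $2x^4-5x^3-7x^2+10x+8$ has four distinct roots $\alpha_1,\dots,\alpha_4$ in $\overline{\mathbb{Q}}$. For each $i$ there is exactly one point of $X_1(17)(\overline{\mathbb Q})$ with coordinates $$(x,y)=\left(\alpha_i,\ \tfrac{\alpha_i^2}{2}-\tfrac{\alpha_i}{2}-2\right),$$ and these four points are exactly the points of $X_1(17)(\overline{\mathbb{Q}})$, cusps included, lying above $P_1$. The polynomial $8x^4+14x^3-11x^2-11x-2$ has four distinct roots $\beta_1,\dots,\beta_4$ in $\overline{\mathbb{Q}}$. For each $i$ there is exactly one point of $X_1(17)(\overline{\mathbb Q})$ with coordinates $(x,y)=(\beta_i,-2\beta_i-1)$,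 and these four points are exactly the points lying above $P_2$. The field of definition of the point belonging to $\alpha_i$ (resp. $\beta_i$) is $\mathbb{Q}(\alpha_i)$ (resp. $\mathbb{Q}(\beta_i)$), which is a cyclic Galois extension of $\mathbb{Q}$ of degree $4$; so all these points are quartic points. **(Elliptic curves.)** At the point belonging to $\alpha_i$ the functions $(b,c)$ take the values $$\left(-\tfrac{1337}{32}\alpha_i^3+\tfrac{3233}{64}\alpha_i^2+\tfrac{12285}{64}\alpha_i+\tfrac{1135}{16},\ -\tfrac{59}{16}\alpha_i^3+\tfrac{147}{32}\alpha_i^2+\tfrac{535}{32}\alpha_i+\tfrac{45}{8}\right),$$ and at the point belonging to $\beta_i$ the values $$\left(-\tfrac{6901}{1024}\beta_i^3-\tfrac{41387}{4096}\beta_i^2+\tfrac{91011}{8192}\beta_i+\tfrac{39449}{8192},\ -\tfrac{139}{16}\beta_i^3-\tfrac{725}{64}\beta_i^2+\tfrac{2301}{128}\beta_i+\tfrac{871}{128}\right).$$ Let $E_{1i}$ and $E_{2i}$ be the curves $E(b,c)$ with these values of $(b,c)$, over $\mathbb{Q}(\alpha_i)$ and $\mathbb{Q}(\beta_i)$ respectively.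 For every $i$, $E_{1i}$ and $E_{2i}$ are elliptic curves, $(0,0)$ is a point of order $17$ on each, and $E_{1i}(\mathbb{Q}(\alpha_i))_{\mathrm{tors}}\cong\mathbb{Z}/17\mathbb{Z}$ and $E_{2i}(\mathbb{Q}(\beta_i))_{\mathrm{tors}}\cong\mathbb{Z}/17\mathbb{Z}$. -/

import Mathlib

open Polynomial
open scoped Polynomial.Bivariate
open scoped Classical

noncomputable section

namespace ModularSeventeen

/-! ### The Tate normal form and the function field of `X₁(N)` -/

/-- The Tate normal form `E(b, c) : Y² + (1 - c)XY - bY = X³ - bX²`. -/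
def tateNormalForm {R : Type*} [CommRing R] (b c : R) : WeierstrassCurve R where
  a₁ := 1 - c
  a₂ := -b
  a₃ := -b
  a₄ := 0
  a₆ := 0

/-- The point `(0, 0)` on a nonsingular Tate normal form. -/
def tateOrigin {K : Type*} [Field K] (b c : K) (hΔ : (tateNormalForm b c).Δ ≠ 0) :
    (tateNormalForm b c).toAffine.Point :=
  .some 0 0 <| (WeierstrassCurve.Affine.equation_iff_nonsingular_of_Δ_ne_zero hΔ).mp <| by
    simp [tateNormalForm]

/-- `F`, with the parameters `b`, `c ∈ F`, is the function field over `ℚ` of the modular curve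
`X₁(N)` (`N ≥ 4`), i.e. `(E(b, c), (0, 0))` over `F` is the generic elliptic curve with a point of
exact order `N`.

Every pair (elliptic curve, point of exact order `N ≥ 4`) over a field has a unique Tate normal
form, so a pair `(b, c)` such that `(0, 0)` has exact order `N` on the elliptic curve `E(b, c)` is a
point of the moduli curve `Y₁(N)`. It is the generic point of this irreducible curve, and `F` is its
residue field, iff `b` and `c` are not both algebraic and generate `F`. -/
structure IsFunctionFieldOfX1 (N : ℕ) {F : Type*} [Field F] [Algebra ℚ F] (b c : F) : Prop where
  /-- the Tate curve is nonsingular and the origin has exact order `N` -/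
  order_eq : ∃ hΔ : (tateNormalForm b c).Δ ≠ 0, addOrderOf (tateOrigin b c hΔ) = N
  /-- the family is not constant -/
  not_constant : ¬ (IsAlgebraic ℚ b ∧ IsAlgebraic ℚ c)
  /-- `F = ℚ(b, c)` -/
  adjoin_eq : IntermediateField.adjoin ℚ {b, c} = ⊤

/-! ### The model `f₁₇(x, y) = 0` of `X₁(17)` -/

/-- `f₁₇(x, y) = y⁴ + (x³+x²-x+2)y³ + (x³-3x+1)y² - (x⁴+2x)y + x³ + x²`. -/
def f17 : ℚ[X][Y] :=
  Y ^ 4 + C (X ^ 3 + X ^ 2 - X + 2) * Y ^ 3 + C (X ^ 3 - 3 * X + 1) * Y ^ 2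
    - C (X ^ 4 + 2 * X) * Y + C (X ^ 3 + X ^ 2)

lemma f17_natDegree : f17.natDegree = 4 := by
  unfold f17; compute_degree!

lemma f17_monic : f17.Monic := by
  unfold f17; monicity!

lemma irreducible_mod_three : Irreducible (X ^ 4 + 2 * X ^ 2 + 2 : (ZMod 3)[X]) := by
  have hd : (X ^ 4 + 2 * X ^ 2 + 2 : (ZMod 3)[X]).natDegree = 4 := by compute_degree!
  have hm : (X ^ 4 + 2 * X ^ 2 + 2 : (ZMod 3)[X]).Monic := by monicity!
  have h1 : (X ^ 4 + 2 * X ^ 2 + 2 : (ZMod 3)[X]) ≠ 1 := by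
    intro h; rw [h, natDegree_one] at hd; omega
  rw [hm.irreducible_iff_lt_natDegree_lt h1, hd]
  intro q hq hqd hdvd
  have hcases : q.natDegree = 1 ∨ q.natDegree = 2 := by
    simp only [Finset.mem_Ioc] at hqd; omega
  rcases hcases with h | h
  · rw [hq.eq_X_add_C h, ← sub_neg_eq_add, ← C_neg, dvd_iff_isRoot] at hdvd
    simp only [IsRoot.def, eval_add, eval_mul, eval_pow, eval_X, eval_ofNat] at hdvd
    revert hdvd
    generalize -q.coeff 0 = a
    revert a; decide
  · set a := q.coeff 1
    set b := q.coeff 0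
    have hqe : q = X ^ 2 + C a * X + C b := by
      have h2 : q.coeff 2 = 1 := by rw [← h]; exact hq
      conv_lhs => rw [q.as_sum_range_C_mul_X_pow, h]
      simp [Finset.sum_range_succ, h2, a, b]; ring
    have hr : q ∣ C (-a * (2 + a ^ 2 - b - b)) * X + C (2 - b * (2 + a ^ 2 - b)) := by
      have hx := dvd_sub hdvd (dvd_mul_right q (X ^ 2 - C a * X + C (2 + a ^ 2 - b)))
      convert hx using 1
      rw [hqe]
      simp only [map_add, map_sub, map_mul, map_neg, map_pow, map_ofNat]
      ring
    have h0 := eq_zero_of_dvd_of_natDegree_lt hr (by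
      rw [h]; exact lt_of_le_of_lt natDegree_linear_le (by norm_num))
    have hc1 := congrArg (fun p => coeff p 1) h0
    have hc0 := congrArg (fun p => coeff p 0) h0
    simp only [coeff_add, coeff_C_mul, coeff_X_one, coeff_C_succ, coeff_X_zero, coeff_C_zero,
      coeff_zero, mul_one, mul_zero, add_zero, zero_add] at hc1 hc0
    revert hc1 hc0
    generalize a = a'
    generalize b = b'
    revert a' b'; decide

lemma f17_irreducible : Irreducible f17 := by
  refine Monic.irreducible_of_irreducible_map (evalRingHom (1 : ℚ)) f17 f17_monic ?_
  have hmZ : (X ^ 4 + 3 * X ^ 3 - X ^ 2 - 3 * X + 2 : ℤ[X]).Monic := by monicity!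
  have hZ : Irreducible (X ^ 4 + 3 * X ^ 3 - X ^ 2 - 3 * X + 2 : ℤ[X]) := by
    refine Monic.irreducible_of_irreducible_map (Int.castRingHom (ZMod 3)) _ hmZ ?_
    convert irreducible_mod_three using 1
    have h3 : (3 : (ZMod 3)[X]) = 0 := by
      rw [← map_ofNat C 3, show (OfNat.ofNat 3 : ZMod 3) = 0 from rfl, C_0]
    simp only [Polynomial.map_add, Polynomial.map_sub, Polynomial.map_mul, Polynomial.map_pow,
      map_X, Polynomial.map_ofNat]
    linear_combination (X ^ 3 - X ^ 2 - X) * h3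
  have hQ := (hmZ.irreducible_iff_irreducible_map_fraction_map (K := ℚ)).mp hZ
  convert hQ using 1
  simp only [f17, Polynomial.map_add, Polynomial.map_sub, Polynomial.map_mul, Polynomial.map_pow,
    map_X, map_C, Polynomial.map_ofNat, coe_evalRingHom, eval_add, eval_sub, eval_mul, eval_pow,
    eval_X, eval_ofNat, eval_one, one_pow, mul_one]
  norm_num
  simp only [map_ofNat]
  ring

/-- The affine coordinate ring `ℚ[x, y] / (f₁₇)`. -/
abbrev CoordRing : Type := AdjoinRoot f17

instance : IsDomain CoordRing := AdjoinRoot.isDomain_of_prime f17_irreducible.prime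

/-- The function field `ℚ(x, y)` of the curve `f₁₇(x, y) = 0`. -/
abbrev FunField : Type := FractionRing CoordRing

/-- The function `x`. -/
def xFn : FunField := algebraMap CoordRing FunField (AdjoinRoot.of f17 X)

/-- The function `y`. -/
def yFn : FunField := algebraMap CoordRing FunField (AdjoinRoot.root f17)

/-- The first parameter of the raw form of `X₁(17)`. -/
def rFn : FunField := (xFn ^ 2 + xFn - yFn) / (xFn ^ 2 + xFn * yFn + xFn - yFn ^ 2 - yFn)

/-- The second parameter of the raw form of `X₁(17)`. -/
def sFn : FunField := (xFn + 1) / (xFn + yFn + 1)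

/-- The parameter `c = s(r - 1)` of the universal Tate normal form over `X₁(17)`. -/
def cFn : FunField := sFn * (rFn - 1)

/-- The parameter `b = cr` of the universal Tate normal form over `X₁(17)`. -/
def bFn : FunField := cFn * rFn

lemma f17_eq_zero : yFn ^ 4 + (xFn ^ 3 + xFn ^ 2 - xFn + 2) * yFn ^ 3
    + (xFn ^ 3 - 3 * xFn + 1) * yFn ^ 2 - (xFn ^ 4 + 2 * xFn) * yFn + xFn ^ 3 + xFn ^ 2 = 0 := by
  have h : algebraMap CoordRing FunField (AdjoinRoot.mk f17
      (Y ^ 4 + C (X ^ 3 + X ^ 2 - X + 2) * Y ^ 3 + C (X ^ 3 - 3 * X + 1) * Y ^ 2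
        - C (X ^ 4 + 2 * X) * Y + C (X ^ 3 + X ^ 2))) = 0 := by
    change algebraMap CoordRing FunField (AdjoinRoot.mk f17 f17) = 0
    rw [AdjoinRoot.mk_self, map_zero]
  simp only [map_add, map_sub, map_mul, map_pow, AdjoinRoot.mk_X, AdjoinRoot.mk_C, map_ofNat,
    map_one] at h
  unfold xFn yFn
  linear_combination h

lemma y_add_one_ne_zero : yFn + 1 ≠ 0 := by
  have h : yFn + 1 = algebraMap CoordRing FunField (AdjoinRoot.mk f17 (Y + 1)) := by
    simp [yFn]
  rw [h, Ne, FaithfulSMul.algebraMap_eq_zero_iff]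
  have hd : (Y + 1 : ℚ[X][Y]).natDegree = 1 := by compute_degree!
  refine AdjoinRoot.mk_ne_zero_of_natDegree_lt f17_monic ?_ (by rw [hd, f17_natDegree]; norm_num)
  intro h0; rw [h0] at hd; simp at hd

lemma x_sub_y_ne_zero : xFn - yFn ≠ 0 := by
  have h : xFn - yFn = algebraMap CoordRing FunField (AdjoinRoot.mk f17 (C X - Y)) := by
    simp [xFn, yFn]
  rw [h, Ne, FaithfulSMul.algebraMap_eq_zero_iff]
  have hd : (C X - Y : ℚ[X][Y]).natDegree = 1 := by compute_degree!
  refine AdjoinRoot.mk_ne_zero_of_natDegree_lt f17_monic ?_ (by rw [hd, f17_natDegree]; norm_num)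
  intro h0; rw [h0] at hd; simp at hd

/-! ### Geometric points of the smooth projective curve `X₁(17)` -/

/-- The algebraic closure `ℚ̄`. -/
abbrev QBar : Type := AlgebraicClosure ℚ

/-- The `ℚ̄`-points of the smooth projective curve over `ℚ` with function field `FunField`: a point
is given by its local ring, a valuation ring of the function field, together with the evaluation
map, an embedding of the residue field into `ℚ̄`. Locality of the evaluation map forces `ℚ` into the
valuation ring (nonzero integers have invertible values) and excludes the trivial valuation ring
(the function field does not embed into `ℚ̄`). All points are included, cusps in particular. -/
structure X1Point where
  /-- the local ring of functions that are regular at the point -/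
  localRing : ValuationSubring FunField
  /-- the value at the point of a regular function -/
  eval : localRing →+* QBar
  /-- a regular function with nonzero value is invertible -/
  isLocal : IsLocalHom eval

namespace X1Point

/-- The function `g` is regular at the point `Q`, with value `t`. -/
def HasValue (Q : X1Point) (g : FunField) (t : QBar) : Prop :=
  ∃ hg : g ∈ Q.localRing, Q.eval ⟨g, hg⟩ = t

/-- The functions `x` and `y` are regular at `Q`, with values `t` and `t'`. -/
def HasCoords (Q : X1Point) (t t' : QBar) : Prop :=
  Q.HasValue xFn t ∧ Q.HasValue yFn t'

/-- The field of definition `ℚ(Q)` of a point: the image in `ℚ̄` of its residue field. -/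
def fieldOfDefinition (Q : X1Point) : IntermediateField ℚ QBar :=
  IntermediateField.adjoin ℚ (Set.range Q.eval)

/-- A quartic point: its field of definition has degree 4 over `ℚ`. -/
def IsQuartic (Q : X1Point) : Prop :=
  Module.finrank ℚ Q.fieldOfDefinition = 4

end X1Point

/-! ### The elliptic curve `E₁₇` and the map `φ₁₇` -/

/-- The elliptic curve `E₁₇ : v² + uv + v = u³ - u² - 6u - 4`. -/
def E17 (K : Type*) [Field K] : WeierstrassCurve K where
  a₁ := 1
  a₂ := -1
  a₃ := 1
  a₄ := -6
  a₆ := -4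

instance (K : Type*) [Field K] [CharZero K] : (E17 K).IsElliptic where
  isUnit := by
    have h : (E17 K).Δ = 289 := by
      simp only [WeierstrassCurve.Δ, WeierstrassCurve.b₂, WeierstrassCurve.b₄, WeierstrassCurve.b₆,
        WeierstrassCurve.b₈, E17]
      norm_num
    rw [h]
    exact isUnit_iff_ne_zero.mpr (by norm_num)

lemma E17_equation_iff {K : Type*} [Field K] (u v : K) : (E17 K).toAffine.Equation u v ↔
    v ^ 2 + u * v + v = u ^ 3 - u ^ 2 - 6 * u - 4 := by
  rw [WeierstrassCurve.Affine.equation_iff]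
  simp only [E17]
  constructor <;> intro h <;> linear_combination h

/-- The rational point `P₁ = (3, -2)` of `E₁₇`. -/
def P1 (K : Type*) [Field K] [CharZero K] : (E17 K).toAffine.Point :=
  .mk (x := 3) (y := -2) <| by rw [E17_equation_iff]; norm_num

/-- The rational point `P₂ = (-5/4, 1/8)` of `E₁₇`. -/
def P2 (K : Type*) [Field K] [CharZero K] : (E17 K).toAffine.Point :=
  .mk (x := -5 / 4) (y := 1 / 8) <| by rw [E17_equation_iff]; norm_num

/-- The first coordinate function of `φ₁₇`. -/
def p1 : FunField := (xFn ^ 2 + xFn * yFn - yFn ^ 2 + xFn - 2 * yFn - 1) / (yFn + 1) ^ 2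

/-- The second coordinate function of `φ₁₇`. -/
def p2 : FunField :=
  (xFn ^ 3 * yFn ^ 2 - xFn ^ 4 + 2 * xFn ^ 3 * yFn + 2 * xFn ^ 2 * yFn ^ 2 - xFn ^ 3
    + xFn ^ 2 * yFn + yFn ^ 3 - xFn * yFn + yFn ^ 2) / ((yFn + 1) ^ 2 * (xFn - yFn))

lemma p1_p2_equation : p2 ^ 2 + p1 * p2 + p2 = p1 ^ 3 - p1 ^ 2 - 6 * p1 - 4 := by
  have hy := y_add_one_ne_zero
  have hxy := x_sub_y_ne_zero
  have hf := f17_eq_zero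
  unfold p1 p2
  generalize xFn = x at *
  generalize yFn = y at *
  rw [← sub_eq_zero]
  field_simp
  linear_combination (y^2 + 2*y^3 + y^4 + x + 2*x*y + 2*x*y^2 + x*y^3 + 4*x^2 + 11*x^2*y
    + 10*x^2*y^2 + 3*x^2*y^3 + 2*x^3 + 7*x^3*y + 5*x^3*y^2 + x^3*y^3 - 2*x^4 - x^4*y) * hf

lemma equation_eval (Q : X1Point) (h₁ : p1 ∈ Q.localRing) (h₂ : p2 ∈ Q.localRing) :
    (E17 QBar).toAffine.Equation (Q.eval ⟨p1, h₁⟩) (Q.eval ⟨p2, h₂⟩) := by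
  rw [E17_equation_iff]
  have h : (⟨p2, h₂⟩ : Q.localRing) ^ 2 + ⟨p1, h₁⟩ * ⟨p2, h₂⟩ + ⟨p2, h₂⟩
      = (⟨p1, h₁⟩ : Q.localRing) ^ 3 - ⟨p1, h₁⟩ ^ 2 - 6 * ⟨p1, h₁⟩ - 4 :=
    Subtype.ext p1_p2_equation
  simpa only [map_add, map_sub, map_mul, map_pow, map_ofNat] using congrArg Q.eval h

/-- The morphism `φ₁₇ : X₁(17) → E₁₇`, `(x, y) ↦ (p₁(x, y), p₂(x, y))`, on `ℚ̄`-points. At a point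
where `p₁` or `p₂` has a pole, the value is the point at infinity of `E₁₇`. -/
def phi17 (Q : X1Point) : (E17 QBar).toAffine.Point :=
  if h : p1 ∈ Q.localRing ∧ p2 ∈ Q.localRing then .mk (equation_eval Q h.1 h.2) else 0

/-! ### The explicit coefficients of the Tate normal forms -/

variable {K : Type*} [Field K]

/-- The parameter `b` of the curve `E₁ᵢ` attached to the root `α = αᵢ`. -/
def b1 (α : K) : K := -(1337 / 32) * α ^ 3 + 3233 / 64 * α ^ 2 + 12285 / 64 * α + 1135 / 16

/-- The parameter `c` of the curve `E₁ᵢ` attached to the root `α = αᵢ`. -/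
def c1 (α : K) : K := -(59 / 16) * α ^ 3 + 147 / 32 * α ^ 2 + 535 / 32 * α + 45 / 8

/-- The parameter `b` of the curve `E₂ᵢ` attached to the root `β = βᵢ`. -/
def b2 (β : K) : K :=
  -(6901 / 1024) * β ^ 3 - 41387 / 4096 * β ^ 2 + 91011 / 8192 * β + 39449 / 8192

/-- The parameter `c` of the curve `E₂ᵢ` attached to the root `β = βᵢ`. -/
def c2 (β : K) : K := -(139 / 16) * β ^ 3 - 725 / 64 * β ^ 2 + 2301 / 128 * β + 871 / 128

/-- The roots `αᵢ` of `2x⁴ - 5x³ - 7x² + 10x + 8`. -/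
def alphaRoots : Set QBar := {α | 2 * α ^ 4 - 5 * α ^ 3 - 7 * α ^ 2 + 10 * α + 8 = 0}

/-- The roots `βᵢ` of `8x⁴ + 14x³ - 11x² - 11x - 2`. -/
def betaRoots : Set QBar := {β | 8 * β ^ 4 + 14 * β ^ 3 - 11 * β ^ 2 - 11 * β - 2 = 0}

/-- The field `L` is a cyclic quartic extension of `ℚ`. -/
def IsCyclicQuartic (L : Type*) [Field L] [Algebra ℚ L] : Prop :=
  Module.finrank ℚ L = 4 ∧ IsGalois ℚ L ∧ IsCyclic (L ≃ₐ[ℚ] L)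

/-- `E(b, c)` is an elliptic curve over `K` on which `(0, 0)` has order 17, and its torsion subgroup
`E(b, c)(K)_tors` is isomorphic to `ℤ/17ℤ`. -/
def HasTorsionSeventeen (b c : K) : Prop :=
  ∃ hΔ : (tateNormalForm b c).Δ ≠ 0,
    addOrderOf (tateOrigin b c hΔ) = 17 ∧
    Nonempty (AddCommGroup.torsion (tateNormalForm b c).toAffine.Point ≃+ ZMod 17)

end ModularSeventeen

end

open ModularSeventeen

/-! The model. Put b = cr, c = s(r - 1) and P = (0, 0) on E(b, c). Repeated duplication gives 2P,
4P, 8P as rational expressions in r and s, and away from the cuspidal factors the equation `raw17 r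
s = 0` forces 16P = -P (`addOrderOf_tateOrigin_eq`). The substitution (x, y) ↦ (r, s) carries f₁₇ =
0 into this equation (`raw17_rOf_sOf`). It has a rational inverse, and r = b/c, s = c²/(b - c), so x
and y are rational in b and c. Hence b and c generate the function field, and they cannot both be
algebraic because x is transcendental. The functions that must be nonzero are nonzero because they
take nonzero values at a single explicit point (`generic_nonvanishing`).

The fibres. Let w = x/(y + 1) and t = y + 1. Then p₁ = w² + w - 1, and the model becomes a quartic
in t with leading coefficient w³. So w is regular wherever p₁ is, and t is regular where moreover w
≠ 0 (`exists_hasValue_wFn`, `exists_hasValue_tFn`). Therefore every place over P₁ or P₂, cusps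
included, has finite coordinates, and elimination determines them. Conversely ∂f₁₇/∂y does not
vanish at the points found, so the local ring there is a valuation ring and exactly one place lies
over each (`IsSmoothPoint.existsUnique`).

The fields. Both quartics are irreducible because a rescaling is irreducible modulo 3. An explicit
polynomial map permutes the roots with order 4, so the root field is cyclic over ℚ
(`isCyclicQuartic_adjoin`).

The torsion. The quartic field embeds into ℚ₅₃ and ℚ₄₃. Torsion points over ℚ_p, p odd, have
integral coordinates, and they inject into the special fibre when that has no point with 2y + a₁x +
a₃ = 0 (`reduction_injective`). Both facts rest on `HasIntegralModel.eq_zero_of_nearInfinity`: near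
infinity the parameter z = x/η, with η = y + (a₁x + a₃)/2, is additive up to cubic terms, which is
incompatible with torsion. The place 53 bounds the torsion by 51 and excludes order 2, and the place
43 excludes order 3. A multiple of 17 that is at most 51 and prime to 6 is 17. -/

noncomputable section

namespace ModularSeventeen

/-! ### Points of a Weierstrass curve near infinity over a nonarchimedean field -/

section Nonarchimedean

variable {K : Type*} [NormedField K] [IsUltrametricDist K]

lemma norm_add_le_of_le {a b : K} {M : ℝ} (ha : ‖a‖ ≤ M) (hb : ‖b‖ ≤ M) : ‖a + b‖ ≤ M :=
  (IsUltrametricDist.norm_add_le_max a b).trans (max_le ha hb)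

lemma norm_sub_le_of_le {a b : K} {M : ℝ} (ha : ‖a‖ ≤ M) (hb : ‖b‖ ≤ M) : ‖a - b‖ ≤ M := by
  rw [sub_eq_add_neg]; exact norm_add_le_of_le ha (by rwa [norm_neg])

lemma norm_eq_of_norm_sub_lt {a b : K} (h : ‖a - b‖ < ‖b‖) : ‖a‖ = ‖b‖ := by
  have := IsUltrametricDist.norm_add_eq_max_of_norm_ne_norm h.ne
  rwa [sub_add_cancel, max_eq_right h.le] at this

lemma norm_natCast_le_one' (n : ℕ) : ‖(n : K)‖ ≤ 1 := IsUltrametricDist.norm_natCast_le_one K n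

/-- For ‖x‖ > 1 the cubic term strictly dominates the others, which have norm at most ‖x‖². -/
lemma norm_sq_eq_cube {A B C x η : K} (hA : ‖A‖ ≤ 1) (hB : ‖B‖ ≤ 1) (hC : ‖C‖ ≤ 1)
    (hx : 1 < ‖x‖) (h : η ^ 2 = x ^ 3 + A * x ^ 2 + B * x + C) : ‖η‖ ^ 2 = ‖x‖ ^ 3 := by
  rw [← norm_pow, ← norm_pow]
  apply norm_eq_of_norm_sub_lt
  have hle : ‖η ^ 2 - x ^ 3‖ ≤ ‖x‖ ^ 2 := by
    have : η ^ 2 - x ^ 3 = A * x ^ 2 + B * x + C := by rw [h]; ring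
    rw [this]
    have h1 : (1 : ℝ) ≤ ‖x‖ ^ 2 := by nlinarith
    refine norm_add_le_of_le (norm_add_le_of_le ?_ ?_) (hC.trans h1)
    · rw [norm_mul, norm_pow]; nlinarith
    · rw [norm_mul]; nlinarith [norm_nonneg B]
  rw [norm_pow]
  nlinarith [pow_pos (zero_lt_one.trans hx) 2]

/-- The three roots of the cubic cutting out a line on a Weierstrass curve. -/
structure Collinear (A B C l n x₁ x₂ x₃ : K) : Prop where
  s1 : x₁ + x₂ + x₃ = l ^ 2 - A
  s2 : x₁ * x₂ + x₁ * x₃ + x₂ * x₃ = B - 2 * l * n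
  s3 : x₁ * x₂ * x₃ = n ^ 2 - C

/-- Let a ≤ b be the norms of x₁, x₂ and suppose that x₃ has norm c < a. Then x₁x₂ dominates the
second symmetric function, so ‖ln‖ = ab. The first and third symmetric functions give ‖l‖² ≤ b and
‖n‖² ≤ max(abc, 1), and then (ab)² ≤ b · max(abc, 1) < (ab)², a contradiction. -/
lemma Collinear.le_norm_of_le {A B C l n x₁ x₂ x₃ : K} (h : Collinear A B C l n x₁ x₂ x₃)
    (h2 : ‖(2 : K)‖ = 1) (hA : ‖A‖ ≤ 1) (hB : ‖B‖ ≤ 1) (hC : ‖C‖ ≤ 1) (h₁ : 1 < ‖x₁‖)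
    (h₁₂ : ‖x₁‖ ≤ ‖x₂‖) : ‖x₁‖ ≤ ‖x₃‖ := by
  by_contra! hlt
  have h₀ := norm_nonneg x₃
  set a := ‖x₁‖ with ha
  set b := ‖x₂‖ with hb
  set c := ‖x₃‖ with hc
  have hab : 1 < a * b := by nlinarith
  have e1 : ‖(x₁ * x₂ + x₁ * x₃ + x₂ * x₃) - x₁ * x₂‖ < ‖x₁ * x₂‖ := by
    have : (x₁ * x₂ + x₁ * x₃ + x₂ * x₃) - x₁ * x₂ = (x₁ + x₂) * x₃ := by ring
    rw [this, norm_mul, norm_mul]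
    have h3 : ‖x₁ + x₂‖ ≤ b := norm_add_le_of_le h₁₂ le_rfl
    calc ‖x₁ + x₂‖ * c ≤ b * c := by gcongr
      _ < a * b := by nlinarith
  have e2 := norm_eq_of_norm_sub_lt e1
  have e3 : ‖l * n‖ = a * b := by
    have h4 : ‖2 * l * n - (-(x₁ * x₂ + x₁ * x₃ + x₂ * x₃))‖
        < ‖-(x₁ * x₂ + x₁ * x₃ + x₂ * x₃)‖ := by
      rw [norm_neg, e2, norm_mul, h.s2]
      have : 2 * l * n - -(B - 2 * l * n) = B := by ring
      rw [this]; exact hB.trans_lt hab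
    have h5 := norm_eq_of_norm_sub_lt h4
    rw [norm_neg, e2, mul_assoc, norm_mul, h2, one_mul, norm_mul x₁] at h5
    exact h5
  have e4 : ‖l‖ ^ 2 ≤ b := by
    rw [← norm_pow, show l ^ 2 = x₁ + x₂ + x₃ + A by rw [h.s1]; ring]
    exact norm_add_le_of_le (norm_add_le_of_le (norm_add_le_of_le h₁₂ le_rfl) (hlt.le.trans h₁₂))
      (by linarith)
  have e5 : ‖n‖ ^ 2 ≤ max (a * b * c) 1 := by
    rw [← norm_pow, show n ^ 2 = x₁ * x₂ * x₃ + C by rw [h.s3]; ring]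
    refine norm_add_le_of_le (le_max_of_le_left ?_) (le_max_of_le_right hC)
    rw [norm_mul, norm_mul]
  have e6 : (a * b) ^ 2 ≤ b * max (a * b * c) 1 := by
    calc (a * b) ^ 2 = ‖l‖ ^ 2 * ‖n‖ ^ 2 := by rw [← e3, norm_mul, mul_pow]
      _ ≤ b * max (a * b * c) 1 := by gcongr
  have e7 : b * max (a * b * c) 1 < (a * b) ^ 2 := by
    rcases max_choice (a * b * c) 1 with h' | h' <;> rw [h']
    · have hb0 : 0 < b := by linarith
      have : b * (a * b * c) < b * (a * b * a) := by gcongr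
      nlinarith
    · nlinarith
  linarith

omit [IsUltrametricDist K] in
lemma Collinear.swap {A B C l n x₁ x₂ x₃ : K} (h : Collinear A B C l n x₁ x₂ x₃) :
    Collinear A B C l n x₂ x₁ x₃ :=
  ⟨by linear_combination h.s1, by linear_combination h.s2, by linear_combination h.s3⟩

/-- Near infinity ‖x‖ is the inverse square of the norm of the local parameter, so this bounds the
parameter of the third point by the larger of the other two. -/
lemma Collinear.min_le_norm {A B C l n x₁ x₂ x₃ : K} (h : Collinear A B C l n x₁ x₂ x₃)
    (h2 : ‖(2 : K)‖ = 1) (hA : ‖A‖ ≤ 1) (hB : ‖B‖ ≤ 1) (hC : ‖C‖ ≤ 1) (h₁ : 1 < ‖x₁‖)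
    (h₂ : 1 < ‖x₂‖) : min ‖x₁‖ ‖x₂‖ ≤ ‖x₃‖ := by
  rcases le_total ‖x₁‖ ‖x₂‖ with h' | h'
  · exact (min_le_left _ _).trans (h.le_norm_of_le h2 hA hB hC h₁ h')
  · exact (min_le_right _ _).trans (h.swap.le_norm_of_le h2 hA hB hC h₂ h')

/-- Near infinity the parameter `x / η` is additive up to terms of third order. -/
lemma Collinear.norm_sum_le {A B C l n x₁ x₂ x₃ : K} (h : Collinear A B C l n x₁ x₂ x₃)
    (hA : ‖A‖ ≤ 1) (hB : ‖B‖ ≤ 1) (hC : ‖C‖ ≤ 1) (h₁ : 1 < ‖x₁‖)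
    (h₂ : 1 < ‖x₂‖) (h₃ : 1 < ‖x₃‖) (n₁ : l * x₁ + n ≠ 0) (n₂ : l * x₂ + n ≠ 0)
    (n₃ : l * x₃ + n ≠ 0) :
    ‖x₁ / (l * x₁ + n) + x₂ / (l * x₂ + n) + x₃ / (l * x₃ + n)‖ ≤
      ‖x₁ / (l * x₁ + n)‖ * ‖x₂ / (l * x₂ + n)‖ * ‖x₃ / (l * x₃ + n)‖ := by
  -- The numerator is n²e₁ + 2ln·e₂ + 3l²e₃ in the symmetric functions eᵢ of the xᵢ. The large terms
  -- l²n² occur with coefficients 1 - 4 + 3 = 0 and cancel; this makes the error cubic.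
  have key : x₁ / (l * x₁ + n) + x₂ / (l * x₂ + n) + x₃ / (l * x₃ + n) =
      -(3 * C * l ^ 2 - 2 * B * (l * n) + A * n ^ 2) /
        ((l * x₁ + n) * (l * x₂ + n) * (l * x₃ + n)) := by
    rw [div_add_div _ _ n₁ n₂, div_add_div _ _ (mul_ne_zero n₁ n₂) n₃]
    congr 1
    linear_combination n ^ 2 * h.s1 + 2 * l * n * h.s2 + 3 * l ^ 2 * h.s3
  have h₁' := norm_nonneg x₁
  have hp2 : 1 ≤ ‖x₁‖ * ‖x₂‖ := by nlinarith
  have hp : 1 ≤ ‖x₁‖ * ‖x₂‖ * ‖x₃‖ := by nlinarith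
  have b1 : ‖x₁‖ ≤ ‖x₁‖ * ‖x₂‖ * ‖x₃‖ := by nlinarith [mul_nonneg h₁' (norm_nonneg x₂)]
  have b2 : ‖x₂‖ ≤ ‖x₁‖ * ‖x₂‖ * ‖x₃‖ := by nlinarith [mul_nonneg h₁' (norm_nonneg x₂)]
  have b3 : ‖x₃‖ ≤ ‖x₁‖ * ‖x₂‖ * ‖x₃‖ := by nlinarith
  have el : ‖l‖ ^ 2 ≤ ‖x₁‖ * ‖x₂‖ * ‖x₃‖ := by
    rw [← norm_pow, show l ^ 2 = x₁ + x₂ + x₃ + A by rw [h.s1]; ring]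
    exact norm_add_le_of_le (norm_add_le_of_le (norm_add_le_of_le b1 b2) b3) (hA.trans hp)
  have en : ‖n‖ ^ 2 ≤ ‖x₁‖ * ‖x₂‖ * ‖x₃‖ := by
    rw [← norm_pow, show n ^ 2 = x₁ * x₂ * x₃ + C by rw [h.s3]; ring]
    refine norm_add_le_of_le ?_ (hC.trans hp)
    rw [norm_mul, norm_mul]
  have eln : ‖l * n‖ ≤ ‖x₁‖ * ‖x₂‖ * ‖x₃‖ := by
    rw [norm_mul]; nlinarith [sq_nonneg (‖l‖ - ‖n‖)]
  have hmul : ∀ {c z : K}, ‖c‖ ≤ 1 → ‖z‖ ≤ ‖x₁‖ * ‖x₂‖ * ‖x₃‖ →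
      ‖c * z‖ ≤ ‖x₁‖ * ‖x₂‖ * ‖x₃‖ := fun {c z} hc hz => by
    rw [norm_mul]; nlinarith [norm_nonneg c, norm_nonneg z]
  have h2le : ‖(2 : K)‖ ≤ 1 := by exact_mod_cast norm_natCast_le_one' (K := K) 2
  have h3le : ‖(3 : K)‖ ≤ 1 := by exact_mod_cast norm_natCast_le_one' (K := K) 3
  have hnum : ‖-(3 * C * l ^ 2 - 2 * B * (l * n) + A * n ^ 2)‖ ≤ ‖x₁‖ * ‖x₂‖ * ‖x₃‖ := by
    rw [norm_neg]
    refine norm_add_le_of_le (norm_sub_le_of_le (hmul ?_ (by rwa [norm_pow])) (hmul ?_ eln))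
      (hmul hA (by rwa [norm_pow]))
    · rw [norm_mul]; exact mul_le_one₀ h3le (norm_nonneg _) hC
    · rw [norm_mul]; exact mul_le_one₀ h2le (norm_nonneg _) hB
  rw [key, norm_div, norm_mul, norm_mul, norm_div, norm_div, norm_div,
    div_mul_div_comm, div_mul_div_comm]
  gcongr

end Nonarchimedean

/-! ### Approximate additivity of the local parameter at infinity. -/

section NearInfinity

open WeierstrassCurve WeierstrassCurve.Affine

/-- The line y = λx + ν becomes η = (λ + a₁/2)x + (ν + a₃/2) after completing the square, which
explains the shifts. Comparing coefficients in `addPolynomial_slope` treats chords and tangents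
together. -/
lemma collinear_slope {K : Type*} [NormedField K] (h2 : (2 : K) ≠ 0) (W : WeierstrassCurve K)
    {x₁ x₂ y₁ y₂ : K}
    (h₁ : W.toAffine.Equation x₁ y₁) (h₂ : W.toAffine.Equation x₂ y₂)
    (hxy : ¬(x₁ = x₂ ∧ y₁ = W.toAffine.negY x₂ y₂)) :
    Collinear (W.b₂ / 4) (W.b₄ / 2) (W.b₆ / 4) (W.toAffine.slope x₁ x₂ y₁ y₂ + W.a₁ / 2)
      (y₁ - W.toAffine.slope x₁ x₂ y₁ y₂ * x₁ + W.a₃ / 2) x₁ x₂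
      (W.toAffine.addX x₁ x₂ (W.toAffine.slope x₁ x₂ y₁ y₂)) := by
  have h := addPolynomial_slope h₁ h₂ hxy
  rw [addPolynomial_eq, neg_inj, Cubic.prod_X_sub_C_eq, Cubic.toPoly_injective,
    Cubic.mk.injEq] at h
  obtain ⟨-, hb, hc, hd⟩ := h
  dsimp only [WeierstrassCurve.toAffine] at hb hc hd
  generalize W.toAffine.slope x₁ x₂ y₁ y₂ = l at *
  generalize W.toAffine.addX x₁ x₂ l = x₃ at *
  have h4 : (4 : K) ≠ 0 := by rw [show (4 : K) = 2 * 2 by norm_num]; exact mul_ne_zero h2 h2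
  refine ⟨?_, ?_, ?_⟩
  · rw [WeierstrassCurve.b₂]; field_simp; linear_combination 16 * hb
  · rw [WeierstrassCurve.b₄]; field_simp; linear_combination -2 * hc
  · rw [WeierstrassCurve.b₆]; field_simp; linear_combination 16 * hd

/-- This places both points on one line, for chords and tangents alike, so that their values of η
are given by the same l and n. -/
lemma Y_slope {K : Type*} [Field K] (W : WeierstrassCurve K) {x₁ x₂ y₁ y₂ : K}
    (h₁ : W.toAffine.Equation x₁ y₁) (h₂ : W.toAffine.Equation x₂ y₂)
    (hxy : ¬(x₁ = x₂ ∧ y₁ = W.toAffine.negY x₂ y₂)) :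
    y₂ = y₁ + W.toAffine.slope x₁ x₂ y₁ y₂ * (x₂ - x₁) := by
  by_cases hx : x₁ = x₂
  · have := Y_eq_of_Y_ne h₁ h₂ hx fun h => hxy ⟨hx, h⟩
    rw [hx, this]; ring
  · rw [slope_of_X_ne hx]
    have := sub_ne_zero.mpr hx
    field_simp
    ring

variable {K : Type*} [NormedField K] (W : WeierstrassCurve K)

/-- The local parameter at infinity `x / (y + (a₁x + a₃) / 2)`. -/
def localParameter : W.toAffine.Point → K
  | .zero => 0
  | .some x y _ => x / (y + (W.a₁ * x + W.a₃) / 2)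

/-- The point is at infinity or its `x`-coordinate is not integral. -/
def NearInfinity : W.toAffine.Point → Prop
  | .zero => True
  | .some x _ _ => 1 < ‖x‖

/-- A Weierstrass curve with integral coefficients over a field in which `2` is a unit. -/
structure HasIntegralModel : Prop where
  two : ‖(2 : K)‖ = 1
  h₁ : ‖W.a₁‖ ≤ 1
  h₂ : ‖W.a₂‖ ≤ 1
  h₃ : ‖W.a₃‖ ≤ 1
  h₄ : ‖W.a₄‖ ≤ 1
  h₆ : ‖W.a₆‖ ≤ 1

variable {W}

lemma HasIntegralModel.two_ne_zero (hW : HasIntegralModel W) : (2 : K) ≠ 0 := by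
  intro h; have := hW.two; rw [h, norm_zero] at this; norm_num at this

lemma equation_completed_square (h2 : (2 : K) ≠ 0) {x y : K} (h : W.toAffine.Equation x y) :
    (y + (W.a₁ * x + W.a₃) / 2) ^ 2 =
      x ^ 3 + W.b₂ / 4 * x ^ 2 + W.b₄ / 2 * x + W.b₆ / 4 := by
  rw [equation_iff] at h
  dsimp only [WeierstrassCurve.toAffine] at h
  have h4 : (4 : K) ≠ 0 := by rw [show (4 : K) = 2 * 2 by norm_num]; exact mul_ne_zero h2 h2
  simp only [WeierstrassCurve.b₂, WeierstrassCurve.b₄, WeierstrassCurve.b₆]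
  field_simp
  linear_combination 16 * h

lemma localParameter_neg (h2 : (2 : K) ≠ 0) (P : W.toAffine.Point) :
    localParameter W (-P) = -localParameter W P := by
  rcases P with _ | ⟨x, y, h⟩
  · exact neg_zero.symm
  · simp only [Point.neg_some, localParameter, negY]
    rw [← div_neg]
    congr 1
    dsimp only [WeierstrassCurve.toAffine]
    field_simp
    ring

variable [IsUltrametricDist K]

lemma HasIntegralModel.norm_b (hW : HasIntegralModel W) :
    ‖W.b₂ / 4‖ ≤ 1 ∧ ‖W.b₄ / 2‖ ≤ 1 ∧ ‖W.b₆ / 4‖ ≤ 1 := by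
  have h4 : ‖(4 : K)‖ = 1 := by
    rw [show (4 : K) = 2 * 2 by norm_num, norm_mul, hW.two, one_mul]
  have hm : ∀ {a b : K}, ‖a‖ ≤ 1 → ‖b‖ ≤ 1 → ‖a * b‖ ≤ 1 := fun ha hb => by
    rw [norm_mul]; exact mul_le_one₀ ha (norm_nonneg _) hb
  have hs : ∀ {a : K}, ‖a‖ ≤ 1 → ‖a ^ 2‖ ≤ 1 := fun ha => by
    rw [norm_pow]; exact pow_le_one₀ (norm_nonneg _) ha
  obtain ⟨h2, h₁, h₂, h₃, h₄, h₆⟩ := hW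
  simp only [norm_div, h4, h2, div_one, WeierstrassCurve.b₂, WeierstrassCurve.b₄,
    WeierstrassCurve.b₆]
  exact ⟨norm_add_le_of_le (hs h₁) (hm h4.le h₂), norm_add_le_of_le (hm h2.le h₄) (hm h₁ h₃),
    norm_add_le_of_le (hs h₃) (hm h4.le h₆)⟩

lemma HasIntegralModel.norm_eta_sq (hW : HasIntegralModel W) {x y : K}
    (h : W.toAffine.Equation x y) (hx : 1 < ‖x‖) :
    ‖y + (W.a₁ * x + W.a₃) / 2‖ ^ 2 = ‖x‖ ^ 3 :=
  norm_sq_eq_cube hW.norm_b.1 hW.norm_b.2.1 hW.norm_b.2.2 hx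
    (equation_completed_square hW.two_ne_zero h)

lemma HasIntegralModel.eta_ne_zero (hW : HasIntegralModel W) {x y : K}
    (h : W.toAffine.Equation x y) (hx : 1 < ‖x‖) : y + (W.a₁ * x + W.a₃) / 2 ≠ 0 := by
  intro h0
  have := hW.norm_eta_sq h hx
  rw [h0, norm_zero] at this
  have : 0 < ‖x‖ ^ 3 := by positivity
  nlinarith

/-- Since ‖η‖² = ‖x‖³, the quotient z = x/η has ‖z‖² = ‖x‖⁻¹, so sizes of z and of x can be
exchanged. -/
lemma HasIntegralModel.norm_localParameter_sq (hW : HasIntegralModel W) {x y : K}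
    {h : W.toAffine.Nonsingular x y} (hx : 1 < ‖x‖) :
    ‖localParameter W (.some x y h)‖ ^ 2 * ‖x‖ = 1 := by
  have := hW.norm_eta_sq h.1 hx
  have hx0 : ‖x‖ ≠ 0 := by linarith
  rw [localParameter, norm_div, div_pow, this]
  field_simp

lemma HasIntegralModel.norm_localParameter_lt_one (hW : HasIntegralModel W)
    {P : W.toAffine.Point} (hP : NearInfinity W P) : ‖localParameter W P‖ < 1 := by
  rcases P with _ | ⟨x, y, h⟩
  · simp [localParameter]
  · have h1 := hW.norm_localParameter_sq (h := h) hP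
    have h2 : 1 < ‖x‖ := hP
    by_contra! hle
    nlinarith [one_le_pow₀ (n := 2) hle]

lemma HasIntegralModel.localParameter_ne_zero (hW : HasIntegralModel W)
    {P : W.toAffine.Point} (hP : NearInfinity W P) (h0 : P ≠ 0) : localParameter W P ≠ 0 := by
  rcases P with _ | ⟨x, y, h⟩
  · exact absurd rfl h0
  · intro h1
    have := hW.norm_localParameter_sq (h := h) hP
    rw [h1] at this
    simp at this

/-- The chord or tangent through P and Q meets the curve again at -(P + Q), whose parameter is the
negative of that of P + Q. Collinearity bounds the sum of the three parameters by the product of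
their norms. This replaces the formal group. -/
lemma HasIntegralModel.add (hW : HasIntegralModel W) {P Q : W.toAffine.Point} {ε : ℝ}
    (hP : NearInfinity W P) (hQ : NearInfinity W Q) (hPε : ‖localParameter W P‖ ≤ ε)
    (hQε : ‖localParameter W Q‖ ≤ ε) :
    NearInfinity W (P + Q) ∧ ‖localParameter W (P + Q)‖ ≤ ε ∧
      ‖localParameter W (P + Q) - localParameter W P - localParameter W Q‖ ≤ ε ^ 3 := by
  have hε : 0 ≤ ε := (norm_nonneg _).trans hPε
  rcases P with _ | ⟨x₁, y₁, h₁⟩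
  · rw [← Point.zero_def, zero_add]
    refine ⟨hQ, hQε, ?_⟩
    simp [localParameter]; positivity
  rcases Q with _ | ⟨x₂, y₂, h₂⟩
  · rw [← Point.zero_def, add_zero]
    refine ⟨hP, hPε, ?_⟩
    simp [localParameter]; positivity
  by_cases hxy : x₁ = x₂ ∧ y₁ = W.toAffine.negY x₂ y₂
  · have hneg : Point.some x₁ y₁ h₁ = -Point.some x₂ y₂ h₂ := by
      rw [Point.neg_some]; simp [hxy.1, hxy.2]
    rw [hneg, neg_add_cancel, localParameter_neg hW.two_ne_zero]
    refine ⟨trivial, ?_, ?_⟩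
    · simpa [Point.zero_def, localParameter] using hε
    · simp [localParameter]; positivity
  have hcol := collinear_slope hW.two_ne_zero W h₁.1 h₂.1 hxy
  have hy := Y_slope W h₁.1 h₂.1 hxy
  have h₃ := nonsingular_add h₁ h₂ hxy
  have hsum : Point.some x₁ y₁ h₁ + Point.some x₂ y₂ h₂ = Point.some _ _ h₃ :=
    Point.add_some hxy
  rw [hsum]
  obtain ⟨hA, hB, hC⟩ := hW.norm_b
  have hmin := hcol.min_le_norm hW.two hA hB hC hP hQ
  set l := W.toAffine.slope x₁ x₂ y₁ y₂ with hl
  set x₃ := W.toAffine.addX x₁ x₂ l with hx₃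
  have hx₃' : 1 < ‖x₃‖ := (lt_min hP hQ).trans_le hmin
  have h2 := hW.two_ne_zero
  have e₁ : y₁ + (W.a₁ * x₁ + W.a₃) / 2 = (l + W.a₁ / 2) * x₁ + (y₁ - l * x₁ + W.a₃ / 2) := by
    ring
  have e₂ : y₂ + (W.a₁ * x₂ + W.a₃) / 2 = (l + W.a₁ / 2) * x₂ + (y₁ - l * x₁ + W.a₃ / 2) := by
    rw [hy]; ring
  have e₃ : W.toAffine.addY x₁ x₂ y₁ l + (W.a₁ * x₃ + W.a₃) / 2 =
      -((l + W.a₁ / 2) * x₃ + (y₁ - l * x₁ + W.a₃ / 2)) := by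
    rw [addY, negAddY, negY, ← hx₃]; field_simp; ring
  have n₁ := hW.eta_ne_zero h₁.1 hP
  have n₂ := hW.eta_ne_zero h₂.1 hQ
  have n₃ := hW.eta_ne_zero h₃.1 hx₃'
  have q₁ := hW.norm_localParameter_sq (h := h₁) hP
  have q₂ := hW.norm_localParameter_sq (h := h₂) hQ
  have q₃ := hW.norm_localParameter_sq (h := h₃) hx₃'
  have hP' : 1 < ‖x₁‖ := hP
  have hQ' : 1 < ‖x₂‖ := hQ
  have h₃ε : ‖localParameter W (.some _ _ h₃)‖ ≤ ε := by
    have aux : ∀ {u v a b : ℝ}, 0 ≤ u → 0 ≤ v → 0 < a → a ≤ b → u ^ 2 * a = 1 → v ^ 2 * b = 1 →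
        v ≤ u := fun {u v a b} hu hv ha hab h1 h2 => by
      by_contra! hlt
      have : u ^ 2 < v ^ 2 := by gcongr
      nlinarith [sq_nonneg v]
    rcases min_le_iff.mp hmin with h' | h'
    · exact (aux (norm_nonneg _) (norm_nonneg _) (by linarith) h' q₁ q₃).trans hPε
    · exact (aux (norm_nonneg _) (norm_nonneg _) (by linarith) h' q₂ q₃).trans hQε
  refine ⟨hx₃', h₃ε, ?_⟩
  have hfin := hcol.norm_sum_le hA hB hC hP hQ hx₃' (e₁ ▸ n₁) (e₂ ▸ n₂)
    (by rw [e₃] at n₃; exact neg_ne_zero.mp n₃)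
  have p₃ : x₃ / ((l + W.a₁ / 2) * x₃ + (y₁ - l * x₁ + W.a₃ / 2)) =
      -localParameter W (.some _ _ h₃) := by
    rw [localParameter, e₃, div_neg, neg_neg]
  rw [← e₁, ← e₂, p₃, norm_neg] at hfin
  rw [← norm_neg]
  calc _ = ‖localParameter W (.some x₁ y₁ h₁) + localParameter W (.some x₂ y₂ h₂) +
          -localParameter W (.some _ _ h₃)‖ := by congr 1; ring
    _ ≤ _ := hfin
    _ ≤ ε * ε * ε := by
      gcongr
      · exact hPε
      · exact hQε
    _ = ε ^ 3 := by ring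

/-- Errors do not accumulate in an ultrametric: each further addition of P contributes at most
‖z(P)‖³, and the maximum of such bounds is the same bound. -/
lemma HasIntegralModel.nsmul (hW : HasIntegralModel W) {P : W.toAffine.Point}
    (hP : NearInfinity W P) (n : ℕ) :
    NearInfinity W (n • P) ∧ ‖localParameter W (n • P)‖ ≤ ‖localParameter W P‖ ∧
      ‖localParameter W (n • P) - n * localParameter W P‖ ≤ ‖localParameter W P‖ ^ 3 := by
  induction n with
  | zero =>
    rw [zero_nsmul]
    rw [show localParameter W (0 : W.toAffine.Point) = 0 from rfl]
    exact ⟨trivial, by simp, by simp⟩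
  | succ n ih =>
    obtain ⟨h1, h2, h3⟩ := ih
    obtain ⟨k1, k2, k3⟩ := hW.add h1 hP h2 le_rfl
    rw [succ_nsmul]
    refine ⟨k1, k2, ?_⟩
    convert norm_add_le_of_le k3 h3 using 2
    push_cast; ring

/-- From nP = 0 the previous estimate reads ‖n‖‖z‖ ≤ ‖z‖³, and z ≠ 0. -/
lemma HasIntegralModel.norm_natCast_le (hW : HasIntegralModel W) {P : W.toAffine.Point}
    (hP : NearInfinity W P) (h0 : P ≠ 0) {n : ℕ} (hn : n • P = 0) :
    ‖(n : K)‖ ≤ ‖localParameter W P‖ ^ 2 := by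
  have h := (hW.nsmul hP n).2.2
  rw [hn, show localParameter W (0 : W.toAffine.Point) = 0 from rfl] at h
  have hpos : 0 < ‖localParameter W P‖ := norm_pos_iff.mpr (hW.localParameter_ne_zero hP h0)
  rw [zero_sub, norm_neg, norm_mul, pow_succ] at h
  exact le_of_mul_le_mul_right h hpos

end NearInfinity

/-! ### Integrality of torsion points over ℚ_p. -/

section Padic

open WeierstrassCurve WeierstrassCurve.Affine

variable {p : ℕ} [Fact p.Prime] {W : WeierstrassCurve ℚ_[p]}

lemma padic_norm_le_inv_of_lt_one {z : ℚ_[p]} (hz : ‖z‖ < 1) : ‖z‖ ≤ (p : ℝ)⁻¹ := by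
  have := (Padic.norm_le_pow_iff_norm_lt_pow_add_one z (-1)).mpr (by simpa using hz)
  simpa using this

lemma padic_inv_le_norm_prime {q : ℕ} (hq : q.Prime) : (p : ℝ)⁻¹ ≤ ‖(q : ℚ_[p])‖ := by
  by_cases h : p = q
  · subst h; simp
  · have hc : ‖(q : ℚ_[p])‖ = 1 := by
      rw [Padic.norm_natCast_eq_one_iff]
      exact (Nat.coprime_primes Fact.out hq).mpr h
    rw [hc]
    exact inv_le_one_of_one_le₀ (by exact_mod_cast (Fact.out : p.Prime).one_lt.le)

/-- A torsion point of a Weierstrass curve with `p`-integral coefficients, `p` odd, has integral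
`x`-coordinate. -/
lemma HasIntegralModel.eq_zero_of_nearInfinity (hW : HasIntegralModel W) {P : W.toAffine.Point}
    (hP : NearInfinity W P) (ht : IsOfFinAddOrder P) : P = 0 := by
  by_contra h0
  have hn1 : addOrderOf P ≠ 1 := by rwa [Ne, AddMonoid.addOrderOf_eq_one_iff]
  -- The multiple mP has prime order q and is still near infinity, which gives ‖q‖ ≤ ‖z(mP)‖² ≤ p⁻²
  -- < p⁻¹ ≤ ‖q‖.
  obtain ⟨q, hq, m, hm⟩ := Nat.exists_prime_and_dvd hn1
  have hmP : m • P ≠ 0 := by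
    intro h
    have hd := addOrderOf_dvd_of_nsmul_eq_zero h
    have hpos := ht.addOrderOf_pos
    have hm0 : 0 < m := by rcases m.eq_zero_or_pos with h | h; (rw [h] at hm; omega); exact h
    have := Nat.le_of_dvd hm0 hd
    have := hq.two_le
    nlinarith
  have hqm : q • m • P = 0 := by rw [← mul_nsmul', ← hm, addOrderOf_nsmul_eq_zero]
  have hN := (hW.nsmul hP m).1
  have h1 := hW.norm_natCast_le hN hmP hqm
  have h2 := padic_norm_le_inv_of_lt_one (hW.norm_localParameter_lt_one hN)
  have h3 := padic_inv_le_norm_prime (p := p) hq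
  have hp : (1 : ℝ) < p := by exact_mod_cast (Fact.out : p.Prime).one_lt
  have h4 : (p : ℝ)⁻¹ < 1 := inv_lt_one_of_one_lt₀ hp
  have h5 : (0 : ℝ) < (p : ℝ)⁻¹ := by positivity
  nlinarith [norm_nonneg (localParameter W (m • P))]

end Padic

/-! ### Reduction of torsion points modulo an odd prime. -/

section Reduction

open WeierstrassCurve WeierstrassCurve.Affine

variable {p : ℕ} [Fact p.Prime]

lemma PadicInt.toZMod_eq_zero_iff (z : ℤ_[p]) : PadicInt.toZMod z = 0 ↔ ‖z‖ < 1 := by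
  rw [← RingHom.mem_ker, PadicInt.ker_toZMod, PadicInt.maximalIdeal_eq_span_p,
    Ideal.mem_span_singleton, ← PadicInt.norm_lt_one_iff_dvd]

variable (V : WeierstrassCurve ℤ_[p])

/-- The generic fibre of an integral Weierstrass curve. -/
abbrev genericFibre : WeierstrassCurve ℚ_[p] := V.map (algebraMap ℤ_[p] ℚ_[p])

/-- The special fibre of an integral Weierstrass curve. -/
abbrev specialFibre : WeierstrassCurve (ZMod p) := V.map PadicInt.toZMod

lemma norm_two_eq_one (hp : p ≠ 2) : ‖(2 : ℚ_[p])‖ = 1 := by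
  have : ‖((2 : ℕ) : ℚ_[p])‖ = 1 := by
    rw [Padic.norm_natCast_eq_one_iff]
    exact (Nat.coprime_primes Fact.out Nat.prime_two).mpr hp
  exact_mod_cast this

lemma hasIntegralModel_genericFibre (hp : p ≠ 2) : HasIntegralModel (genericFibre V) :=
  ⟨norm_two_eq_one hp, V.a₁.2, V.a₂.2, V.a₃.2, V.a₄.2, V.a₆.2⟩

variable {V}

lemma exists_integral_coords (hp : p ≠ 2) {P : (genericFibre V).toAffine.Point} (h0 : P ≠ 0)
    (ht : IsOfFinAddOrder P) : ∃ x y : ℤ_[p], ∃ h : (genericFibre V).toAffine.Nonsingular (x :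
      ℚ_[p]) y,
      P = .some _ _ h := by
  rcases P with _ | ⟨x, y, h⟩
  · exact absurd rfl h0
  have hW := hasIntegralModel_genericFibre V hp
  have hx : ‖x‖ ≤ 1 := by
    by_contra! hx
    exact h0 (hW.eq_zero_of_nearInfinity (P := .some x y h) hx ht)
  -- With x and the coefficients integral, a nonintegral y would satisfy ‖y‖² ≤ ‖y‖.
  have hy : ‖y‖ ≤ 1 := by
    by_contra! hy
    have he := (equation_iff _ _).mp h.1
    have hm : ∀ {a b : ℚ_[p]}, ‖a‖ ≤ 1 → ‖b‖ ≤ 1 → ‖a * b‖ ≤ 1 := fun ha hb => by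
      rw [norm_mul]; exact mul_le_one₀ ha (norm_nonneg _) hb
    have e : y ^ 2 = (x * (x * x) + (genericFibre V).a₂ * (x * x) + (genericFibre V).a₄ * x
        + (genericFibre V).a₆) - ((genericFibre V).a₁ * x + (genericFibre V).a₃) * y := by
      linear_combination he
    have h1 : ‖y ^ 2‖ ≤ ‖y‖ := by
      rw [e]
      refine norm_sub_le_of_le (le_trans ?_ hy.le) ?_
      · exact norm_add_le_of_le (norm_add_le_of_le (norm_add_le_of_le (hm hx (hm hx hx))
          (hm hW.h₂ (hm hx hx))) (hm hW.h₄ hx)) hW.h₆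
      · rw [norm_mul]
        exact mul_le_of_le_one_left (norm_nonneg _) (norm_add_le_of_le (hm hW.h₁ hx) hW.h₃)
    rw [norm_pow] at h1
    nlinarith
  exact ⟨⟨x, hx⟩, ⟨y, hy⟩, h, rfl⟩

lemma equation_integral {x y : ℤ_[p]} (h : (genericFibre V).toAffine.Equation (x : ℚ_[p]) y) :
    V.toAffine.Equation x y :=
  (Affine.map_equation V.toAffine (f := algebraMap ℤ_[p] ℚ_[p])
    (IsFractionRing.injective ℤ_[p] ℚ_[p]) x y).mp h

lemma equation_specialFibre {x y : ℤ_[p]} (h : V.toAffine.Equation x y) :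
    (specialFibre V).toAffine.Equation (PadicInt.toZMod x) (PadicInt.toZMod y) :=
  h.map _

/-- The special fibre has no point of order two. -/
def NoTwoTorsion {F : Type*} [Field F] (W : WeierstrassCurve F) : Prop :=
  ∀ x y : F, W.toAffine.Equation x y → 2 * y + W.a₁ * x + W.a₃ ≠ 0

/-- If this quantity were not a unit, the point would reduce to one at which 2y + a₁x + a₃ vanishes.
Affine singular points are also of this kind, so smoothness of the special fibre needs no separate
assumption. -/
lemma norm_eq_one_of_noTwoTorsion (h2 : NoTwoTorsion (specialFibre V)) {x y : ℤ_[p]}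
    (h : V.toAffine.Equation x y) : ‖2 * y + V.a₁ * x + V.a₃‖ = 1 := by
  refine le_antisymm (PadicInt.norm_le_one _) ?_
  by_contra! hlt
  refine h2 _ _ (equation_specialFibre h) ?_
  have := (PadicInt.toZMod_eq_zero_iff _).mpr hlt
  simp only [map_add, map_mul, map_ofNat] at this
  exact this

/-- Integral torsion points with the same reduction, not of order two, agree. -/
lemma HasIntegralModel.eq_of_norm_sub_lt {W : WeierstrassCurve ℚ_[p]} (hW : HasIntegralModel W)
    {x₁ y₁ x₂ y₂ : ℚ_[p]} {h₁ : W.toAffine.Nonsingular x₁ y₁} {h₂ : W.toAffine.Nonsingular x₂ y₂}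
    (ht₁ : IsOfFinAddOrder (Point.some _ _ h₁)) (ht₂ : IsOfFinAddOrder (Point.some _ _ h₂))
    (n₁ : ‖x₁‖ ≤ 1) (n₂ : ‖x₂‖ ≤ 1) (hx : ‖x₁ - x₂‖ < 1) (hy : ‖y₁ - y₂‖ < 1)
    (hu : ‖2 * y₂ + W.a₁ * x₂ + W.a₃‖ = 1) :
    Point.some _ _ h₁ = Point.some _ _ h₂ := by
  have hnum : ‖y₁ - W.toAffine.negY x₂ y₂‖ = 1 := by
    rw [← hu]
    apply norm_eq_of_norm_sub_lt
    rw [hu]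
    have e : y₁ - W.toAffine.negY x₂ y₂ - (2 * y₂ + W.a₁ * x₂ + W.a₃) = y₁ - y₂ := by
      rw [negY]
      dsimp only [WeierstrassCurve.toAffine]
      ring
    rwa [e]
  by_cases hxe : x₁ = x₂
  · subst hxe
    rcases Y_eq_of_X_eq h₁.1 h₂.1 rfl with h | h
    · simp only [h]
    · rw [h, sub_self, norm_zero] at hnum
      norm_num at hnum
  · exfalso
    have hneg := (W.toAffine.nonsingular_neg x₂ y₂).mpr h₂
    have hsub : Point.some _ _ h₁ - Point.some _ _ h₂ =
        Point.some _ _ (nonsingular_add h₁ hneg fun hxy => hxe hxy.left) := by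
      rw [sub_eq_add_neg, Point.neg_some, Point.add_of_X_ne hxe]
    have ht : IsOfFinAddOrder (Point.some _ _ h₁ - Point.some _ _ h₂) := by
      rw [sub_eq_add_neg]; exact ht₁.add ht₂.neg
    rw [hsub] at ht
    refine Point.some_ne_zero _ (hW.eq_zero_of_nearInfinity ?_ ht)
    change 1 < ‖W.toAffine.addX x₁ x₂ (W.toAffine.slope x₁ x₂ y₁ (W.toAffine.negY x₂ y₂))‖
    -- The line through the first point and the negative of the second has a unit as numerator of
    -- its slope and a small denominator. So the x-coordinate of the difference is dominated by l²,
    -- and the difference is a torsion point near infinity.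
    have hlne : 1 < ‖W.toAffine.slope x₁ x₂ y₁ (W.toAffine.negY x₂ y₂)‖ := by
      rw [slope_of_X_ne hxe, norm_div, hnum, one_lt_div (norm_pos_iff.mpr (sub_ne_zero.mpr hxe))]
      exact hx
    generalize W.toAffine.slope x₁ x₂ y₁ (W.toAffine.negY x₂ y₂) = l at hlne
    have hle : ‖W.toAffine.addX x₁ x₂ l - l ^ 2‖ ≤ ‖l‖ := by
      have : W.toAffine.addX x₁ x₂ l - l ^ 2 = W.a₁ * l - (W.a₂ + x₁ + x₂) := by
        rw [addX]; ring
      rw [this]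
      refine norm_sub_le_of_le ?_ (le_trans ?_ hlne.le)
      · rw [norm_mul]; exact mul_le_of_le_one_left (norm_nonneg _) hW.h₁
      · exact norm_add_le_of_le (norm_add_le_of_le hW.h₂ n₁) n₂
    have : ‖W.toAffine.addX x₁ x₂ l‖ = ‖l ^ 2‖ := by
      apply norm_eq_of_norm_sub_lt
      rw [norm_pow]; nlinarith
    rw [this, norm_pow]; nlinarith

lemma PadicInt.coe_two : ((2 : ℤ_[p]) : ℚ_[p]) = 2 := map_ofNat PadicInt.Coe.ringHom 2

lemma PadicInt.coe_three : ((3 : ℤ_[p]) : ℚ_[p]) = 3 := map_ofNat PadicInt.Coe.ringHom 3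

/-- Torsion points with the same reduction agree. -/
lemma eq_of_reduction_eq (hp : p ≠ 2) (h2 : NoTwoTorsion (specialFibre V))
    {x₁ y₁ x₂ y₂ : ℤ_[p]} {h₁ : (genericFibre V).toAffine.Nonsingular (x₁ : ℚ_[p]) y₁}
    {h₂ : (genericFibre V).toAffine.Nonsingular (x₂ : ℚ_[p]) y₂}
    (ht₁ : IsOfFinAddOrder (Point.some _ _ h₁)) (ht₂ : IsOfFinAddOrder (Point.some _ _ h₂))
    (hx : PadicInt.toZMod x₁ = PadicInt.toZMod x₂) (hy : PadicInt.toZMod y₁ = PadicInt.toZMod y₂) :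
    Point.some _ _ h₁ = Point.some _ _ h₂ := by
  have hx' : ‖x₁ - x₂‖ < 1 := by
    rw [← PadicInt.toZMod_eq_zero_iff, map_sub, hx, sub_self]
  have hy' : ‖y₁ - y₂‖ < 1 := by
    rw [← PadicInt.toZMod_eq_zero_iff, map_sub, hy, sub_self]
  have hu := norm_eq_one_of_noTwoTorsion h2 (equation_integral h₂.1)
  rw [PadicInt.norm_def] at hx' hy' hu
  push_cast [PadicInt.coe_two] at hx' hy' hu
  exact (hasIntegralModel_genericFibre V hp).eq_of_norm_sub_lt ht₁ ht₂ x₁.2 x₂.2 hx' hy' hu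

/-- The reduction of a torsion point; the point at infinity is sent to `none`. -/
def reduction (hp : p ≠ 2) (P : AddCommGroup.torsion (genericFibre V).toAffine.Point) :
    Option (ZMod p × ZMod p) :=
  if h : (P : (genericFibre V).toAffine.Point) = 0 then none else
    some (PadicInt.toZMod (exists_integral_coords hp h P.2).choose,
      PadicInt.toZMod (exists_integral_coords hp h P.2).choose_spec.choose)

lemma reduction_injective (hp : p ≠ 2) (h2 : NoTwoTorsion (specialFibre V)) :
    Function.Injective (reduction (V := V) hp) := by
  intro P Q h
  unfold reduction at h
  split_ifs at h with hP hQ hQ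
  · exact Subtype.ext (hP.trans hQ.symm)
  · obtain ⟨h₁, e₁⟩ := (exists_integral_coords hp hP P.2).choose_spec.choose_spec
    obtain ⟨h₂, e₂⟩ := (exists_integral_coords hp hQ Q.2).choose_spec.choose_spec
    simp only [Option.some.injEq, Prod.mk.injEq] at h
    apply Subtype.ext
    have t₁ := P.2
    have t₂ := Q.2
    rw [e₁] at t₁ ⊢
    rw [e₂] at t₂ ⊢
    exact eq_of_reduction_eq hp h2 t₁ t₂ h.1 h.2

/-- The number of torsion points is at most the number of points of the special fibre. -/
lemma finite_torsion_and_card_le (hp : p ≠ 2) (h2 : NoTwoTorsion (specialFibre V))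
    (S : Finset (ZMod p × ZMod p))
    (hS : ∀ x y, (specialFibre V).toAffine.Equation x y → (x, y) ∈ S) :
    Finite (AddCommGroup.torsion (genericFibre V).toAffine.Point) ∧
      Nat.card (AddCommGroup.torsion (genericFibre V).toAffine.Point) ≤ S.card + 1 := by
  have hmem : ∀ P, reduction (V := V) hp P ∈ Finset.insertNone S := by
    intro P
    unfold reduction
    split_ifs with hP
    · simp
    · obtain ⟨h₁, e₁⟩ := (exists_integral_coords hp hP P.2).choose_spec.choose_spec
      simpa using hS _ _ (equation_specialFibre (equation_integral h₁.1))
  let f : AddCommGroup.torsion (genericFibre V).toAffine.Point → Finset.insertNone S :=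
    fun P => ⟨reduction hp P, hmem P⟩
  have hf : Function.Injective f := fun P Q h =>
    reduction_injective hp h2 (congrArg Subtype.val h)
  refine ⟨Finite.of_injective f hf, ?_⟩
  have := Nat.card_le_card_of_injective f hf
  rwa [Nat.card_eq_fintype_card (α := Finset.insertNone S), Fintype.card_coe,
    Finset.card_insertNone] at this

/-- There is no point of order two if there is none on the special fibre. -/
lemma two_nsmul_ne_zero (hp : p ≠ 2) (h2 : NoTwoTorsion (specialFibre V))
    {P : (genericFibre V).toAffine.Point} (hP : P ≠ 0) : 2 • P ≠ 0 := by
  intro h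
  have ht : IsOfFinAddOrder P := isOfFinAddOrder_iff_nsmul_eq_zero.mpr ⟨2, by norm_num, h⟩
  obtain ⟨x, y, hn, rfl⟩ := exists_integral_coords hp hP ht
  have hneg : Point.some _ _ hn = -Point.some _ _ hn := by
    rw [two_nsmul] at h; exact eq_neg_of_add_eq_zero_left h
  rw [Point.neg_some] at hneg
  simp only [Point.some.injEq, true_and] at hneg
  have hu := norm_eq_one_of_noTwoTorsion h2 (equation_integral hn.1)
  have h0 : 2 * y + V.a₁ * x + V.a₃ = 0 := by
    rw [negY] at hneg
    dsimp only [WeierstrassCurve.toAffine] at hneg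
    rw [← PadicInt.coe_eq_zero]
    push_cast [PadicInt.coe_two]
    change 2 * (y : ℚ_[p]) + (genericFibre V).a₁ * x + (genericFibre V).a₃ = 0
    linear_combination hneg
  rw [h0, norm_zero] at hu
  norm_num at hu

/-- The affine points whose tangent meets the curve in a triple point or which have vertical
tangent are excluded by this condition. -/
def NoThreeTorsion {F : Type*} [Field F] (W : WeierstrassCurve F) : Prop :=
  ∀ x y : F, W.toAffine.Equation x y →
    (3 * x + W.a₂) * (2 * y + W.a₁ * x + W.a₃) ^ 2 ≠
      (3 * x ^ 2 + 2 * W.a₂ * x + W.a₄ - W.a₁ * y) ^ 2 +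
        W.a₁ * (3 * x ^ 2 + 2 * W.a₂ * x + W.a₄ - W.a₁ * y) * (2 * y + W.a₁ * x + W.a₃)

/-- If 3P = 0 then 2P and P have the same x-coordinate. Clearing the denominator of the duplication
formula turns this into a polynomial relation with integral coefficients, which survives reduction
and is excluded on the special fibre. -/
lemma three_nsmul_ne_zero (hp : p ≠ 2) (h3 : NoThreeTorsion (specialFibre V))
    {P : (genericFibre V).toAffine.Point} (hP : P ≠ 0) : 3 • P ≠ 0 := by
  intro h
  have ht : IsOfFinAddOrder P := isOfFinAddOrder_iff_nsmul_eq_zero.mpr ⟨3, by norm_num, h⟩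
  obtain ⟨x, y, hn, rfl⟩ := exists_integral_coords hp hP ht
  have hdouble : Point.some _ _ hn + Point.some _ _ hn = -Point.some _ _ hn := by
    rw [succ_nsmul, two_nsmul] at h; exact eq_neg_of_add_eq_zero_left h
  have hy : (y : ℚ_[p]) ≠ (genericFibre V).toAffine.negY x y := by
    intro hy
    rw [Point.add_self_of_Y_eq hy] at hdouble
    exact hP (neg_eq_zero.mp hdouble.symm)
  rw [Point.add_self_of_Y_ne hy, Point.neg_some] at hdouble
  simp only [Point.some.injEq] at hdouble
  have hX := hdouble.1
  rw [slope_of_Y_ne rfl hy, addX] at hX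
  have hden := sub_ne_zero.mpr hy
  rw [negY] at hX hden
  dsimp only [WeierstrassCurve.toAffine] at hX hden
  refine h3 _ _ (equation_specialFibre (equation_integral hn.1)) ?_
  have key : (3 * x + V.a₂) * (2 * y + V.a₁ * x + V.a₃) ^ 2 =
      (3 * x ^ 2 + 2 * V.a₂ * x + V.a₄ - V.a₁ * y) ^ 2 +
        V.a₁ * (3 * x ^ 2 + 2 * V.a₂ * x + V.a₄ - V.a₁ * y) * (2 * y + V.a₁ * x + V.a₃) := by
    have e1 : ((V.a₁ : ℤ_[p]) : ℚ_[p]) = (genericFibre V).a₁ := rfl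
    have e2 : ((V.a₂ : ℤ_[p]) : ℚ_[p]) = (genericFibre V).a₂ := rfl
    have e3 : ((V.a₃ : ℤ_[p]) : ℚ_[p]) = (genericFibre V).a₃ := rfl
    have e4 : ((V.a₄ : ℤ_[p]) : ℚ_[p]) = (genericFibre V).a₄ := rfl
    apply PadicInt.ext
    push_cast [PadicInt.coe_two, PadicInt.coe_three]
    rw [e1, e2, e3, e4]
    generalize hη : (y : ℚ_[p]) - (-y - (genericFibre V).a₁ * x - (genericFibre V).a₃) = η
      at hX hden
    have hη' : 2 * (y : ℚ_[p]) + (genericFibre V).a₁ * x + (genericFibre V).a₃ = η := by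
      rw [← hη]; ring
    rw [hη']
    field_simp at hX
    linear_combination -hX
  have := congrArg PadicInt.toZMod key
  simp only [map_add, map_mul, map_ofNat, map_sub, map_pow] at this
  exact this

end Reduction

/-! ### Determining the torsion from reductions at two places. -/

section TorsionCriterion

open WeierstrassCurve WeierstrassCurve.Affine

lemma exists_injective_point_map {K L : Type*} [Field K] [Field L] (W : WeierstrassCurve K)
    (φ : K →+* L) :
    ∃ f : W.toAffine.Point →+ (W.map φ).toAffine.Point, Function.Injective f := by
  let := φ.toAlgebra
  exact ⟨Point.map (W' := W) (Algebra.ofId K L), Point.map_injective (W' := W) _⟩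

/-- An additive group containing an element of order 17 and whose torsion subgroup has at most 51
elements, none of them of order 2 or 3, has torsion subgroup `ℤ/17ℤ`. -/
lemma nonempty_torsion_equiv_zmod {G : Type*} [AddCommGroup G] {g : G} (hg : addOrderOf g = 17)
    (hfin : Finite (AddCommGroup.torsion G)) (hcard : Nat.card (AddCommGroup.torsion G) ≤ 51)
    (h2 : ∀ x : G, x ≠ 0 → 2 • x ≠ 0) (h3 : ∀ x : G, x ≠ 0 → 3 • x ≠ 0) :
    Nonempty (AddCommGroup.torsion G ≃+ ZMod 17) := by
  have hno : ∀ q : ℕ, q.Prime → (∀ x : G, x ≠ 0 → q • x ≠ 0) →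
      ¬ q ∣ Nat.card (AddCommGroup.torsion G) := by
    intro q hq h hd
    have := Fact.mk hq
    obtain ⟨x, hx⟩ := exists_prime_addOrderOf_dvd_card' q hd
    have hx0 : (x : G) ≠ 0 := by
      intro h0
      rw [show x = 0 from Subtype.ext h0, addOrderOf_zero] at hx
      exact hq.one_lt.ne hx
    refine h x hx0 ?_
    have := addOrderOf_nsmul_eq_zero x
    rw [hx] at this
    exact congrArg Subtype.val this
  have hgt : IsOfFinAddOrder g := by rw [← addOrderOf_pos_iff, hg]; norm_num
  have h17 : 17 ∣ Nat.card (AddCommGroup.torsion G) := by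
    have : addOrderOf (⟨g, hgt⟩ : AddCommGroup.torsion G) = 17 := by
      rw [← hg]; exact (AddSubgroup.addOrderOf_coe _).symm
    rw [← this]
    exact addOrderOf_dvd_natCard _
  have hc : Nat.card (AddCommGroup.torsion G) = 17 := by
    obtain ⟨k, hk⟩ := h17
    have hpos : 0 < Nat.card (AddCommGroup.torsion G) := Nat.card_pos
    have h2' := hno 2 Nat.prime_two h2
    have h3' := hno 3 Nat.prime_three h3
    -- The order is 17k with 0 < 17k ≤ 51; by Cauchy's theorem k = 2 and k = 3 would produce points
    -- of order 2 and 3.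
    have : k ≤ 3 := by omega
    interval_cases k <;> omega
  have : Fact (Nat.Prime 17) := ⟨by norm_num⟩
  have := isAddCyclic_of_prime_card hc
  have e := zmodAddCyclicAddEquiv (inferInstance : IsAddCyclic (AddCommGroup.torsion G))
  rw [hc] at e
  exact ⟨e.symm⟩

/-- A criterion for the torsion subgroup to be `ℤ/17ℤ`, by reduction at two places. -/
theorem hasTorsionSeventeen_of_reduction {K : Type*} [Field K] {b c : K}
    (hΔ : (tateNormalForm b c).Δ ≠ 0) (h17 : addOrderOf (tateOrigin b c hΔ) = 17)
    {p q : ℕ} [Fact p.Prime] [Fact q.Prime] (hp : p ≠ 2) (hq : q ≠ 2)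
    (φ : K →+* ℚ_[p]) (V : WeierstrassCurve ℤ_[p])
    (hV : (tateNormalForm b c).map φ = genericFibre V) (h2 : NoTwoTorsion (specialFibre V))
    (S : Finset (ZMod p × ZMod p))
    (hS : ∀ x y, (specialFibre V).toAffine.Equation x y → (x, y) ∈ S) (hScard : S.card ≤ 50)
    (ψ : K →+* ℚ_[q]) (U : WeierstrassCurve ℤ_[q])
    (hU : (tateNormalForm b c).map ψ = genericFibre U) (h3 : NoThreeTorsion (specialFibre U)) :
    HasTorsionSeventeen b c := by
  obtain ⟨f, hf⟩ := exists_injective_point_map (tateNormalForm b c) φ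
  obtain ⟨g, hg⟩ := exists_injective_point_map (tateNormalForm b c) ψ
  -- The codomains of f and g must be rewritten along `hV` and `hU`.
  revert f g
  rw [hV, hU]
  intro f hf g hg
  obtain ⟨hfin, hcard⟩ := finite_torsion_and_card_le hp h2 S hS
  let F : AddCommGroup.torsion (tateNormalForm b c).toAffine.Point →
      AddCommGroup.torsion (genericFibre V).toAffine.Point :=
    fun P => ⟨f P, f.isOfFinAddOrder P.2⟩
  have hF : Function.Injective F := fun P Q h =>
    Subtype.ext (hf (congrArg Subtype.val h))
  refine ⟨hΔ, h17, nonempty_torsion_equiv_zmod h17 (Finite.of_injective F hF) ?_ ?_ ?_⟩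
  · exact (Nat.card_le_card_of_injective F hF).trans (hcard.trans (by omega))
  · intro P hP h
    refine two_nsmul_ne_zero hp h2 (P := f P) ?_ (by rw [← map_nsmul, h, map_zero])
    rwa [Ne, map_eq_zero_iff f hf]
  · intro P hP h
    refine three_nsmul_ne_zero hq h3 (P := g P) ?_ (by rw [← map_nsmul, h, map_zero])
    rwa [Ne, map_eq_zero_iff g hg]

lemma map_tateNormalForm {R S : Type*} [CommRing R] [CommRing S] (φ : R →+* S) (b c : R) :
    (tateNormalForm b c).map φ = tateNormalForm (φ b) (φ c) := by
  ext <;> simp [tateNormalForm]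

/-- A simple root modulo `p` of an integral polynomial lifts to `ℤ_p`. -/
lemma exists_padic_root {p : ℕ} [Fact p.Prime] (F : ℤ[X]) (a₀ : ℤ) (h0 : (p : ℤ) ∣ F.eval a₀)
    (h1 : ¬ (p : ℤ) ∣ F.derivative.eval a₀) :
    ∃ a : ℤ_[p], aeval a F = 0 ∧ PadicInt.toZMod a = a₀ := by
  have e : ∀ G : ℤ[X], aeval (a₀ : ℤ_[p]) G = ((G.eval a₀ : ℤ) : ℤ_[p]) := fun G => by
    rw [show (a₀ : ℤ_[p]) = algebraMap ℤ ℤ_[p] a₀ from rfl, aeval_algebraMap_apply]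
    simp
  have hd : ‖aeval (a₀ : ℤ_[p]) F.derivative‖ = 1 := by
    refine le_antisymm (PadicInt.norm_le_one _) ?_
    by_contra! hlt
    rw [e, PadicInt.norm_int_lt_one_iff_dvd] at hlt
    exact h1 hlt
  have hn : ‖aeval (a₀ : ℤ_[p]) F‖ < 1 := by
    rw [e, PadicInt.norm_int_lt_one_iff_dvd]; exact h0
  obtain ⟨a, ha, hdist, -⟩ := hensels_lemma (F := F) (a := (a₀ : ℤ_[p])) (by simpa [hd] using hn)
  refine ⟨a, ha, ?_⟩
  rw [hd, ← PadicInt.toZMod_eq_zero_iff, map_sub, map_intCast, sub_eq_zero] at hdist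
  exact hdist

end TorsionCriterion

/-! ### Doubling the origin, and the raw equation of X₁(17). -/

section OrderSeventeen

open WeierstrassCurve WeierstrassCurve.Affine

variable {K : Type*} [Field K]

/-- The slope is supplied together with an equation free of division that determines it, so that a
duplication with explicit coordinates reduces to identities between rational functions. -/
lemma some_add_self {W : WeierstrassCurve K} {x y x' y' l : K}
    (h : W.toAffine.Nonsingular x y) (hy : 2 * y + W.a₁ * x + W.a₃ ≠ 0)
    (hl : l * (2 * y + W.a₁ * x + W.a₃) = 3 * x ^ 2 + 2 * W.a₂ * x + W.a₄ - W.a₁ * y)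
    (hx' : x' = l ^ 2 + W.a₁ * l - W.a₂ - 2 * x)
    (hy' : y' = -(l * (x' - x) + y) - W.a₁ * x' - W.a₃) :
    ∃ h' : W.toAffine.Nonsingular x' y', Point.some _ _ h + Point.some _ _ h = Point.some _ _ h' :=
      by
  have hne : y ≠ W.toAffine.negY x y := by
    intro h0
    rw [negY] at h0
    dsimp only [WeierstrassCurve.toAffine] at h0
    exact hy (by linear_combination h0)
  have hs : W.toAffine.slope x x y y = l := by
    rw [slope_of_Y_ne rfl hne, div_eq_iff (sub_ne_zero.mpr hne), negY]
    dsimp only [WeierstrassCurve.toAffine]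
    linear_combination -hl
  have e1 : W.toAffine.addX x x l = x' := by
    rw [hx', addX]; dsimp only [WeierstrassCurve.toAffine]; ring
  have e2 : W.toAffine.addY x x y l = y' := by
    rw [addY, negAddY, e1, hy', negY]
  have hn := nonsingular_add h h fun hxy => hne hxy.right
  have hadd := Point.add_self_of_Y_ne (h₁ := h) hne
  subst e1 e2 hs
  exact ⟨hn, hadd⟩

/-- The raw equation of `X₁(17)` in the parameters `r`, `s`. -/
def raw17 (r s : K) : K :=
  -r ^ 5 + r ^ 4 * s ^ 6 - 9 * r ^ 4 * s ^ 5 + 31 * r ^ 4 * s ^ 4 - 50 * r ^ 4 * s ^ 3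
    + 39 * r ^ 4 * s ^ 2 - 10 * r ^ 4 * s + 3 * r ^ 4 + r ^ 3 * s ^ 6 - 3 * r ^ 3 * s ^ 5
    - 12 * r ^ 3 * s ^ 4 + 46 * r ^ 3 * s ^ 3 - 54 * r ^ 3 * s ^ 2 + 15 * r ^ 3 * s - 3 * r ^ 3
    + r ^ 2 * s ^ 6 + 3 * r ^ 2 * s ^ 5 - 9 * r ^ 2 * s ^ 4 - r ^ 2 * s ^ 3 + 21 * r ^ 2 * s ^ 2
    - 6 * r ^ 2 * s + r ^ 2 - r * s ^ 7 + 3 * r * s ^ 6 - 6 * r * s ^ 5 + 10 * r * s ^ 4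
    - 11 * r * s ^ 3 + s ^ 3

/-- The factor of the denominator of the duplication formula at `8 • (0, 0)`. -/
def dup8 (r s : K) : K :=
  r ^ 3 * s ^ 2 - 4 * r ^ 3 * s + 2 * r ^ 3 + 3 * r ^ 2 * s ^ 2 + 2 * r ^ 2 * s - 2 * r ^ 2
    - r * s ^ 5 + 4 * r * s ^ 4 - 10 * r * s ^ 3 + 6 * r * s ^ 2 - 3 * r * s + r + s ^ 4

/-- The factor of the discriminant of the Tate normal form in the parameters `r`, `s`. -/
def discFactor (r s : K) : K :=
  r ^ 2 * s ^ 3 - 8 * r ^ 2 * s ^ 2 + 16 * r ^ 2 * s - 2 * r * s ^ 3 + 5 * r * s ^ 2 - 20 * r * s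
    + s ^ 3 + 3 * s ^ 2 + 3 * s + 1

/-- The cuspidal factors in the parameters `r`, `s` do not vanish. -/
structure Noncuspidal (r s : K) : Prop where
  hr : r ≠ 0
  hs : s ≠ 0
  hr1 : r - 1 ≠ 0
  hrs : r - s ≠ 0
  hd : r * s - 2 * r + 1 ≠ 0
  hm : r - s ^ 2 + s - 1 ≠ 0
  hdup : dup8 r s ≠ 0
  hdisc : discFactor r s ≠ 0

lemma tateNormalForm_Δ (r s : K) : (tateNormalForm (s * (r - 1) * r) (s * (r - 1))).Δ =
    r ^ 3 * s ^ 4 * (r - 1) ^ 5 * discFactor r s := by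
  simp only [WeierstrassCurve.Δ, WeierstrassCurve.b₂, WeierstrassCurve.b₄, WeierstrassCurve.b₆,
    WeierstrassCurve.b₈, tateNormalForm, discFactor]
  ring

lemma Noncuspidal.Δ_ne_zero {r s : K} (h : Noncuspidal r s) :
    (tateNormalForm (s * (r - 1) * r) (s * (r - 1))).Δ ≠ 0 := by
  rw [tateNormalForm_Δ]
  exact mul_ne_zero (mul_ne_zero (mul_ne_zero (pow_ne_zero _ h.hr) (pow_ne_zero _ h.hs))
    (pow_ne_zero _ h.hr1)) h.hdisc

/-- Four doublings lead from P to 16P = (0, b), which is -P because a₃ = -b. So 17P = 0, and 17 is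
prime while P is an affine point. The factors in `Noncuspidal` supply the denominators of the
successive slopes. -/
theorem addOrderOf_tateOrigin_eq {r s : K} (h : Noncuspidal r s) (h17 : raw17 r s = 0)
    (hΔ : (tateNormalForm (s * (r - 1) * r) (s * (r - 1))).Δ ≠ 0) :
    addOrderOf (tateOrigin (s * (r - 1) * r) (s * (r - 1)) hΔ) = 17 := by
  obtain ⟨hr, hs, hr1, hrs, hd, hm, hdup, -⟩ := h
  set W := tateNormalForm (s * (r - 1) * r) (s * (r - 1)) with hW
  have a1 : W.a₁ = 1 - s * (r - 1) := rfl
  have a2 : W.a₂ = -(s * (r - 1) * r) := rfl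
  have a3 : W.a₃ = -(s * (r - 1) * r) := rfl
  have a4 : W.a₄ = 0 := rfl
  obtain ⟨n1, e1⟩ : ∃ n : W.toAffine.Nonsingular 0 0,
      tateOrigin (s * (r - 1) * r) (s * (r - 1)) hΔ = Point.some _ _ n := ⟨_, rfl⟩
  obtain ⟨n2, e2⟩ := some_add_self (x' := s * (r - 1) * r) (y' := s * (r - 1) * r * (s * (r - 1)))
    (l := 0) n1 (by
      rw [a1, a3]
      simpa using ⟨⟨hs, hr1⟩, hr⟩) (by rw [a1, a2, a3, a4]; ring) (by rw [a1, a2]; ring)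
    (by rw [a1, a3]; ring)
  have h2y : 2 * (s * (r - 1) * r * (s * (r - 1))) + W.a₁ * (s * (r - 1) * r) + W.a₃ =
      r * s ^ 2 * (r - 1) ^ 2 := by
    rw [a1, a3]; ring
  obtain ⟨n4, e4⟩ := some_add_self (x' := r * (r - 1)) (y' := r ^ 2 * (s * (r - 1) - r + 1))
    (l := r - 1 + s * (r - 1)) n2 (by
      rw [h2y]
      exact mul_ne_zero (mul_ne_zero hr (pow_ne_zero _ hs)) (pow_ne_zero _ hr1))
    (by rw [h2y, a1, a2, a4]; ring) (by rw [a1, a2]; ring)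
    (by rw [a1, a3]; ring)
  have h4y : 2 * (r ^ 2 * (s * (r - 1) - r + 1)) + W.a₁ * (r * (r - 1)) + W.a₃ =
      r * (r - 1) * (r * s - 2 * r + 1) := by
    rw [a1, a3]; ring
  -- The denominators d and m are made opaque so that they are cleared as atoms and expanded only
  -- afterwards.
  obtain ⟨d, hdd⟩ : ∃ d, d = r * s - 2 * r + 1 := ⟨_, rfl⟩
  obtain ⟨m, hmm⟩ : ∃ m, m = r - s ^ 2 + s - 1 := ⟨_, rfl⟩
  rw [← hdd] at hd h4y
  rw [← hmm] at hm
  obtain ⟨n8, e8⟩ := some_add_self (x' := r * (r - 1) * (r - s) * m / d ^ 2)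
    (y' := r * (r - 1) ^ 2 * (r - s) ^ 2 * (r * s ^ 2 - 3 * r * s + r + s ^ 2) / d ^ 3)
    (l := r * (r * s ^ 2 - 3 * r * s + 3 * r - s ^ 2 + 2 * s - 2) / d) n4
    (by rw [h4y]; exact mul_ne_zero (mul_ne_zero hr hr1) hd)
    (by rw [h4y, a1, a2, a4]; field_simp; ring)
    (by rw [a1, a2]; field_simp; rw [hdd, hmm]; ring)
    (by rw [a1, a3]; field_simp; rw [hdd, hmm]; ring)
  have h8y : 2 * (r * (r - 1) ^ 2 * (r - s) ^ 2 * (r * s ^ 2 - 3 * r * s + r + s ^ 2) / d ^ 3) +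
      W.a₁ * (r * (r - 1) * (r - s) * m / d ^ 2) + W.a₃ =
      r * (r - 1) ^ 2 * dup8 r s / d ^ 3 := by
    rw [a1, a3, dup8]; field_simp; rw [hdd, hmm]; ring
  rw [raw17] at h17
  -- The tangent at 8P should meet the curve again at -16P = P = (0, 0), so its slope is the
  -- quotient of the coordinates of 8P. The equation `h17` enters only here: it certifies this slope
  -- and the vanishing of the x-coordinate of 16P.
  obtain ⟨n16, e16⟩ := some_add_self (x' := 0) (y' := s * (r - 1) * r)
    (l := (r - 1) * (r - s) * (r * s ^ 2 - 3 * r * s + r + s ^ 2) / (m * d)) n8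
    (by
      rw [h8y]
      exact div_ne_zero (mul_ne_zero (mul_ne_zero hr (pow_ne_zero _ hr1)) hdup)
        (pow_ne_zero _ hd))
    (by rw [h8y, a1, a2, a4, dup8]; field_simp; rw [hdd, hmm]; linear_combination r * (r - 1) ^ 2 *
      (r - s) * h17)
    (by rw [a1, a2]; field_simp; rw [hdd, hmm]; linear_combination -(r - 1) * h17)
    (by rw [a1, a3]; field_simp; rw [hdd, hmm]; ring)
  have hP : (17 : ℕ) • tateOrigin (s * (r - 1) * r) (s * (r - 1)) hΔ = 0 := by
    rw [e1]
    have : (17 : ℕ) • Point.some (W' := W.toAffine) 0 0 n1 =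
        Point.some _ _ n16 + Point.some _ _ n1 := by
      rw [← e16, ← e8, ← e4, ← e2]; abel
    rw [this]
    refine Point.add_of_Y_eq rfl ?_
    rw [negY]
    dsimp only [WeierstrassCurve.toAffine]
    rw [a3]; ring
  have : Fact (Nat.Prime 17) := ⟨by norm_num⟩
  exact addOrderOf_eq_prime hP (by rw [e1]; exact Point.some_ne_zero _)

end OrderSeventeen

/-! ### The birational maps between (x, y), (r, s) and (b, c). -/

section Model

variable {K : Type*} [Field K]

/-- The equation `f₁₇(x, y) = 0`. -/
def OnModel (x y : K) : Prop :=
  y ^ 4 + (x ^ 3 + x ^ 2 - x + 2) * y ^ 3 + (x ^ 3 - 3 * x + 1) * y ^ 2 - (x ^ 4 + 2 * x) * y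
    + x ^ 3 + x ^ 2 = 0

/-- The denominators of the parameters `r` and `s` do not vanish. -/
structure RegularParameters (x y : K) : Prop where
  hA : x ^ 2 + x * y + x - y ^ 2 - y ≠ 0
  hB : x + y + 1 ≠ 0

/-- The parameter `r` as a function of `x` and `y`. -/
def rOf (x y : K) : K := (x ^ 2 + x - y) / (x ^ 2 + x * y + x - y ^ 2 - y)

/-- The parameter `s` as a function of `x` and `y`. -/
def sOf (x y : K) : K := (x + 1) / (x + y + 1)

lemma raw17_homogenize {n d : K} (hd : d ≠ 0) (s : K) :
    d ^ 5 * raw17 (n / d) s =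
      -n ^ 5 + (s ^ 6 - 9 * s ^ 5 + 31 * s ^ 4 - 50 * s ^ 3 + 39 * s ^ 2 - 10 * s + 3) * n ^ 4 * d
      + (s ^ 6 - 3 * s ^ 5 - 12 * s ^ 4 + 46 * s ^ 3 - 54 * s ^ 2 + 15 * s - 3) * n ^ 3 * d ^ 2
      + (s ^ 6 + 3 * s ^ 5 - 9 * s ^ 4 - s ^ 3 + 21 * s ^ 2 - 6 * s + 1) * n ^ 2 * d ^ 3
      + (-s ^ 7 + 3 * s ^ 6 - 6 * s ^ 5 + 10 * s ^ 4 - 11 * s ^ 3) * n * d ^ 4 + s ^ 3 * d ^ 5 := by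
  obtain ⟨r, rfl⟩ : ∃ r, n = r * d := ⟨n / d, by field_simp⟩
  rw [mul_div_cancel_right₀ _ hd, raw17]
  ring

/-- With B = x + y + 1 one has x = sB - 1 and y = B(1 - s), and a factor B cancels in r, leaving r =
n/d with n and d linear in B. Then B · d⁵ · `raw17` (n/d) s = -(1 - s)¹¹ f₁₇(x, y), and B and d are
nonzero. -/
lemma raw17_rOf_sOf {x y : K} (h : RegularParameters x y) (hf : OnModel x y) :
    raw17 (rOf x y) (sOf x y) = 0 := by
  obtain ⟨hA, hB⟩ := h
  obtain ⟨s, hs⟩ : ∃ s, s = sOf x y := ⟨_, rfl⟩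
  obtain ⟨B, hB'⟩ : ∃ B, B = x + y + 1 := ⟨_, rfl⟩
  rw [← hB'] at hB
  have hx : x = s * B - 1 := by
    rw [hs, sOf, ← hB', div_mul_cancel₀ _ hB]; ring
  have hy : y = B * (1 - s) := by linear_combination -hB' - hx
  subst hx hy
  rw [← hs]
  have hr : rOf (s * B - 1) (B * (1 - s)) =
      (s ^ 2 * B - 1) / -((s ^ 2 - 3 * s + 1) * B + 2 - s) := by
    rw [rOf, ← mul_div_mul_left (s ^ 2 * B - 1) _ hB]
    congr 1 <;> ring
  have hd : -((s ^ 2 - 3 * s + 1) * B + 2 - s) ≠ 0 := by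
    intro h0
    refine hA ?_
    linear_combination B * h0
  refine (mul_eq_zero.mp ?_).resolve_left (mul_ne_zero hB (pow_ne_zero 5 hd))
  rw [hr, mul_assoc, raw17_homogenize hd]
  rw [OnModel] at hf
  linear_combination -(1 - s) ^ 11 * hf

/-- This and `y_mul_eq` invert the map to (r, s). The common denominator stays on the left, so its
nonvanishing is not needed yet. -/
lemma x_mul_eq {x y : K} (h : RegularParameters x y) :
    x * (rOf x y * sOf x y ^ 2 - 3 * rOf x y * sOf x y + rOf x y + sOf x y ^ 2) =
      (sOf x y - 1) * (rOf x y - sOf x y) := by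
  obtain ⟨hA, hB⟩ := h
  rw [rOf, sOf]
  obtain ⟨A, hA'⟩ : ∃ A, A = x ^ 2 + x * y + x - y ^ 2 - y := ⟨_, rfl⟩
  obtain ⟨B, hB'⟩ : ∃ B, B = x + y + 1 := ⟨_, rfl⟩
  rw [← hA'] at hA ⊢
  rw [← hB'] at hB ⊢
  field_simp
  rw [hA', hB']
  ring

lemma y_mul_eq {x y : K} (h : RegularParameters x y) :
    y * (rOf x y * sOf x y ^ 2 - 3 * rOf x y * sOf x y + rOf x y + sOf x y ^ 2) =
      -((sOf x y - 1) * (rOf x y * sOf x y - 2 * rOf x y + 1)) := by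
  obtain ⟨hA, hB⟩ := h
  rw [rOf, sOf]
  obtain ⟨A, hA'⟩ : ∃ A, A = x ^ 2 + x * y + x - y ^ 2 - y := ⟨_, rfl⟩
  obtain ⟨B, hB'⟩ : ∃ B, B = x + y + 1 := ⟨_, rfl⟩
  rw [← hA'] at hA ⊢
  rw [← hB'] at hB ⊢
  field_simp
  rw [hA', hB']
  ring

/-- The denominator in the formulas expressing `x`, `y` in terms of `b`, `c`. -/
def bcDenominator (b c : K) : K :=
  b * c ^ 4 + c ^ 5 - 3 * b ^ 2 * c ^ 2 + 3 * b * c ^ 3 + b ^ 3 - 2 * b ^ 2 * c + b * c ^ 2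

lemma bcDenominator_eq (r s : K) : bcDenominator (s * (r - 1) * r) (s * (r - 1)) =
    s ^ 3 * (r - 1) ^ 5 * (r * s ^ 2 - 3 * r * s + r + s ^ 2) := by
  rw [bcDenominator]; ring

lemma bcDenominator_ne_zero {r s : K} (hs : s ≠ 0) (hr1 : r - 1 ≠ 0)
    (hE : r * s ^ 2 - 3 * r * s + r + s ^ 2 ≠ 0) :
    bcDenominator (s * (r - 1) * r) (s * (r - 1)) ≠ 0 := by
  rw [bcDenominator_eq]
  exact mul_ne_zero (mul_ne_zero (pow_ne_zero _ hs) (pow_ne_zero _ hr1)) hE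

/-- Substituting r = b/c and s = c²/(b - c) into the inverse map gives the formula; the factor s³(r
- 1)⁵ is the one in `bcDenominator_eq`. -/
lemma x_eq_of_bc {x r s b c : K} (hb : b = c * r) (hc : c = s * (r - 1))
    (hx : x * (r * s ^ 2 - 3 * r * s + r + s ^ 2) = (s - 1) * (r - s))
    (hD : bcDenominator b c ≠ 0) :
    x = -((-c ^ 2 + b - c) * (-c ^ 3 + b ^ 2 - b * c)) / bcDenominator b c := by
  rw [eq_div_iff hD, bcDenominator]
  subst hb hc
  linear_combination s ^ 3 * (r - 1) ^ 5 * hx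

lemma y_eq_of_bc {y r s b c : K} (hb : b = c * r) (hc : c = s * (r - 1))
    (hy : y * (r * s ^ 2 - 3 * r * s + r + s ^ 2) = -((s - 1) * (r * s - 2 * r + 1)))
    (hD : bcDenominator b c ≠ 0) :
    y = -((-c ^ 2 + b - c) * (-b * c ^ 2 + 2 * b ^ 2 - 3 * b * c + c ^ 2)) /
      bcDenominator b c := by
  rw [eq_div_iff hD, bcDenominator]
  subst hb hc
  linear_combination s ^ 3 * (r - 1) ^ 5 * hy

end Model

/-! ### Values of functions at points -/

namespace X1Point

variable {Q : X1Point} {g h : FunField} {t u : QBar}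

lemma HasValue.unique (hg : Q.HasValue g t) (hg' : Q.HasValue g u) : t = u := by
  obtain ⟨_, rfl⟩ := hg
  obtain ⟨_, rfl⟩ := hg'
  rfl

lemma HasValue.add (hg : Q.HasValue g t) (hh : Q.HasValue h u) : Q.HasValue (g + h) (t + u) := by
  obtain ⟨hg, rfl⟩ := hg
  obtain ⟨hh, rfl⟩ := hh
  exact ⟨add_mem hg hh, map_add Q.eval ⟨g, hg⟩ ⟨h, hh⟩⟩

lemma HasValue.mul (hg : Q.HasValue g t) (hh : Q.HasValue h u) : Q.HasValue (g * h) (t * u) := by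
  obtain ⟨hg, rfl⟩ := hg
  obtain ⟨hh, rfl⟩ := hh
  exact ⟨mul_mem hg hh, map_mul Q.eval ⟨g, hg⟩ ⟨h, hh⟩⟩

lemma HasValue.neg (hg : Q.HasValue g t) : Q.HasValue (-g) (-t) := by
  obtain ⟨hg, rfl⟩ := hg
  exact ⟨neg_mem hg, map_neg Q.eval ⟨g, hg⟩⟩

lemma HasValue.sub (hg : Q.HasValue g t) (hh : Q.HasValue h u) : Q.HasValue (g - h) (t - u) := by
  rw [sub_eq_add_neg, sub_eq_add_neg]; exact hg.add hh.neg

lemma HasValue.pow (hg : Q.HasValue g t) (n : ℕ) : Q.HasValue (g ^ n) (t ^ n) := by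
  obtain ⟨hg, rfl⟩ := hg
  exact ⟨pow_mem hg n, map_pow Q.eval ⟨g, hg⟩ n⟩

lemma HasValue.one : Q.HasValue 1 1 := ⟨one_mem _, map_one Q.eval⟩

lemma HasValue.zero : Q.HasValue 0 0 := ⟨zero_mem _, map_zero Q.eval⟩

lemma HasValue.natCast (n : ℕ) : Q.HasValue (n : FunField) (n : QBar) :=
  ⟨natCast_mem _ n, map_natCast Q.eval n⟩

lemma HasValue.ofNat (n : ℕ) [n.AtLeastTwo] :
    Q.HasValue (OfNat.ofNat n : FunField) (OfNat.ofNat n : QBar) :=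
  HasValue.natCast n

lemma HasValue.inv (hg : Q.HasValue g t) (ht : t ≠ 0) : Q.HasValue g⁻¹ t⁻¹ := by
  obtain ⟨hg, rfl⟩ := hg
  have hu : IsUnit (⟨g, hg⟩ : Q.localRing) :=
    Q.isLocal.map_nonunit _ (isUnit_iff_ne_zero.mpr ht)
  obtain ⟨v, hv⟩ := hu.exists_right_inv
  have hgv : g * v = 1 := congrArg Subtype.val hv
  have hinv : g⁻¹ = v := inv_eq_of_mul_eq_one_right hgv
  have hv' := congrArg Q.eval hv
  rw [map_mul, map_one] at hv'
  refine ⟨hinv ▸ v.2, ?_⟩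
  have : (⟨g⁻¹, hinv ▸ v.2⟩ : Q.localRing) = v := Subtype.ext hinv
  rw [this]
  exact (inv_eq_of_mul_eq_one_right hv').symm

lemma HasValue.div (hg : Q.HasValue g t) (hh : Q.HasValue h u) (hu : u ≠ 0) :
    Q.HasValue (g / h) (t / u) := by
  rw [div_eq_mul_inv, div_eq_mul_inv]; exact hg.mul (hh.inv hu)

/-- Inequalities pass from one explicit point to the generic curve by this lemma. -/
lemma HasValue.ne_zero (hg : Q.HasValue g t) (ht : t ≠ 0) : g ≠ 0 := by
  rintro rfl
  exact ht (hg.unique HasValue.zero)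

lemma hasValue_algebraMap (q : ℚ) :
    Q.HasValue (algebraMap ℚ FunField q) (algebraMap ℚ QBar q) := by
  have hd : (q.den : QBar) ≠ 0 := by exact_mod_cast q.den_ne_zero
  have hn : ∀ n : ℤ, Q.HasValue (n : FunField) (n : QBar) := fun n =>
    ⟨intCast_mem _ n, map_intCast Q.eval n⟩
  have := (hn q.num).div (HasValue.natCast q.den) hd
  rwa [eq_ratCast, eq_ratCast, Rat.cast_def q, Rat.cast_def q]

/-- Either a function is regular, or its inverse vanishes. -/
lemma exists_hasValue_or_inv (Q : X1Point) (g : FunField) :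
    (∃ t, Q.HasValue g t) ∨ Q.HasValue g⁻¹ 0 := by
  rcases Q.localRing.mem_or_inv_mem g with h | h
  · exact Or.inl ⟨_, h, rfl⟩
  · by_cases h0 : Q.eval ⟨g⁻¹, h⟩ = 0
    · exact Or.inr ⟨h, h0⟩
    · have h1 : Q.HasValue g⁻¹ (Q.eval ⟨g⁻¹, h⟩) := ⟨h, rfl⟩
      have := h1.inv h0
      rw [inv_inv] at this
      exact Or.inl ⟨_, this⟩

end X1Point

/-! ### The point of a smooth affine point of the model -/

/-- If the localization of a noetherian domain at a prime ideal has principal maximal ideal, it is a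
valuation ring of the fraction field. -/
lemma exists_eq_div_or_inv_eq_div {A K : Type*} [CommRing A] [IsDomain A] [IsNoetherianRing A]
    [Field K] [Algebra A K] [IsFractionRing A K] (I : Ideal A) [I.IsPrime] (π : A) (hπ : π ∈ I)
    (h : ∀ a ∈ I, ∃ b, b ∉ I ∧ π ∣ b * a) (g : K) :
    ∃ a b : A, b ∉ I ∧ (g = algebraMap A K a / algebraMap A K b ∨
      g⁻¹ = algebraMap A K a / algebraMap A K b) := by
  let R := Localization.AtPrime I
  have hinj : Function.Injective (algebraMap A R) :=
    IsLocalization.injective R I.primeCompl_le_nonZeroDivisors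
  have : IsDomain R := IsLocalization.isDomain_localization I.primeCompl_le_nonZeroDivisors
  have : IsNoetherianRing R := IsLocalization.isNoetherianRing I.primeCompl R inferInstance
  -- The hypothesis says that each element of the ideal becomes a multiple of π after multiplication
  -- by some b outside it, and such b are units of the localization.
  have hmax : (IsLocalRing.maximalIdeal R).IsPrincipal := by
    refine ⟨algebraMap A R π, le_antisymm ?_ ?_⟩
    · intro z hz
      obtain ⟨a, s, rfl⟩ := IsLocalization.exists_mk'_eq I.primeCompl z
      rw [IsLocalization.AtPrime.mk'_mem_maximal_iff R I] at hz
      obtain ⟨b, hb, c, hc⟩ := h a hz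
      rw [Ideal.submodule_span_eq, Ideal.mem_span_singleton]
      refine ⟨IsLocalization.mk' R c (s * ⟨b, hb⟩ : I.primeCompl), ?_⟩
      rw [IsLocalization.mul_mk'_eq_mk'_of_mul]
      refine IsLocalization.mk'_eq_of_eq ?_
      rw [← hc, Submonoid.coe_mul]
      ring
    · rw [Ideal.submodule_span_eq, Ideal.span_singleton_le_iff_mem]
      exact (IsLocalization.AtPrime.to_map_mem_maximal_iff R I π).mpr hπ
  have hval : ValuationRing R :=
    ((tfae_of_isNoetherianRing_of_isLocalRing_of_isDomain R).out 4 1).mp hmax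
  obtain ⟨a, b, hb, rfl⟩ := IsFractionRing.div_surjective (A := A) g
  have key : ∀ a b : A, (∃ c : R, algebraMap A R a * c = algebraMap A R b) → a ≠ 0 →
      ∃ u s : A, s ∉ I ∧ algebraMap A K b / algebraMap A K a =
        algebraMap A K u / algebraMap A K s := by
    rintro a b ⟨c, hc⟩ ha
    obtain ⟨u, s, rfl⟩ := IsLocalization.exists_mk'_eq I.primeCompl c
    refine ⟨u, s, s.2, ?_⟩
    have hs : (s : A) ≠ 0 := fun h0 => s.2 (h0 ▸ I.zero_mem)
    have e : a * u = b * s := by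
      apply hinj
      rw [map_mul, map_mul, ← hc, mul_assoc, IsLocalization.mk'_spec]
    have h1 : algebraMap A K a ≠ 0 := by rwa [Ne, FaithfulSMul.algebraMap_eq_zero_iff]
    have h2 : algebraMap A K s ≠ 0 := by rwa [Ne, FaithfulSMul.algebraMap_eq_zero_iff]
    rw [div_eq_div_iff h1 h2, ← map_mul, ← map_mul, ← e, mul_comm]
  have hb0 := nonZeroDivisors.ne_zero hb
  obtain ⟨c, hc | hc⟩ := ValuationRing.cond (algebraMap A R a) (algebraMap A R b)
  · by_cases ha : a = 0
    · exact ⟨0, 1, fun h1 => ‹I.IsPrime›.ne_top ((Ideal.eq_top_iff_one I).mpr h1),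
        Or.inl (by simp [ha])⟩
    · obtain ⟨u, s, hs, e⟩ := key a b ⟨c, hc⟩ ha
      exact ⟨u, s, hs, Or.inr (by rw [inv_div, e])⟩
  · obtain ⟨u, s, hs, e⟩ := key b a ⟨c, hc⟩ hb0
    exact ⟨u, s, hs, Or.inl e⟩

section SmoothPoint

variable (x₀ y₀ : QBar)

/-- Evaluation of a polynomial in `x`, `y` at a point. -/
abbrev evalX : ℚ[X] →+* QBar := (aeval x₀ : ℚ[X] →ₐ[ℚ] QBar)

lemma eval₂_f17 : f17.eval₂ (evalX x₀) y₀ = y₀ ^ 4 + (x₀ ^ 3 + x₀ ^ 2 - x₀ + 2) * y₀ ^ 3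
    + (x₀ ^ 3 - 3 * x₀ + 1) * y₀ ^ 2 - (x₀ ^ 4 + 2 * x₀) * y₀ + x₀ ^ 3 + x₀ ^ 2 := by
  have e2 : (aeval x₀ : ℚ[X] →ₐ[ℚ] QBar) 2 = 2 := map_ofNat _ 2
  have e3 : (aeval x₀ : ℚ[X] →ₐ[ℚ] QBar) 3 = 3 := map_ofNat _ 3
  simp only [f17, eval₂_add, eval₂_sub, eval₂_mul, eval₂_pow, eval₂_X, eval₂_C]
  simp [add_assoc, e2, e3]

variable {x₀ y₀}

/-- Evaluation of regular functions on the affine model at a point. -/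
def evalCoord (hf : OnModel x₀ y₀) : CoordRing →+* QBar :=
  AdjoinRoot.lift (evalX x₀) y₀ (by rw [eval₂_f17]; exact hf)

lemma evalCoord_mk (hf : OnModel x₀ y₀) (g : ℚ[X][Y]) :
    evalCoord hf (AdjoinRoot.mk f17 g) = g.eval₂ (evalX x₀) y₀ := AdjoinRoot.lift_mk _ _

instance : IsNoetherianRing CoordRing :=
  inferInstanceAs (IsNoetherianRing (ℚ[X][Y] ⧸ Ideal.span {f17}))

lemma derivative_f17 (x₀ y₀ : QBar) : f17.derivative.eval₂ (evalX x₀) y₀ =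
    4 * y₀ ^ 3 + 3 * (x₀ ^ 3 + x₀ ^ 2 - x₀ + 2) * y₀ ^ 2
    + 2 * (x₀ ^ 3 - 3 * x₀ + 1) * y₀ - (x₀ ^ 4 + 2 * x₀) := by
  have e2 : (aeval x₀ : ℚ[X] →ₐ[ℚ] QBar) 2 = 2 := map_ofNat _ 2
  have e3 : (aeval x₀ : ℚ[X] →ₐ[ℚ] QBar) 3 = 3 := map_ofNat _ 3
  have e4 : (aeval x₀ : ℚ[X] →ₐ[ℚ] QBar) 4 = 4 := map_ofNat _ 4
  simp only [f17, derivative_add, derivative_sub, derivative_mul, derivative_X_pow, derivative_C,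
    derivative_X, eval₂_add, eval₂_sub, eval₂_mul, eval₂_pow, eval₂_X, eval₂_C]
  simp [e2, e3, e4]
  ring

/-- A point of the affine model at which the projection to the `x`-line is unramified and whose
second coordinate is a polynomial in the first. -/
structure IsSmoothPoint (x₀ : QBar) (h : ℚ[X]) : Prop where
  onModel : OnModel x₀ (aeval x₀ h)
  smooth : f17.derivative.eval₂ (evalX x₀) (aeval x₀ h) ≠ 0

lemma eval₂_aeval (g : ℚ[X][Y]) (h : ℚ[X]) :
    g.eval₂ (evalX x₀) (aeval x₀ h) = aeval x₀ (g.eval h) := by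
  change _ = evalX x₀ (g.eval h)
  rw [← eval₂_at_apply]
  rfl

variable {h : ℚ[X]}

/-- The minimal polynomial μ of x₀ is a uniformizer. Write g = g(h) + (Y - h)k and f₁₇ = f₁₇(h) + (Y
- h)k₀, where μ divides g(h) and f₁₇(h) because both vanish at x₀. In k₀g - kf₁₇ the terms with Y -
h cancel, so k₀g is a multiple of μ modulo f₁₇. The multiplier k₀ takes the value ∂f₁₇/∂y ≠ 0 at the
point. -/
lemma IsSmoothPoint.exists_dvd (H : IsSmoothPoint x₀ h) (a : CoordRing)
    (ha : evalCoord H.onModel a = 0) : ∃ b, evalCoord H.onModel b ≠ 0 ∧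
      AdjoinRoot.of f17 (minpoly ℚ x₀) ∣ b * a := by
  obtain ⟨g, rfl⟩ := AdjoinRoot.mk_surjective a
  rw [evalCoord_mk, eval₂_aeval] at ha
  obtain ⟨g₁, hg₁⟩ := minpoly.dvd ℚ x₀ ha
  have hf := H.onModel
  rw [OnModel, ← eval₂_f17, eval₂_aeval] at hf
  obtain ⟨f₁, hf₁⟩ := minpoly.dvd ℚ x₀ hf
  obtain ⟨k, hk⟩ := X_sub_C_dvd_sub_C_eval (a := h) (p := g)
  obtain ⟨k₀, hk₀⟩ := X_sub_C_dvd_sub_C_eval (a := h) (p := f17)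
  refine ⟨AdjoinRoot.mk f17 k₀, ?_, AdjoinRoot.mk f17 (k₀ * C g₁ - k * C f₁), ?_⟩
  · rw [evalCoord_mk]
    have hs := H.smooth
    have hd := congrArg derivative hk₀
    simp only [derivative_sub, derivative_C, sub_zero, derivative_mul, derivative_X, one_mul] at hd
    rw [hd, eval₂_add, eval₂_mul, eval₂_sub, eval₂_X, eval₂_C] at hs
    simpa using hs
  · rw [← AdjoinRoot.mk_C, ← map_mul, ← map_mul]
    rw [← sub_eq_zero, ← map_sub, AdjoinRoot.mk_eq_zero]
    refine ⟨k, ?_⟩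
    rw [hg₁, C_mul] at hk
    rw [hf₁, C_mul] at hk₀
    linear_combination k₀ * hk - k * hk₀

lemma IsSmoothPoint.exists_eq_div_or (H : IsSmoothPoint x₀ h) (g : FunField) :
    ∃ a b : CoordRing, evalCoord H.onModel b ≠ 0 ∧
      (g = algebraMap CoordRing FunField a / algebraMap CoordRing FunField b ∨
        g⁻¹ = algebraMap CoordRing FunField a / algebraMap CoordRing FunField b) := by
  have : (RingHom.ker (evalCoord H.onModel)).IsPrime := RingHom.ker_isPrime _
  refine exists_eq_div_or_inv_eq_div (RingHom.ker (evalCoord H.onModel))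
    (AdjoinRoot.of f17 (minpoly ℚ x₀)) ?_ (fun a ha => H.exists_dvd a ha) g
  rw [RingHom.mem_ker, ← AdjoinRoot.mk_C, evalCoord_mk, eval₂_C]
  exact minpoly.aeval ℚ x₀

lemma algebraMap_ne_zero_of_eval (hf : OnModel x₀ y₀) {b : CoordRing} (hb : evalCoord hf b ≠ 0) :
    algebraMap CoordRing FunField b ≠ 0 := by
  rw [Ne, FaithfulSMul.algebraMap_eq_zero_iff]
  rintro rfl
  exact hb (map_zero _)

/-- The functions regular at a point of the affine model. -/
def regularFunctions (hf : OnModel x₀ y₀) : Subring FunField where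
  carrier := {g | ∃ a b : CoordRing, evalCoord hf b ≠ 0 ∧
    g = algebraMap CoordRing FunField a / algebraMap CoordRing FunField b}
  one_mem' := ⟨1, 1, by simp, by simp⟩
  zero_mem' := ⟨0, 1, by simp, by simp⟩
  mul_mem' := by
    rintro _ _ ⟨a, b, hb, rfl⟩ ⟨c, d, hd, rfl⟩
    exact ⟨a * c, b * d, by rw [map_mul]; exact mul_ne_zero hb hd, by
      rw [map_mul, map_mul, div_mul_div_comm]⟩
  add_mem' := by
    rintro _ _ ⟨a, b, hb, rfl⟩ ⟨c, d, hd, rfl⟩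
    exact ⟨a * d + b * c, b * d, by rw [map_mul]; exact mul_ne_zero hb hd, by
      rw [div_add_div _ _ (algebraMap_ne_zero_of_eval hf hb) (algebraMap_ne_zero_of_eval hf hd)]
      simp only [map_add, map_mul]⟩
  neg_mem' := by
    rintro _ ⟨a, b, hb, rfl⟩
    exact ⟨-a, b, hb, by rw [map_neg, neg_div]⟩

lemma eval_div_well_defined (hf : OnModel x₀ y₀) {a b c d : CoordRing}
    (hb : evalCoord hf b ≠ 0) (hd : evalCoord hf d ≠ 0)
    (h : algebraMap CoordRing FunField a / algebraMap CoordRing FunField b =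
      algebraMap CoordRing FunField c / algebraMap CoordRing FunField d) :
    evalCoord hf a / evalCoord hf b = evalCoord hf c / evalCoord hf d := by
  rw [div_eq_div_iff (algebraMap_ne_zero_of_eval hf hb) (algebraMap_ne_zero_of_eval hf hd),
    ← map_mul, ← map_mul] at h
  rw [div_eq_div_iff hb hd, ← map_mul, ← map_mul, FaithfulSMul.algebraMap_injective _ _ h]

/-- The value of a regular function at a point of the affine model. -/
def evalFun (hf : OnModel x₀ y₀) (g : regularFunctions hf) : QBar :=
  evalCoord hf g.2.choose / evalCoord hf g.2.choose_spec.choose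

lemma evalFun_eq (hf : OnModel x₀ y₀) (g : regularFunctions hf) {a b : CoordRing}
    (hb : evalCoord hf b ≠ 0)
    (h : (g : FunField) = algebraMap CoordRing FunField a / algebraMap CoordRing FunField b) :
    evalFun hf g = evalCoord hf a / evalCoord hf b :=
  eval_div_well_defined hf g.2.choose_spec.choose_spec.1 hb
    (g.2.choose_spec.choose_spec.2.symm.trans h)

/-- Evaluation of regular functions at a point of the affine model. -/
def evalHom (hf : OnModel x₀ y₀) : regularFunctions hf →+* QBar where
  toFun := evalFun hf
  map_one' := by rw [evalFun_eq hf 1 (a := 1) (b := 1) (by simp) (by simp)]; simp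
  map_zero' := by rw [evalFun_eq hf 0 (a := 0) (b := 1) (by simp) (by simp)]; simp
  map_mul' := by
    rintro ⟨_, a, b, hb, rfl⟩ ⟨_, c, d, hd, rfl⟩
    rw [evalFun_eq hf ⟨_, a, b, hb, rfl⟩ hb rfl, evalFun_eq hf ⟨_, c, d, hd, rfl⟩ hd rfl,
      evalFun_eq hf (a := a * c) (b := b * d) _ (by rw [map_mul]; exact mul_ne_zero hb hd)
      (by rw [map_mul, map_mul, ← div_mul_div_comm]; rfl), map_mul, map_mul, div_mul_div_comm]
  map_add' := by
    rintro ⟨_, a, b, hb, rfl⟩ ⟨_, c, d, hd, rfl⟩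
    rw [evalFun_eq hf ⟨_, a, b, hb, rfl⟩ hb rfl, evalFun_eq hf ⟨_, c, d, hd, rfl⟩ hd rfl,
      evalFun_eq hf (a := a * d + b * c) (b := b * d) _
        (by rw [map_mul]; exact mul_ne_zero hb hd)
      (by
        rw [map_add, map_mul, map_mul, map_mul, ← div_add_div _ _
          (algebraMap_ne_zero_of_eval hf hb) (algebraMap_ne_zero_of_eval hf hd)]; rfl),
      div_add_div _ _ hb hd, map_add, map_mul, map_mul, map_mul]

/-- The point of `X₁(17)` at a smooth point of the affine model. -/
def IsSmoothPoint.toPoint (H : IsSmoothPoint x₀ h) : X1Point where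
  localRing :=
    { regularFunctions H.onModel with
      mem_or_inv_mem' := by
        intro g
        obtain ⟨a, b, hb, hg | hg⟩ := H.exists_eq_div_or g
        · exact Or.inl ⟨a, b, hb, hg⟩
        · exact Or.inr ⟨a, b, hb, hg⟩ }
  eval := evalHom H.onModel
  isLocal := by
    constructor
    rintro ⟨_, a, b, hb, rfl⟩ hu
    have he : evalHom H.onModel ⟨_, a, b, hb, rfl⟩ = evalCoord H.onModel a / evalCoord H.onModel b
      :=
      evalFun_eq H.onModel ⟨_, a, b, hb, rfl⟩ hb rfl
    have ha : evalCoord H.onModel a ≠ 0 := by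
      intro h0
      rw [h0, zero_div] at he
      exact hu.ne_zero he
    refine IsUnit.of_mul_eq_one ⟨_, b, a, ha, rfl⟩ (Subtype.ext ?_)
    have h1 := algebraMap_ne_zero_of_eval H.onModel ha
    have h2 := algebraMap_ne_zero_of_eval H.onModel hb
    change algebraMap CoordRing FunField a / algebraMap CoordRing FunField b *
      (algebraMap CoordRing FunField b / algebraMap CoordRing FunField a) = 1
    field_simp

/-- Every polynomial function takes the expected value at a point. -/
lemma X1Point.HasCoords.hasValue {Q : X1Point} (hQ : Q.HasCoords x₀ y₀) (hf : OnModel x₀ y₀)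
    (a : CoordRing) : Q.HasValue (algebraMap CoordRing FunField a) (evalCoord hf a) := by
  obtain ⟨g, rfl⟩ := AdjoinRoot.mk_surjective a
  have hX : ∀ g : ℚ[X], Q.HasValue (algebraMap CoordRing FunField (AdjoinRoot.of f17 g))
      (aeval x₀ g) := by
    intro g
    induction g using Polynomial.induction_on' with
    | add p q hp hq => simpa only [map_add] using hp.add hq
    | monomial n a =>
      rw [← C_mul_X_pow_eq_monomial]
      simp only [map_mul, map_pow, aeval_X, aeval_C]
      exact (X1Point.hasValue_algebraMap a).mul (hQ.1.pow n)
  rw [evalCoord_mk]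
  induction g using Polynomial.induction_on' with
  | add p q hp hq => simpa only [map_add, eval₂_add] using hp.add hq
  | monomial n a =>
    rw [← C_mul_X_pow_eq_monomial]
    simp only [map_mul, map_pow, AdjoinRoot.mk_C, AdjoinRoot.mk_X, eval₂_mul, eval₂_C, eval₂_pow,
      eval₂_X]
    exact (hX a).mul (hQ.2.pow n)

/-- A valuation ring is maximal under domination. If g is regular at Q but not a quotient with
nonvanishing denominator, then g⁻¹ is such a quotient and vanishes at Q, contradicting gg⁻¹ = 1. -/
lemma IsSmoothPoint.mem_localRing_iff (H : IsSmoothPoint x₀ h) {Q : X1Point}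
    (hQ : Q.HasCoords x₀ (aeval x₀ h)) (g : FunField) :
    g ∈ Q.localRing ↔ g ∈ regularFunctions H.onModel := by
  have hreg : ∀ {a b : CoordRing}, evalCoord H.onModel b ≠ 0 →
      Q.HasValue (algebraMap CoordRing FunField a / algebraMap CoordRing FunField b)
        (evalCoord H.onModel a / evalCoord H.onModel b) := fun {a b} hb =>
    (hQ.hasValue H.onModel a).div (hQ.hasValue H.onModel b) hb
  constructor
  · intro hg
    obtain ⟨a, b, hb, hg' | hg'⟩ := H.exists_eq_div_or g
    · exact ⟨a, b, hb, hg'⟩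
    · by_cases ha : evalCoord H.onModel a = 0
      · have h0 := hreg (a := a) hb
        rw [← hg', ha, zero_div] at h0
        have h1 : Q.HasValue g _ := ⟨hg, rfl⟩
        by_cases hg0 : g = 0
        · rw [hg0]; exact zero_mem _
        · have h2 := h1.mul h0
          rw [mul_inv_cancel₀ hg0, mul_zero] at h2
          exact absurd (h2.unique X1Point.HasValue.one) zero_ne_one
      · refine ⟨b, a, ha, ?_⟩
        rw [← inv_inv g, hg', inv_div]
  · rintro ⟨a, b, hb, rfl⟩
    exact (hreg hb).1

lemma IsSmoothPoint.hasValue (H : IsSmoothPoint x₀ h) {Q : X1Point}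
    (hQ : Q.HasCoords x₀ (aeval x₀ h)) (g : regularFunctions H.onModel) :
    Q.HasValue g (evalHom H.onModel g) := by
  obtain ⟨_, a, b, hb, rfl⟩ := g
  change Q.HasValue _ (evalFun H.onModel ⟨_, a, b, hb, rfl⟩)
  rw [evalFun_eq H.onModel ⟨_, a, b, hb, rfl⟩ hb rfl]
  exact (hQ.hasValue H.onModel a).div (hQ.hasValue H.onModel b) hb

lemma X1Point.ext_hasValue {Q R : X1Point} (h₁ : Q.localRing = R.localRing)
    (h₂ : ∀ g t, Q.HasValue g t → R.HasValue g t) : Q = R := by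
  obtain ⟨A, e, he⟩ := Q
  obtain ⟨B, f, hf⟩ := R
  obtain rfl : A = B := h₁
  have : e = f := by
    ext g
    obtain ⟨_, h⟩ := h₂ g (e g) ⟨g.2, rfl⟩
    exact h.symm
  subst this
  rfl

/-- There is exactly one point of `X₁(17)` at a smooth point of the affine model. -/
theorem IsSmoothPoint.existsUnique (H : IsSmoothPoint x₀ h) :
    ∃! Q : X1Point, Q.HasCoords x₀ (aeval x₀ h) := by
  refine ⟨H.toPoint, ⟨?_, ?_⟩, ?_⟩
  · refine ⟨⟨AdjoinRoot.of f17 X, 1, by simp, by simp [xFn]⟩, ?_⟩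
    refine (evalFun_eq H.onModel _ (a := AdjoinRoot.of f17 X) (b := 1) (by simp)
      (by simp [xFn])).trans ?_
    rw [← AdjoinRoot.mk_C, evalCoord_mk]
    simp
  · refine ⟨⟨AdjoinRoot.root f17, 1, by simp, by simp [yFn]⟩, ?_⟩
    refine (evalFun_eq H.onModel _ (a := AdjoinRoot.root f17) (b := 1) (by simp)
      (by simp [yFn])).trans ?_
    rw [← AdjoinRoot.mk_X, evalCoord_mk]
    simp
  · intro Q hQ
    symm
    refine X1Point.ext_hasValue ?_ ?_
    · ext g
      exact (H.mem_localRing_iff hQ g).symm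
    · rintro g t ⟨hg, rfl⟩
      exact H.hasValue hQ ⟨g, hg⟩

/-- The field of definition of a smooth point of the affine model. -/
theorem IsSmoothPoint.fieldOfDefinition_eq (H : IsSmoothPoint x₀ h) {Q : X1Point}
    (hQ : Q.HasCoords x₀ (aeval x₀ h)) :
    Q.fieldOfDefinition = IntermediateField.adjoin ℚ {x₀} := by
  apply le_antisymm
  · rw [X1Point.fieldOfDefinition, IntermediateField.adjoin_le_iff]
    rintro _ ⟨⟨g, hg⟩, rfl⟩
    obtain ⟨a, b, hb, rfl⟩ := (H.mem_localRing_iff hQ g).mp hg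
    have h1 : Q.HasValue (algebraMap CoordRing FunField a / algebraMap CoordRing FunField b) _ :=
      ⟨hg, rfl⟩
    rw [h1.unique ((hQ.hasValue H.onModel a).div (hQ.hasValue H.onModel b) hb)]
    have hmem : ∀ c : CoordRing, evalCoord H.onModel c ∈ IntermediateField.adjoin ℚ {x₀} := by
      intro c
      obtain ⟨g, rfl⟩ := AdjoinRoot.mk_surjective c
      rw [evalCoord_mk, eval₂_aeval]
      exact IntermediateField.algebra_adjoin_le_adjoin _ _ (aeval_mem_adjoin_singleton ℚ x₀)
    exact div_mem (hmem a) (hmem b)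
  · rw [IntermediateField.adjoin_le_iff, Set.singleton_subset_iff]
    obtain ⟨hx, hx'⟩ := hQ.1
    exact IntermediateField.subset_adjoin _ _ ⟨⟨xFn, hx⟩, hx'⟩

end SmoothPoint

/-! ### Cyclic quartic fields -/

section CyclicQuartic

open IntermediateField

/-- A monic quartic polynomial without linear and quadratic factors is irreducible. -/
lemma irreducible_quartic {k : Type*} [Field k] (p q r s : k)
    (h1 : ∀ a, a ^ 4 + p * a ^ 3 + q * a ^ 2 + r * a + s ≠ 0)
    (h2 : ∀ a b, r - b * (p - a) - a * (q - b - a * (p - a)) = 0 →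
      s - b * (q - b - a * (p - a)) ≠ 0) :
    Irreducible (X ^ 4 + C p * X ^ 3 + C q * X ^ 2 + C r * X + C s) := by
  have hd : (X ^ 4 + C p * X ^ 3 + C q * X ^ 2 + C r * X + C s).natDegree = 4 := by
    compute_degree!
  have hm : (X ^ 4 + C p * X ^ 3 + C q * X ^ 2 + C r * X + C s).Monic := by monicity!
  have hne : X ^ 4 + C p * X ^ 3 + C q * X ^ 2 + C r * X + C s ≠ 1 := by
    intro h; rw [h, natDegree_one] at hd; omega
  rw [hm.irreducible_iff_lt_natDegree_lt hne, hd]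
  intro f hf hfd hdvd
  have hcases : f.natDegree = 1 ∨ f.natDegree = 2 := by
    simp only [Finset.mem_Ioc] at hfd; omega
  rcases hcases with h | h
  · rw [hf.eq_X_add_C h, ← sub_neg_eq_add, ← C_neg, dvd_iff_isRoot] at hdvd
    simp only [IsRoot.def, eval_add, eval_mul, eval_pow, eval_X, eval_C] at hdvd
    exact h1 _ hdvd
  · set a := f.coeff 1
    set b := f.coeff 0
    have hfe : f = X ^ 2 + C a * X + C b := by
      have h2 : f.coeff 2 = 1 := by rw [← h]; exact hf
      conv_lhs => rw [f.as_sum_range_C_mul_X_pow, h]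
      simp [Finset.sum_range_succ, h2, a, b]; ring
    -- This is the remainder of the quartic on division by f, the quotient being X² + (p - a)X + (q
    -- - b - a(p - a)). Its degree is less than 2, so divisibility by f makes both coefficients
    -- vanish.
    have hr : f ∣ C (r - b * (p - a) - a * (q - b - a * (p - a))) * X +
        C (s - b * (q - b - a * (p - a))) := by
      have hx := dvd_sub hdvd (dvd_mul_right f (X ^ 2 + C (p - a) * X + C (q - b - a * (p - a))))
      convert hx using 1
      rw [hfe]
      simp only [map_sub, map_mul]
      ring
    have h0 := eq_zero_of_dvd_of_natDegree_lt hr (by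
      rw [h]; exact lt_of_le_of_lt natDegree_linear_le (by norm_num))
    have hc1 := congrArg (fun p => coeff p 1) h0
    have hc0 := congrArg (fun p => coeff p 0) h0
    simp only [coeff_add, coeff_C_mul, coeff_X_one, coeff_C_succ, coeff_X_zero, coeff_C_zero,
      coeff_zero, mul_one, mul_zero, add_zero, zero_add] at hc1 hc0
    exact h2 _ _ hc1 hc0

/-- Irreducibility over `ℚ` of a monic integral quartic that is irreducible modulo `3`. -/
lemma irreducible_quartic_rat (p q r s : ℤ)
    (h1 : ∀ a : ZMod 3, a ^ 4 + p * a ^ 3 + q * a ^ 2 + r * a + s ≠ 0)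
    (h2 : ∀ a b : ZMod 3, r - b * (p - a) - a * (q - b - a * (p - a)) = 0 →
      s - b * (q - b - a * (p - a)) ≠ 0) :
    Irreducible (X ^ 4 + C (p : ℚ) * X ^ 3 + C (q : ℚ) * X ^ 2 + C (r : ℚ) * X + C (s : ℚ)) := by
  have hm : (X ^ 4 + C p * X ^ 3 + C q * X ^ 2 + C r * X + C s).Monic := by monicity!
  have hZ : Irreducible (X ^ 4 + C p * X ^ 3 + C q * X ^ 2 + C r * X + C s) := by
    refine Monic.irreducible_of_irreducible_map (Int.castRingHom (ZMod 3)) _ hm ?_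
    simpa using irreducible_quartic (p : ZMod 3) q r s h1 h2
  simpa using (hm.irreducible_iff_irreducible_map_fraction_map (K := ℚ)).mp hZ

variable {F : ℚ[X]} {α : QBar}

lemma isIntegral_QBar (α : QBar) : IsIntegral ℚ α := by
  have h := AlgebraicClosure.isAlgebraic ℚ
  rw [← isAlgebraic_iff_isIntegral]
  convert h.isAlgebraic α
  exact Subsingleton.elim _ _

lemma aeval_minpoly_eq_zero (hF : Irreducible F) (hα : aeval α F = 0) {A : Type*} [Field A]
    [Algebra ℚ A] {a : A} (ha : aeval a F = 0) : aeval a (minpoly ℚ α) = 0 := by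
  rw [← minpoly.eq_of_irreducible hF hα, map_mul, ha, zero_mul]

lemma exists_algHom_adjoin (hF : Irreducible F) (hα : aeval α F = 0) {A : Type*} [Field A]
    [Algebra ℚ A] {a : A} (ha : aeval a F = 0) :
    ∃ φ : ℚ⟮α⟯ →ₐ[ℚ] A, φ (AdjoinSimple.gen ℚ α) = a := by
  have h : aeval a (minpoly ℚ (adjoin.powerBasis (isIntegral_QBar α)).gen) = 0 := by
    rw [adjoin.powerBasis_gen]
    convert aeval_minpoly_eq_zero hF hα ha using 2
    convert minpoly_gen ℚ α
    · rfl
    · exact Subsingleton.elim _ _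
  exact ⟨(adjoin.powerBasis (isIntegral_QBar α)).lift a h,
    (adjoin.powerBasis (isIntegral_QBar α)).lift_gen a h⟩

lemma finrank_adjoin_root (hF : Irreducible F) (hα : aeval α F = 0) :
    Module.finrank ℚ ℚ⟮α⟯ = F.natDegree := by
  rw [adjoin.finrank (isIntegral_QBar α), ← minpoly.eq_of_irreducible hF hα,
    natDegree_mul_C (inv_ne_zero (leadingCoeff_ne_zero.mpr hF.ne_zero))]

lemma aeval_gen (hα : aeval α F = 0) : aeval (AdjoinSimple.gen ℚ α) F = 0 := by
  apply (algebraMap ℚ⟮α⟯ QBar).injective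
  rw [map_zero, ← aeval_algebraMap_apply, AdjoinSimple.algebraMap_gen, hα]

/-- A quartic polynomial one of whose roots is moved in a `4`-cycle by a polynomial generates a
cyclic extension. -/
lemma isCyclicQuartic_adjoin (hF : Irreducible F) (hd : F.natDegree = 4) (hα : aeval α F = 0)
    (g : ℚ⟮α⟯ → ℚ⟮α⟯) (hgσ : ∀ (σ : ℚ⟮α⟯ →ₐ[ℚ] ℚ⟮α⟯) x, σ (g x) = g (σ x))
    (hg : ∀ x, aeval x F = 0 → aeval (g x) F = 0)
    (hg2 : ∀ x, aeval x F = 0 → g (g x) ≠ x)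
    (hg4 : ∀ x, aeval x F = 0 → g (g (g (g x))) = x) : IsCyclicQuartic ℚ⟮α⟯ := by
  have hfr : Module.finrank ℚ ℚ⟮α⟯ = 4 := by rw [finrank_adjoin_root hF hα, hd]
  have : FiniteDimensional ℚ ℚ⟮α⟯ := adjoin.finiteDimensional (isIntegral_QBar α)
  have hx := aeval_gen hα
  set x := AdjoinSimple.gen ℚ α with hxdef
  -- Sending the generator to its conjugate g x defines an automorphism. It commutes with g, so its
  -- powers act on the generator by iterating g.
  obtain ⟨φ, hφ⟩ := exists_algHom_adjoin hF hα (hg x hx)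
  rw [← hxdef] at hφ
  let σ : ℚ⟮α⟯ ≃ₐ[ℚ] ℚ⟮α⟯ := AlgEquiv.ofBijective φ φ.bijective
  have hσ : ∀ y, σ y = φ y := fun y => rfl
  have h2 : σ ^ 2 ≠ 1 := by
    intro h
    have := DFunLike.congr_fun h x
    rw [pow_two, AlgEquiv.mul_apply, AlgEquiv.one_apply, hσ, hσ, hφ, hgσ, hφ] at this
    exact hg2 x hx this
  have h4 : σ ^ 4 = 1 := by
    have hp : (σ ^ 4 : ℚ⟮α⟯ ≃ₐ[ℚ] ℚ⟮α⟯).toAlgHom = AlgHom.id ℚ _ := by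
      refine (adjoin.powerBasis (isIntegral_QBar α)).algHom_ext ?_
      rw [adjoin.powerBasis_gen, ← hxdef]
      change (σ ^ 4) x = x
      simp only [pow_succ, pow_zero, one_mul, AlgEquiv.mul_apply, hσ, hφ, hgσ]
      exact hg4 x hx
    ext y
    exact congrArg Subtype.val (DFunLike.congr_fun hp y)
  have horder : orderOf σ = 4 :=
    -- With p = 2 and n = 1 the criterion reads σ² ≠ 1 and σ⁴ = 1.
    orderOf_eq_prime_pow (p := 2) (n := 1) (by simpa using h2) (by simpa using h4)
  have hcard : Nat.card (ℚ⟮α⟯ ≃ₐ[ℚ] ℚ⟮α⟯) = 4 := by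
    apply le_antisymm
    · rw [Nat.card_eq_fintype_card, ← hfr]
      exact AlgEquiv.card_le
    · rw [← horder]
      exact orderOf_le_card
  exact ⟨hfr, IsGalois.of_card_aut_eq_finrank _ _ (hcard.trans hfr.symm),
    isCyclic_of_orderOf_eq_card σ (horder.trans hcard.symm)⟩

lemma ncard_roots (hF : Irreducible F) : {α : QBar | aeval α F = 0}.ncard = F.natDegree := by
  have h : {α : QBar | aeval α F = 0} = F.rootSet QBar := by
    ext α
    rw [mem_rootSet]
    exact ⟨fun h => ⟨hF.ne_zero, h⟩, fun h => h.2⟩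
  rw [h, ← Nat.card_coe_set_eq, Nat.card_eq_fintype_card,
    card_rootSet_eq_natDegree hF.separable (IsAlgClosed.splits _)]

/-- The minimal polynomial of `αᵢ`, up to a constant. -/
def alphaPoly : ℤ[X] := 2 * X ^ 4 - 5 * X ^ 3 - 7 * X ^ 2 + 10 * X + 8

/-- The minimal polynomial of `βᵢ`, up to a constant. -/
def betaPoly : ℤ[X] := 8 * X ^ 4 + 14 * X ^ 3 - 11 * X ^ 2 - 11 * X - 2

lemma aeval_alphaPoly {A : Type*} [CommRing A] (a : A) :
    aeval a alphaPoly = 2 * a ^ 4 - 5 * a ^ 3 - 7 * a ^ 2 + 10 * a + 8 := by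
  simp only [alphaPoly, map_add, map_sub, map_mul, map_pow, aeval_X, map_ofNat]

lemma aeval_betaPoly {A : Type*} [CommRing A] (a : A) :
    aeval a betaPoly = 8 * a ^ 4 + 14 * a ^ 3 - 11 * a ^ 2 - 11 * a - 2 := by
  simp only [betaPoly, map_add, map_sub, map_mul, map_pow, aeval_X, map_ofNat]

lemma aeval_alphaPoly_map {A : Type*} [Field A] [Algebra ℚ A] (a : A) :
    aeval a (alphaPoly.map (algebraMap ℤ ℚ)) =
      2 * a ^ 4 - 5 * a ^ 3 - 7 * a ^ 2 + 10 * a + 8 := by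
  rw [aeval_map_algebraMap, aeval_alphaPoly]

lemma aeval_betaPoly_map {A : Type*} [Field A] [Algebra ℚ A] (a : A) :
    aeval a (betaPoly.map (algebraMap ℤ ℚ)) =
      8 * a ^ 4 + 14 * a ^ 3 - 11 * a ^ 2 - 11 * a - 2 := by
  rw [aeval_map_algebraMap, aeval_betaPoly]

lemma natDegree_alphaPoly : (alphaPoly.map (algebraMap ℤ ℚ)).natDegree = 4 := by
  simp only [alphaPoly, Polynomial.map_add, Polynomial.map_sub, Polynomial.map_mul,
    Polynomial.map_pow, map_X, Polynomial.map_ofNat]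
  compute_degree!

lemma natDegree_betaPoly : (betaPoly.map (algebraMap ℤ ℚ)).natDegree = 4 := by
  simp only [betaPoly, Polynomial.map_add, Polynomial.map_sub, Polynomial.map_mul,
    Polynomial.map_pow, map_X, Polynomial.map_ofNat]
  compute_degree!

/-- If F is this polynomial, 8F(X/2) = X⁴ - 5X³ - 14X² + 40X + 64 is monic, integral and irreducible
modulo 3; the automorphism X ↦ 2X of ℚ[X] brings this back to F. -/
lemma irreducible_alphaPoly : Irreducible (alphaPoly.map (algebraMap ℤ ℚ)) := by
  have : Invertible (2 : ℚ) := invertibleOfNonzero two_ne_zero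
  have h := irreducible_quartic_rat (-5) (-14) 40 64 (by decide) (by decide)
  rw [← MulEquiv.irreducible_iff (algEquivCMulXAddC (2 : ℚ) 0)] at h
  have hu : IsUnit (C (1 / 8 : ℚ)) := isUnit_C.mpr (by norm_num)
  rw [← irreducible_isUnit_mul hu] at h
  convert h using 1
  refine Polynomial.funext fun t => ?_
  simp [alphaPoly]
  ring

/-- The monic integral form is 32F(X/4) = X⁴ + 7X³ - 22X² - 88X - 64, again irreducible modulo 3. -/
lemma irreducible_betaPoly : Irreducible (betaPoly.map (algebraMap ℤ ℚ)) := by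
  have : Invertible (4 : ℚ) := invertibleOfNonzero four_ne_zero
  have h := irreducible_quartic_rat 7 (-22) (-88) (-64) (by decide) (by decide)
  rw [← MulEquiv.irreducible_iff (algEquivCMulXAddC (4 : ℚ) 0)] at h
  have hu : IsUnit (C (1 / 32 : ℚ)) := isUnit_C.mpr (by norm_num)
  rw [← irreducible_isUnit_mul hu] at h
  convert h using 1
  refine Polynomial.funext fun t => ?_
  simp [betaPoly]
  ring

end CyclicQuartic

/-! ### The points belonging to the roots `αᵢ` and `βᵢ` -/

section Alpha

variable {K : Type*} [Field K]

/-- The second coordinate of the point belonging to `α`. -/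
def alphaY (α : K) : K := α ^ 2 / 2 - α / 2 - 2

/-- The value of `r` at the point belonging to `α`. -/
def alphaR (α : K) : K := 1 / 2 * α ^ 3 - 17 / 4 * α ^ 2 + 15 / 4 * α + 14

/-- The value of `s` at the point belonging to `α`. -/
def alphaS (α : K) : K := -3 / 8 * α ^ 3 + 11 / 16 * α ^ 2 + 23 / 16 * α + 1 / 4

variable [CharZero K] {α : K}

lemma onModel_alpha (hα : 2 * α ^ 4 - 5 * α ^ 3 - 7 * α ^ 2 + 10 * α + 8 = 0) :
    OnModel α (alphaY α) := by
  simp only [OnModel, alphaY]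
  linear_combination (1 / 16 * α ^ 5 + 1 / 16 * α ^ 4 - 7 / 16 * α ^ 3 - 13 / 16 * α ^ 2 + 1 /
    8 * α + 1 / 2) * hα

/-- The witness is the inverse in ℚ(α), as furnished by the extended Euclidean algorithm, and the
coefficient of `hα` is the resulting quotient by the quartic. The other nonvanishing statements for
α and β are certified in the same way. -/
lemma derivative_alpha_ne_zero (hα : 2 * α ^ 4 - 5 * α ^ 3 - 7 * α ^ 2 + 10 * α + 8 = 0) :
    4 * alphaY α ^ 3 + 3 * (α ^ 3 + α ^ 2 - α + 2) * alphaY α ^ 2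
      + 2 * (α ^ 3 - 3 * α + 1) * alphaY α - (α ^ 4 + 2 * α) ≠ 0 := by
  refine left_ne_zero_of_mul_eq_one (b := -1811 / 17408 * α ^ 3 + 9287 / 34816 * α ^ 2 + 14561 /
    34816 * α - 14781 / 17408) ?_
  simp only [alphaY]
  linear_combination (-5433 / 139264 * α ^ 6 + 127 / 8192 * α ^ 5 + 15383 / 34816 * α ^ 4 +
    8257 / 139264 * α ^ 3 - 201621 / 139264 * α ^ 2 - 32803 / 69632 * α + 39991 / 34816) * hα

lemma alpha_denominator_r_ne_zero (hα : 2 * α ^ 4 - 5 * α ^ 3 - 7 * α ^ 2 + 10 * α + 8 = 0) :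
    α ^ 2 + α * alphaY α + α - alphaY α ^ 2 - alphaY α ≠ 0 := by
  refine left_ne_zero_of_mul_eq_one (b := 19 / 16 * α ^ 3 - 135 / 32 * α ^ 2 - 33 / 32 * α + 149 /
    16) ?_
  simp only [alphaY]
  linear_combination (-19 / 128 * α ^ 3 + 3 / 4 * α ^ 2 + 53 / 128 * α - 157 / 64) * hα

lemma alpha_denominator_s_ne_zero (hα : 2 * α ^ 4 - 5 * α ^ 3 - 7 * α ^ 2 + 10 * α + 8 = 0) :
    α + alphaY α + 1 ≠ 0 := by
  refine left_ne_zero_of_mul_eq_one (b := -1 / 8 * α ^ 3 + 1 / 16 * α ^ 2 + 17 / 16 * α - 1 / 4) ?_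
  simp only [alphaY]
  linear_combination (-1 / 32 * α - 3 / 32) * hα

lemma regularParameters_alpha (hα : 2 * α ^ 4 - 5 * α ^ 3 - 7 * α ^ 2 + 10 * α + 8 = 0) :
    RegularParameters α (alphaY α) :=
  ⟨alpha_denominator_r_ne_zero hα, alpha_denominator_s_ne_zero hα⟩

lemma rOf_alpha (hα : 2 * α ^ 4 - 5 * α ^ 3 - 7 * α ^ 2 + 10 * α + 8 = 0) :
    rOf α (alphaY α) = alphaR α := by
  rw [rOf, div_eq_iff (alpha_denominator_r_ne_zero hα), alphaR, alphaY]
  linear_combination (1 / 16 * α ^ 3 - 5 / 8 * α ^ 2 + 13 / 16 * α + 15 / 4) * hα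

lemma sOf_alpha (hα : 2 * α ^ 4 - 5 * α ^ 3 - 7 * α ^ 2 + 10 * α + 8 = 0) :
    sOf α (alphaY α) = alphaS α := by
  rw [sOf, div_eq_iff (alpha_denominator_s_ne_zero hα), alphaS, alphaY]
  linear_combination (3 / 32 * α + 5 / 32) * hα

lemma alpha_r_ne_zero (hα : 2 * α ^ 4 - 5 * α ^ 3 - 7 * α ^ 2 + 10 * α + 8 = 0) :
    alphaR α ≠ 0 := by
  refine left_ne_zero_of_mul_eq_one (b := -1 / 8 * α ^ 3 + 11 / 16 * α ^ 2 - 3 / 8 * α - 1 / 2) ?_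
  simp only [alphaR]
  linear_combination (-1 / 32 * α ^ 2 + 23 / 64 * α - 1) * hα

lemma alpha_s_ne_zero (hα : 2 * α ^ 4 - 5 * α ^ 3 - 7 * α ^ 2 + 10 * α + 8 = 0) :
    alphaS α ≠ 0 := by
  refine left_ne_zero_of_mul_eq_one (b := -α ^ 3 + 7 / 2 * α ^ 2 + 1 / 2 * α - 5) ?_
  simp only [alphaS]
  linear_combination (3 / 16 * α ^ 2 - 17 / 32 * α - 9 / 32) * hα

lemma alpha_r_sub_one_ne_zero (hα : 2 * α ^ 4 - 5 * α ^ 3 - 7 * α ^ 2 + 10 * α + 8 = 0) :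
    alphaR α - 1 ≠ 0 := by
  refine left_ne_zero_of_mul_eq_one (b := 1 / 8 * α ^ 3 - 29 / 16 * α ^ 2 + 21 / 16 * α + 15 / 8) ?_
  simp only [alphaR]
  linear_combination (1 / 32 * α ^ 2 - 41 / 64 * α + 187 / 64) * hα

lemma alpha_r_sub_s_ne_zero (hα : 2 * α ^ 4 - 5 * α ^ 3 - 7 * α ^ 2 + 10 * α + 8 = 0) :
    alphaR α - alphaS α ≠ 0 := by
  refine left_ne_zero_of_mul_eq_one (b := 3 / 4 * α ^ 3 + 17 / 8 * α ^ 2 - 25 / 8 * α - 11 / 4) ?_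
  simp only [alphaR, alphaS]
  linear_combination (21 / 64 * α ^ 2 - 13 / 128 * α - 621 / 128) * hα

lemma alpha_d_ne_zero (hα : 2 * α ^ 4 - 5 * α ^ 3 - 7 * α ^ 2 + 10 * α + 8 = 0) :
    alphaR α * alphaS α - 2 * alphaR α + 1 ≠ 0 := by
  refine left_ne_zero_of_mul_eq_one (b := -11 / 4 * α ^ 3 - 49 / 8 * α ^ 2 + 81 / 8 * α + 35 / 4) ?_
  simp only [alphaR, alphaS]
  linear_combination (33 / 128 * α ^ 5 - 185 / 128 * α ^ 4 - 2371 / 512 * α ^ 3 + 3941 / 256 *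
    α ^ 2 + 8897 / 512 * α - 1653 / 64) * hα

lemma alpha_m_ne_zero (hα : 2 * α ^ 4 - 5 * α ^ 3 - 7 * α ^ 2 + 10 * α + 8 = 0) :
    alphaR α - alphaS α ^ 2 + alphaS α - 1 ≠ 0 := by
  refine left_ne_zero_of_mul_eq_one (b := 47 / 4 * α ^ 3 - 19 / 8 * α ^ 2 - 149 / 8 * α - 31 / 4) ?_
  simp only [alphaR, alphaS]
  linear_combination (-423 / 512 * α ^ 5 + 579 / 512 * α ^ 4 + 8581 / 2048 * α ^ 3 + 3903 /
    1024 * α ^ 2 - 38719 / 2048 * α - 6605 / 512) * hα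

lemma dup8_alpha_ne_zero (hα : 2 * α ^ 4 - 5 * α ^ 3 - 7 * α ^ 2 + 10 * α + 8 = 0) :
    dup8 (alphaR α) (alphaS α) ≠ 0 := by
  refine left_ne_zero_of_mul_eq_one (b := -18863249 / 128 * α ^ 3 - 17235891 / 256 * α ^ 2 +
    81038699 / 256 * α + 25510945 / 128) ?_
  simp only [dup8, alphaR, alphaS]
  linear_combination (-4583769507 / 16777216 * α ^ 17 + 67426343433 / 16777216 * α ^ 16 -
    1033498435113 / 67108864 * α ^ 15 - 431492926275 / 16777216 * α ^ 14 + 71751551720007 /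
    268435456 * α ^ 13 - 103271684505155 / 268435456 * α ^ 12 - 263103695863751 / 1073741824 *
    α ^ 11 + 986356205830299 / 536870912 * α ^ 10 - 12984327166034353 / 1073741824 * α ^ 9 +
    18844041834833 / 1048576 * α ^ 8 + 77596759391988487 / 1073741824 * α ^ 7 -
    77647830488233897 / 536870912 * α ^ 6 - 212821666877256859 / 1073741824 * α ^ 5 +
    50681746976925489 / 134217728 * α ^ 4 + 10685117214693715 / 33554432 * α ^ 3 -
    785204269947821 / 2097152 * α ^ 2 - 1018199967348739 / 4194304 * α + 34809454788459 /
    524288) * hα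

lemma discFactor_alpha_ne_zero (hα : 2 * α ^ 4 - 5 * α ^ 3 - 7 * α ^ 2 + 10 * α + 8 = 0) :
    discFactor (alphaR α) (alphaS α) ≠ 0 := by
  refine left_ne_zero_of_mul_eq_one (b := 34411 / 68 * α ^ 3 + 31905 / 136 * α ^ 2 - 148233 / 136 *
    α - 46779 / 68) ?_
  simp only [discFactor, alphaR, alphaS]
  linear_combination (-929097 / 278528 * α ^ 14 + 36302445 / 557056 * α ^ 13 - 1658817 / 4096 *
    α ^ 12 + 429513145 / 1114112 * α ^ 11 + 21509691623 / 4456448 * α ^ 10 - 122374492327 /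
    8912896 * α ^ 9 - 135722854991 / 8912896 * α ^ 8 + 406372783009 / 4456448 * α ^ 7 -
    1501535231 / 139264 * α ^ 6 - 2440373740227 / 8912896 * α ^ 5 + 1021628710641 / 8912896 * α
    ^ 4 + 121624096253 / 278528 * α ^ 3 - 30193396665 / 278528 * α ^ 2 - 10901401751 / 34816 *
    α - 1871024015 / 34816) * hα

lemma noncuspidal_alpha (hα : 2 * α ^ 4 - 5 * α ^ 3 - 7 * α ^ 2 + 10 * α + 8 = 0) :
    Noncuspidal (alphaR α) (alphaS α) :=
  ⟨alpha_r_ne_zero hα, alpha_s_ne_zero hα, alpha_r_sub_one_ne_zero hα, alpha_r_sub_s_ne_zero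
    hα, alpha_d_ne_zero hα, alpha_m_ne_zero hα, dup8_alpha_ne_zero hα, discFactor_alpha_ne_zero
    hα⟩

lemma alpha_bcDenominator_factor_ne_zero (hα : 2 * α ^ 4 - 5 * α ^ 3 - 7 * α ^ 2 + 10 * α + 8 = 0) :
    alphaR α * alphaS α ^ 2 - 3 * alphaR α * alphaS α + alphaR α + alphaS α ^ 2 ≠ 0 := by
  refine left_ne_zero_of_mul_eq_one (b := -79 / 4 * α ^ 3 - 41 / 8 * α ^ 2 + 313 / 8 * α + 91 / 4)
    ?_
  simp only [alphaR, alphaS]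
  linear_combination (-711 / 1024 * α ^ 8 + 13377 / 2048 * α ^ 7 - 26179 / 4096 * α ^ 6 -
    436689 / 8192 * α ^ 5 + 496579 / 8192 * α ^ 4 + 1241905 / 8192 * α ^ 3 - 701321 / 8192 * α
    ^ 2 - 67387 / 512 * α + 6397 / 512) * hα

lemma c1_eq (hα : 2 * α ^ 4 - 5 * α ^ 3 - 7 * α ^ 2 + 10 * α + 8 = 0) :
    alphaS α * (alphaR α - 1) = c1 α := by
  simp only [alphaR, alphaS, c1]
  linear_combination (-3 / 32 * α ^ 2 + 47 / 64 * α - 19 / 64) * hα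

lemma b1_eq (hα : 2 * α ^ 4 - 5 * α ^ 3 - 7 * α ^ 2 + 10 * α + 8 = 0) :
    alphaS α * (alphaR α - 1) * alphaR α = b1 α := by
  rw [c1_eq hα, b1, c1, alphaR]
  linear_combination (-59 / 64 * α ^ 2 + 855 / 128 * α + 125 / 128) * hα

lemma alphaY_add_one_ne_zero (hα : 2 * α ^ 4 - 5 * α ^ 3 - 7 * α ^ 2 + 10 * α + 8 = 0) :
    alphaY α + 1 ≠ 0 := by
  refine left_ne_zero_of_mul_eq_one (b := -1 / 2 * α ^ 3 + 9 / 4 * α ^ 2 - 3 / 4 * α - 4) ?_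
  simp only [alphaY]
  linear_combination (-1 / 8 * α + 3 / 8) * hα

lemma alpha_sub_alphaY_ne_zero (hα : 2 * α ^ 4 - 5 * α ^ 3 - 7 * α ^ 2 + 10 * α + 8 = 0) :
    α - alphaY α ≠ 0 := by
  refine left_ne_zero_of_mul_eq_one (b := 13 / 32 * α ^ 3 - 89 / 64 * α ^ 2 + 1 / 64 * α + 67 / 32)
    ?_
  simp only [alphaY]
  linear_combination (-13 / 128 * α + 51 / 128) * hα

lemma alpha_p1_value (hα : 2 * α ^ 4 - 5 * α ^ 3 - 7 * α ^ 2 + 10 * α + 8 = 0) :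
    (α ^ 2 + α * alphaY α - alphaY α ^ 2 + α - 2 * alphaY α - 1) / (alphaY α + 1) ^ 2 = 3 := by
  rw [div_eq_iff (pow_ne_zero 2 (alphaY_add_one_ne_zero hα)), alphaY]
  linear_combination (-1 / 2) * hα

lemma alpha_p2_value (hα : 2 * α ^ 4 - 5 * α ^ 3 - 7 * α ^ 2 + 10 * α + 8 = 0) :
    (α ^ 3 * alphaY α ^ 2 - α ^ 4 + 2 * α ^ 3 * alphaY α + 2 * α ^ 2 * alphaY α ^ 2 - α ^ 3
      + α ^ 2 * alphaY α + alphaY α ^ 3 - α * alphaY α + alphaY α ^ 2) /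
      ((alphaY α + 1) ^ 2 * (α - alphaY α)) = -2 := by
  rw [div_eq_iff (mul_ne_zero (pow_ne_zero 2 (alphaY_add_one_ne_zero hα))
    (alpha_sub_alphaY_ne_zero hα)), alphaY]
  linear_combination (1 / 8 * α ^ 3 + 1 / 4 * α ^ 2 + 5 / 8 * α) * hα

/-- A generator of the Galois group acting on the roots `α`. -/
def alphaConj (α : K) : K := -α ^ 2 + 3 / 2 * α + 3

lemma alphaConj_root (hα : 2 * α ^ 4 - 5 * α ^ 3 - 7 * α ^ 2 + 10 * α + 8 = 0) :
    2 * alphaConj α ^ 4 - 5 * alphaConj α ^ 3 - 7 * alphaConj α ^ 2 + 10 * alphaConj α + 8 = 0 := by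
  rw [alphaConj]
  linear_combination (α ^ 4 - 7 / 2 * α ^ 3 - 5 / 4 * α ^ 2 + 71 / 8 * α + 1 / 4) * hα

lemma alphaConj_alphaConj (hα : 2 * α ^ 4 - 5 * α ^ 3 - 7 * α ^ 2 + 10 * α + 8 = 0) :
    alphaConj (alphaConj α) = 1 / 2 * α ^ 3 - 5 / 4 * α ^ 2 - 7 / 4 * α + 5 / 2 := by
  rw [alphaConj, alphaConj]
  linear_combination (-1 / 2) * hα

lemma alphaConj_alphaConj_ne (hα : 2 * α ^ 4 - 5 * α ^ 3 - 7 * α ^ 2 + 10 * α + 8 = 0) :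
    alphaConj (alphaConj α) ≠ α := by
  rw [alphaConj_alphaConj hα, ← sub_ne_zero]
  refine left_ne_zero_of_mul_eq_one (b := 3 / 85 * α ^ 3 - 7 / 170 * α ^ 2 - 53 / 170 * α + 8 / 85)
    ?_
  linear_combination (3 / 340 * α ^ 2 - 7 / 680 * α - 13 / 136) * hα

lemma alphaConj_order_four (hα : 2 * α ^ 4 - 5 * α ^ 3 - 7 * α ^ 2 + 10 * α + 8 = 0) :
    alphaConj (alphaConj (alphaConj (alphaConj α))) = α := by
  -- The fourth iterate is computed as the second iterate composed with itself, in reduced form,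
  -- which keeps the degrees small.
  rw [alphaConj_alphaConj (alphaConj_root (alphaConj_root hα)), alphaConj_alphaConj hα]
  linear_combination (1 / 32 * α ^ 5 - 5 / 32 * α ^ 4 - 3 / 128 * α ^ 3 + 45 / 64 * α ^ 2 - 17
    / 128 * α - 15 / 64) * hα

end Alpha

/-! ### Identities at the points over P₂. -/

section Beta

variable {K : Type*} [Field K]

/-- The second coordinate of the point belonging to `β`. -/
def betaY (β : K) : K := -2 * β - 1

/-- The value of `r` at the point belonging to `β`. -/
def betaR (β : K) : K := -41 / 8 * β ^ 3 - 247 / 32 * β ^ 2 + 559 / 64 * β + 285 / 64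

/-- The value of `s` at the point belonging to `β`. -/
def betaS (β : K) : K := -4 * β ^ 3 - 7 * β ^ 2 + 11 / 2 * β + 9 / 2

variable [CharZero K] {β : K}

omit [CharZero K] in
lemma onModel_beta (hβ : 8 * β ^ 4 + 14 * β ^ 3 - 11 * β ^ 2 - 11 * β - 2 = 0) :
    OnModel β (betaY β) := by
  simp only [OnModel, betaY]
  linear_combination (-β ^ 2) * hβ

lemma derivative_beta_ne_zero (hβ : 8 * β ^ 4 + 14 * β ^ 3 - 11 * β ^ 2 - 11 * β - 2 = 0) :
    4 * betaY β ^ 3 + 3 * (β ^ 3 + β ^ 2 - β + 2) * betaY β ^ 2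
      + 2 * (β ^ 3 - 3 * β + 1) * betaY β - (β ^ 4 + 2 * β) ≠ 0 := by
  refine left_ne_zero_of_mul_eq_one (b := 4622 / 17 * β ^ 3 + 13229 / 34 * β ^ 2 - 33843 / 68 * β -
    3653 / 17) ?_
  simp only [betaY]
  linear_combination (6933 / 17 * β ^ 4 + 35065 / 68 * β ^ 3 - 20700 / 17 * β ^ 2 - 22105 / 68
    * β + 1 / 2) * hβ

lemma beta_denominator_r_ne_zero (hβ : 8 * β ^ 4 + 14 * β ^ 3 - 11 * β ^ 2 - 11 * β - 2 = 0) :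
    β ^ 2 + β * betaY β + β - betaY β ^ 2 - betaY β ≠ 0 := by
  refine left_ne_zero_of_mul_eq_one (b := 609 / 8 * β ^ 3 + 3263 / 32 * β ^ 2 - 9399 / 64 * β -
    2869 / 64) ?_
  simp only [betaY]
  linear_combination (-3045 / 64 * β + 1 / 2) * hβ

lemma beta_denominator_s_ne_zero (hβ : 8 * β ^ 4 + 14 * β ^ 3 - 11 * β ^ 2 - 11 * β - 2 = 0) :
    β + betaY β + 1 ≠ 0 := by
  refine left_ne_zero_of_mul_eq_one (b := -4 * β ^ 3 - 7 * β ^ 2 + 11 / 2 * β + 11 / 2) ?_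
  simp only [betaY]
  linear_combination (1 / 2) * hβ

lemma regularParameters_beta (hβ : 8 * β ^ 4 + 14 * β ^ 3 - 11 * β ^ 2 - 11 * β - 2 = 0) :
    RegularParameters β (betaY β) :=
  ⟨beta_denominator_r_ne_zero hβ, beta_denominator_s_ne_zero hβ⟩

lemma rOf_beta (hβ : 8 * β ^ 4 + 14 * β ^ 3 - 11 * β ^ 2 - 11 * β - 2 = 0) :
    rOf β (betaY β) = betaR β := by
  rw [rOf, div_eq_iff (beta_denominator_r_ne_zero hβ), betaR, betaY]
  linear_combination (-205 / 64 * β - 1 / 2) * hβ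

lemma sOf_beta (hβ : 8 * β ^ 4 + 14 * β ^ 3 - 11 * β ^ 2 - 11 * β - 2 = 0) :
    sOf β (betaY β) = betaS β := by
  rw [sOf, div_eq_iff (beta_denominator_s_ne_zero hβ), betaS, betaY]
  linear_combination (-1 / 2) * hβ

lemma beta_r_ne_zero (hβ : 8 * β ^ 4 + 14 * β ^ 3 - 11 * β ^ 2 - 11 * β - 2 = 0) :
    betaR β ≠ 0 := by
  refine left_ne_zero_of_mul_eq_one (b := 8 * β ^ 3 + 14 * β ^ 2 - 19 * β - 6) ?_
  simp only [betaR]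
  linear_combination (-41 / 8 * β ^ 2 - 247 / 32 * β + 887 / 64) * hβ

lemma beta_s_ne_zero (hβ : 8 * β ^ 4 + 14 * β ^ 3 - 11 * β ^ 2 - 11 * β - 2 = 0) :
    betaS β ≠ 0 := by
  refine left_ne_zero_of_mul_eq_one (b := β ^ 3 + 3 / 4 * β ^ 2 - 17 / 8 * β - 1 / 4) ?_
  simp only [betaS]
  linear_combination (-1 / 2 * β ^ 2 - 3 / 8 * β + 17 / 16) * hβ

lemma beta_r_sub_one_ne_zero (hβ : 8 * β ^ 4 + 14 * β ^ 3 - 11 * β ^ 2 - 11 * β - 2 = 0) :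
    betaR β - 1 ≠ 0 := by
  refine left_ne_zero_of_mul_eq_one (b := -32 * β ^ 3 - 46 * β ^ 2 + 117 / 2 * β + 25) ?_
  simp only [betaR]
  linear_combination (41 / 2 * β ^ 2 + 783 / 32 * β - 5461 / 128) * hβ

lemma beta_r_sub_s_ne_zero (hβ : 8 * β ^ 4 + 14 * β ^ 3 - 11 * β ^ 2 - 11 * β - 2 = 0) :
    betaR β - betaS β ≠ 0 := by
  refine left_ne_zero_of_mul_eq_one (b := β ^ 3 + 9 / 4 * β ^ 2 - 5 / 4 * β - 3 / 2) ?_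
  simp only [betaR, betaS]
  linear_combination (-9 / 64 * β ^ 2 - 41 / 256 * β + 119 / 256) * hβ

lemma beta_d_ne_zero (hβ : 8 * β ^ 4 + 14 * β ^ 3 - 11 * β ^ 2 - 11 * β - 2 = 0) :
    betaR β * betaS β - 2 * betaR β + 1 ≠ 0 := by
  refine left_ne_zero_of_mul_eq_one (b := 9 / 4 * β ^ 3 + 49 / 16 * β ^ 2 - 73 / 16 * β - 7 / 8) ?_
  simp only [betaR, betaS]
  linear_combination (369 / 64 * β ^ 5 + 529 / 32 * β ^ 4 - 9931 / 1024 * β ^ 3 - 69449 / 2048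
    * β ^ 2 + 8193 / 512 * β + 11895 / 2048) * hβ

lemma beta_m_ne_zero (hβ : 8 * β ^ 4 + 14 * β ^ 3 - 11 * β ^ 2 - 11 * β - 2 = 0) :
    betaR β - betaS β ^ 2 + betaS β - 1 ≠ 0 := by
  refine left_ne_zero_of_mul_eq_one (b := -9 / 8 * β ^ 3 - 49 / 32 * β ^ 2 + 73 / 32 * β + 7 / 16)
    ?_
  simp only [betaR, betaS]
  linear_combination (9 / 4 * β ^ 5 + 7 * β ^ 4 - 147 / 64 * β ^ 3 - 7043 / 512 * β ^ 2 + 8593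
    / 2048 * β + 6533 / 2048) * hβ

lemma dup8_beta_ne_zero (hβ : 8 * β ^ 4 + 14 * β ^ 3 - 11 * β ^ 2 - 11 * β - 2 = 0) :
    dup8 (betaR β) (betaS β) ≠ 0 := by
  refine left_ne_zero_of_mul_eq_one (b := 4677 / 2048 * β ^ 3 + 30113 / 8192 * β ^ 2 - 37817 / 8192
    * β - 7383 / 4096) ?_
  simp only [dup8, betaR, betaS]
  linear_combination (-191757 / 128 * β ^ 17 - 969881 / 64 * β ^ 16 - 102424835 / 2048 * β ^ 15
    - 10432114653 / 524288 * β ^ 14 + 454632974099 / 2097152 * β ^ 13 + 1359357328677 / 4194304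
    * β ^ 12 - 5282007837449 / 16777216 * β ^ 11 - 111212847132073 / 134217728 * β ^ 10 +
    73387439542263 / 536870912 * β ^ 9 + 524250775201375 / 536870912 * β ^ 8 + 119722635487137
    / 1073741824 * β ^ 7 - 1246270196629649 / 2147483648 * β ^ 6 - 1496530936410193 /
    8589934592 * β ^ 5 + 1424237760352863 / 8589934592 * β ^ 4 + 350571901575163 / 4294967296 *
    β ^ 3 - 55213453108399 / 4294967296 * β ^ 2 - 115637419709005 / 8589934592 * β -
    18240250806941 / 8589934592) * hβ

lemma discFactor_beta_ne_zero (hβ : 8 * β ^ 4 + 14 * β ^ 3 - 11 * β ^ 2 - 11 * β - 2 = 0) :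
    discFactor (betaR β) (betaS β) ≠ 0 := by
  refine left_ne_zero_of_mul_eq_one (b := 1203 / 1088 * β ^ 3 + 3979 / 2176 * β ^ 2 - 4873 / 2176 *
    β - 1011 / 1088) ?_
  simp only [discFactor, betaR, betaS]
  linear_combination (-2022243 / 8704 * β ^ 14 - 33027181 / 17408 * β ^ 13 - 298634741 / 69632
    * β ^ 12 + 5855703 / 2048 * β ^ 11 + 43170692117 / 2228224 * β ^ 10 + 21223821273 / 4456448
    * β ^ 9 - 37842301507 / 1114112 * β ^ 8 - 88288989067 / 8912896 * β ^ 7 + 1081981072389 /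
    35651584 * β ^ 6 + 105806934277 / 71303168 * β ^ 5 - 798371786893 / 71303168 * β ^ 4 +
    48649105205 / 35651584 * β ^ 3 + 9001650913 / 4456448 * β ^ 2 - 32741776791 / 71303168 * β
    - 18940332125 / 71303168) * hβ

lemma noncuspidal_beta (hβ : 8 * β ^ 4 + 14 * β ^ 3 - 11 * β ^ 2 - 11 * β - 2 = 0) :
    Noncuspidal (betaR β) (betaS β) :=
  ⟨beta_r_ne_zero hβ, beta_s_ne_zero hβ, beta_r_sub_one_ne_zero hβ, beta_r_sub_s_ne_zero hβ,
    beta_d_ne_zero hβ, beta_m_ne_zero hβ, dup8_beta_ne_zero hβ, discFactor_beta_ne_zero hβ⟩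

lemma c2_eq (hβ : 8 * β ^ 4 + 14 * β ^ 3 - 11 * β ^ 2 - 11 * β - 2 = 0) :
    betaS β * (betaR β - 1) = c2 β := by
  simp only [betaR, betaS, c2]
  linear_combination (41 / 16 * β ^ 2 + 247 / 64 * β - 559 / 128) * hβ

lemma b2_eq (hβ : 8 * β ^ 4 + 14 * β ^ 3 - 11 * β ^ 2 - 11 * β - 2 = 0) :
    betaS β * (betaR β - 1) * betaR β = b2 β := by
  rw [c2_eq hβ, b2, c2, betaR]
  linear_combination (5699 / 1024 * β ^ 2 + 24165 / 4096 * β - 104393 / 8192) * hβ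

lemma betaY_add_one_ne_zero (hβ : 8 * β ^ 4 + 14 * β ^ 3 - 11 * β ^ 2 - 11 * β - 2 = 0) :
    betaY β + 1 ≠ 0 := by
  refine left_ne_zero_of_mul_eq_one (b := -2 * β ^ 3 - 7 / 2 * β ^ 2 + 11 / 4 * β + 11 / 4) ?_
  simp only [betaY]
  linear_combination (1 / 2) * hβ

lemma beta_sub_betaY_ne_zero (hβ : 8 * β ^ 4 + 14 * β ^ 3 - 11 * β ^ 2 - 11 * β - 2 = 0) :
    β - betaY β ≠ 0 := by
  refine left_ne_zero_of_mul_eq_one (b := -108 * β ^ 3 - 153 * β ^ 2 + 399 / 2 * β + 82) ?_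
  simp only [betaY]
  linear_combination (-81 / 2) * hβ

lemma beta_p1_value (hβ : 8 * β ^ 4 + 14 * β ^ 3 - 11 * β ^ 2 - 11 * β - 2 = 0) :
    (β ^ 2 + β * betaY β - betaY β ^ 2 + β - 2 * betaY β - 1) / (betaY β + 1) ^ 2 = -5 / 4 := by
  rw [div_eq_iff (pow_ne_zero 2 (betaY_add_one_ne_zero hβ)), betaY]
  -- On the whole line y = -2x - 1 one has x/(y + 1) = -1/2, hence p₁ = 1/4 - 1/2 - 1; the quartic
  -- plays no role.
  linear_combination (0) * hβ

lemma beta_p2_value (hβ : 8 * β ^ 4 + 14 * β ^ 3 - 11 * β ^ 2 - 11 * β - 2 = 0) :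
    (β ^ 3 * betaY β ^ 2 - β ^ 4 + 2 * β ^ 3 * betaY β + 2 * β ^ 2 * betaY β ^ 2 - β ^ 3
      + β ^ 2 * betaY β + betaY β ^ 3 - β * betaY β + betaY β ^ 2) /
      ((betaY β + 1) ^ 2 * (β - betaY β)) = 1 / 8 := by
  rw [div_eq_iff (mul_ne_zero (pow_ne_zero 2 (betaY_add_one_ne_zero hβ))
    (beta_sub_betaY_ne_zero hβ)), betaY]
  linear_combination (1 / 2 * β) * hβ

/-- A generator of the Galois group acting on the roots `β`. -/
def betaConj (β : K) : K := -8 * β ^ 3 - 12 * β ^ 2 + 27 / 2 * β + 6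

lemma betaConj_root (hβ : 8 * β ^ 4 + 14 * β ^ 3 - 11 * β ^ 2 - 11 * β - 2 = 0) :
    8 * betaConj β ^ 4 + 14 * betaConj β ^ 3 - 11 * betaConj β ^ 2 - 11 * betaConj β - 2 = 0 := by
  rw [betaConj]
  linear_combination (4096 * β ^ 8 + 17408 * β ^ 7 + 2816 * β ^ 6 - 57664 * β ^ 5 - 25488 * β ^
    4 + 67932 * β ^ 3 + 17709 * β ^ 2 - 81379 / 4 * β - 6464) * hβ

lemma betaConj_betaConj (hβ : 8 * β ^ 4 + 14 * β ^ 3 - 11 * β ^ 2 - 11 * β - 2 = 0) :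
    betaConj (betaConj β) = 18 * β ^ 3 + 51 / 2 * β ^ 2 - 133 / 4 * β - 14 := by
  rw [betaConj, betaConj]
  linear_combination (512 * β ^ 5 + 1408 * β ^ 4 - 896 * β ^ 3 - 3088 * β ^ 2 + 1034 * β + 2059
    / 2) * hβ

lemma betaConj_betaConj_ne (hβ : 8 * β ^ 4 + 14 * β ^ 3 - 11 * β ^ 2 - 11 * β - 2 = 0) :
    betaConj (betaConj β) ≠ β := by
  rw [betaConj_betaConj hβ, ← sub_ne_zero]
  refine left_ne_zero_of_mul_eq_one (b := 592 / 85 * β ^ 3 + 828 / 85 * β ^ 2 - 1138 / 85 * β - 90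
    / 17) ?_
  linear_combination (1332 / 85 * β ^ 2 + 1419 / 85 * β - 1243 / 34) * hβ

lemma betaConj_order_four (hβ : 8 * β ^ 4 + 14 * β ^ 3 - 11 * β ^ 2 - 11 * β - 2 = 0) :
    betaConj (betaConj (betaConj (betaConj β))) = β := by
  rw [betaConj_betaConj (betaConj_root (betaConj_root hβ)), betaConj_betaConj hβ]
  linear_combination (13122 * β ^ 5 + 32805 * β ^ 4 - 264627 / 8 * β ^ 3 - 77274 * β ^ 2 +
    1366227 / 32 * β + 87885 / 4) * hβ

end Beta

/-! ### The torsion subgroups -/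

section Torsion

open IntermediateField

/-- A Tate normal form over `ℚ(α)` whose parameters have only powers of `2` in their denominators
has an integral model at a simple root modulo an odd prime of the minimal polynomial of `α`. -/
lemma exists_integral_model {p : ℕ} [Fact p.Prime] (hp : p ≠ 2) {F : ℤ[X]}
    (hF : Irreducible (F.map (algebraMap ℤ ℚ))) {α : QBar}
    (hα : aeval α (F.map (algebraMap ℤ ℚ)) = 0) (a₀ : ℤ) (h0 : (p : ℤ) ∣ F.eval a₀)
    (h1 : ¬ (p : ℤ) ∣ F.derivative.eval a₀) {b c : ℚ⟮α⟯} (B C : ℤ[X]) (n m : ℕ)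
    (hb : b * 2 ^ n = aeval (AdjoinSimple.gen ℚ α) B)
    (hc : c * 2 ^ m = aeval (AdjoinSimple.gen ℚ α) C) (b₀ c₀ : ZMod p)
    (hb₀ : b₀ * 2 ^ n = (B.eval a₀ : ℤ)) (hc₀ : c₀ * 2 ^ m = (C.eval a₀ : ℤ)) :
    ∃ (φ : ℚ⟮α⟯ →+* ℚ_[p]) (V : WeierstrassCurve ℤ_[p]),
      (tateNormalForm b c).map φ = genericFibre V ∧ specialFibre V = tateNormalForm b₀ c₀ := by
  obtain ⟨a, ha, ha₀⟩ := exists_padic_root (p := p) F a₀ h0 h1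
  have haQ : aeval (a : ℚ_[p]) (F.map (algebraMap ℤ ℚ)) = 0 := by
    rw [aeval_map_algebraMap]
    change aeval (algebraMap ℤ_[p] ℚ_[p] a) F = 0
    rw [aeval_algebraMap_apply, ha, map_zero]
  obtain ⟨φ, hφ⟩ := exists_algHom_adjoin hF hα haQ
  have h2 : (2 : ZMod p) ≠ 0 := by
    intro h
    have h' : ((2 : ℕ) : ZMod p) = 0 := by exact_mod_cast h
    rw [ZMod.natCast_eq_zero_iff] at h'
    exact hp ((Nat.prime_dvd_prime_iff_eq Fact.out Nat.prime_two).mp h')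
  have hu : IsUnit (2 : ℤ_[p]) := by
    by_contra hu
    have : (2 : ℤ_[p]) ∈ RingHom.ker PadicInt.toZMod := by
      rw [PadicInt.ker_toZMod]; exact hu
    rw [RingHom.mem_ker, map_ofNat] at this
    exact h2 this
  obtain ⟨u, hu⟩ := hu.exists_right_inv
  -- Since 2 has an inverse u in ℤ_p, the element G(α)/2ᵏ is sent to the integral element G(a)uᵏ,
  -- whose residue is determined by a₀.
  have key : ∀ (G : ℤ[X]) (k : ℕ) (g : ℚ⟮α⟯) (g₀ : ZMod p),
      g * 2 ^ k = aeval (AdjoinSimple.gen ℚ α) G → g₀ * 2 ^ k = (G.eval a₀ : ℤ) →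
      φ g = algebraMap ℤ_[p] ℚ_[p] (aeval a G * u ^ k) ∧
        PadicInt.toZMod (aeval a G * u ^ k) = g₀ := by
    intro G k g g₀ hg hg₀
    constructor
    · have e := congrArg φ hg
      rw [map_mul, map_pow, map_ofNat] at e
      have e1 : φ (aeval (AdjoinSimple.gen ℚ α) G) = algebraMap ℤ_[p] ℚ_[p] (aeval a G) := by
        rw [← aeval_algebraMap_apply]
        change φ.toRingHom _ = _
        rw [aeval_def, aeval_def, hom_eval₂]
        change eval₂ _ (φ (AdjoinSimple.gen ℚ α)) G = _
        rw [hφ]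
        congr 1
        exact RingHom.ext_int _ _
      have hk : algebraMap ℤ_[p] ℚ_[p] u ^ k * 2 ^ k = 1 := by
        rw [← mul_pow, mul_comm, ← map_ofNat (algebraMap ℤ_[p] ℚ_[p]) 2, ← map_mul, hu, map_one,
          one_pow]
      rw [map_mul, map_pow, ← e1, ← e, mul_assoc, mul_comm (2 ^ k), hk, mul_one]
    · have e1 : PadicInt.toZMod (aeval a G) = ((G.eval a₀ : ℤ) : ZMod p) := by
        rw [aeval_def, hom_eval₂, ha₀, ← eq_intCast (Int.castRingHom (ZMod p)) a₀, ← eq_intCast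
          (Int.castRingHom (ZMod p)) (G.eval a₀), ← eval₂_at_apply]
        congr 1
        exact RingHom.ext_int _ _
      have hk : 2 ^ k * PadicInt.toZMod u ^ k = 1 := by
        rw [← mul_pow, ← map_ofNat PadicInt.toZMod 2, ← map_mul, hu, map_one, one_pow]
      rw [map_mul, map_pow, e1, ← hg₀, mul_assoc, hk, mul_one]
  obtain ⟨kb, kb₀⟩ := key B n b b₀ hb hb₀
  obtain ⟨kc, kc₀⟩ := key C m c c₀ hc hc₀
  refine ⟨φ, tateNormalForm (aeval a B * u ^ n) (aeval a C * u ^ m), ?_, ?_⟩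
  · rw [genericFibre, map_tateNormalForm, map_tateNormalForm, ← kb, ← kc]
    rfl
  · rw [specialFibre, map_tateNormalForm, kb₀, kc₀]

lemma tateNormalForm_equation_iff {k : Type*} [Field k] (b c x y : k) :
    (tateNormalForm b c).toAffine.Equation x y ↔
      y ^ 2 + (1 - c) * x * y - b * y = x ^ 3 - b * x ^ 2 := by
  rw [WeierstrassCurve.Affine.equation_iff]
  simp only [tateNormalForm]
  constructor <;> intro h <;> linear_combination h

/-- The affine points of a Tate normal form over a prime field. -/
def affinePoints {p : ℕ} [Fact p.Prime] (b c : ZMod p) : Finset (ZMod p × ZMod p) :=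
  Finset.univ.filter fun q => q.2 ^ 2 + (1 - c) * q.1 * q.2 - b * q.2 = q.1 ^ 3 - b * q.1 ^ 2

lemma mem_affinePoints {p : ℕ} [Fact p.Prime] {b c x y : ZMod p}
    (h : (tateNormalForm b c).toAffine.Equation x y) : (x, y) ∈ affinePoints b c :=
  Finset.mem_filter.mpr ⟨Finset.mem_univ _, (tateNormalForm_equation_iff _ _ _ _).mp h⟩

/-- The origin is a point of order 17 on `E(b, c)`. -/
def OriginHasOrderSeventeen {k : Type*} [Field k] (b c : k) : Prop :=
  ∃ hΔ : (tateNormalForm b c).Δ ≠ 0, addOrderOf (tateOrigin b c hΔ) = 17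

/-- The torsion of a Tate normal form over `ℚ(α)`, determined from its reductions at two places. -/
theorem hasTorsionSeventeen_of_residues {p q : ℕ} [Fact p.Prime] [Fact q.Prime] (hp : p ≠ 2)
    (hq : q ≠ 2) {F : ℤ[X]} (hF : Irreducible (F.map (algebraMap ℤ ℚ))) {α : QBar}
    (hα : aeval α (F.map (algebraMap ℤ ℚ)) = 0) {b c : ℚ⟮α⟯}
    (h17 : OriginHasOrderSeventeen b c)
    (B C : ℤ[X]) (n m : ℕ) (hb : b * 2 ^ n = aeval (AdjoinSimple.gen ℚ α) B)
    (hc : c * 2 ^ m = aeval (AdjoinSimple.gen ℚ α) C)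
    (a₀ : ℤ) (h0 : (p : ℤ) ∣ F.eval a₀) (h1 : ¬ (p : ℤ) ∣ F.derivative.eval a₀) {b₀ c₀ : ZMod p}
    (hb₀ : b₀ * 2 ^ n = (B.eval a₀ : ℤ)) (hc₀ : c₀ * 2 ^ m = (C.eval a₀ : ℤ))
    (h2 : NoTwoTorsion (tateNormalForm b₀ c₀)) (hcard : (affinePoints b₀ c₀).card ≤ 50)
    (a₁ : ℤ) (k0 : (q : ℤ) ∣ F.eval a₁) (k1 : ¬ (q : ℤ) ∣ F.derivative.eval a₁) {b₁ c₁ : ZMod q}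
    (hb₁ : b₁ * 2 ^ n = (B.eval a₁ : ℤ)) (hc₁ : c₁ * 2 ^ m = (C.eval a₁ : ℤ))
    (h3 : NoThreeTorsion (tateNormalForm b₁ c₁)) : HasTorsionSeventeen b c := by
  obtain ⟨hΔ, h17⟩ := h17
  obtain ⟨φ, V, hV, hV₀⟩ :=
    exists_integral_model hp hF hα a₀ h0 h1 B C n m hb hc b₀ c₀ hb₀ hc₀
  obtain ⟨ψ, U, hU, hU₀⟩ :=
    exists_integral_model hq hF hα a₁ k0 k1 B C n m hb hc b₁ c₁ hb₁ hc₁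
  refine hasTorsionSeventeen_of_reduction hΔ h17 hp hq φ V hV (by rwa [hV₀]) _ ?_ hcard ψ U hU
    (by rwa [hU₀])
  intro x y hxy
  rw [hV₀] at hxy
  exact mem_affinePoints hxy

instance : Fact (Nat.Prime 53) := ⟨by norm_num⟩

instance : Fact (Nat.Prime 43) := ⟨by norm_num⟩

/-- The pair (46, 39) is the reduction of (b₁, c₁) at the root α ≡ 16 modulo 53. -/
lemma noTwoTorsion_alpha : NoTwoTorsion (tateNormalForm (46 : ZMod 53) 39) := by
  have h : ∀ x y : ZMod 53, y ^ 2 + (1 - 39) * x * y - 46 * y = x ^ 3 - 46 * x ^ 2 →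
      2 * y + (1 - 39) * x + -46 ≠ 0 := by decide +kernel
  exact fun x y hxy => h x y ((tateNormalForm_equation_iff _ _ x y).mp hxy)

/-- With the point at infinity this allows at most 51 = 3 · 17 torsion points, which is why order 3
has to be excluded at another place. -/
lemma card_affinePoints_alpha : (affinePoints (46 : ZMod 53) 39).card ≤ 50 := by
  decide +kernel

/-- The pair (4, 14) is the reduction of (b₁, c₁) at the root α ≡ 22 modulo 43. -/
lemma noThreeTorsion_alpha : NoThreeTorsion (tateNormalForm (4 : ZMod 43) 14) := by
  have h : ∀ x y : ZMod 43, y ^ 2 + (1 - 14) * x * y - 4 * y = x ^ 3 - 4 * x ^ 2 →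
      (3 * x + -4) * (2 * y + (1 - 14) * x + -4) ^ 2 ≠
        (3 * x ^ 2 + 2 * -4 * x + 0 - (1 - 14) * y) ^ 2 +
          (1 - 14) * (3 * x ^ 2 + 2 * -4 * x + 0 - (1 - 14) * y) * (2 * y + (1 - 14) * x + -4) := by
    decide +kernel
  exact fun x y hxy => h x y ((tateNormalForm_equation_iff _ _ x y).mp hxy)

lemma aeval_alphaPoly_eq_zero {α : QBar} (hα : 2 * α ^ 4 - 5 * α ^ 3 - 7 * α ^ 2 + 10 * α + 8 = 0) :
    aeval α (alphaPoly.map (algebraMap ℤ ℚ)) = 0 := by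
  rw [aeval_alphaPoly_map, hα]

lemma alpha_gen {α : QBar} (hα : 2 * α ^ 4 - 5 * α ^ 3 - 7 * α ^ 2 + 10 * α + 8 = 0) :
    2 * AdjoinSimple.gen ℚ α ^ 4 - 5 * AdjoinSimple.gen ℚ α ^ 3 - 7 * AdjoinSimple.gen ℚ α ^ 2 + 10
      * AdjoinSimple.gen ℚ α + 8 = 0 := by
  rw [← aeval_alphaPoly_map]
  exact aeval_gen (aeval_alphaPoly_eq_zero hα)

/-- The numerator of `b1`. -/
def b1Num : ℤ[X] := -2674 * X ^ 3 + 3233 * X ^ 2 + 12285 * X + 4540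

/-- The numerator of `c1`. -/
def c1Num : ℤ[X] := -118 * X ^ 3 + 147 * X ^ 2 + 535 * X + 180

lemma aeval_b1Num {A : Type*} [CommRing A] (t : A) :
    aeval t b1Num = -2674 * t ^ 3 + 3233 * t ^ 2 + 12285 * t + 4540 := by
  simp only [b1Num, map_add, map_mul, map_pow, map_neg, aeval_X, map_ofNat]

lemma aeval_c1Num {A : Type*} [CommRing A] (t : A) :
    aeval t c1Num = -118 * t ^ 3 + 147 * t ^ 2 + 535 * t + 180 := by
  simp only [c1Num, map_add, map_mul, map_pow, map_neg, aeval_X, map_ofNat]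

lemma b1_mul {k : Type*} [Field k] [CharZero k] (t : k) : b1 t * 2 ^ 6 = aeval t b1Num := by
  rw [aeval_b1Num, b1]; ring

lemma c1_mul {k : Type*} [Field k] [CharZero k] (t : k) : c1 t * 2 ^ 5 = aeval t c1Num := by
  rw [aeval_c1Num, c1]; ring

lemma derivative_alphaPoly : derivative alphaPoly = 8 * X ^ 3 - 15 * X ^ 2 - 14 * X + 10 := by
  refine Polynomial.funext fun t => ?_
  simp [alphaPoly]
  ring

lemma addOrderOf_alpha {k : Type*} [Field k] [CharZero k] {α : k} (hα : 2 * α ^ 4 - 5 * α ^ 3 - 7 *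
    α ^ 2 + 10 * α + 8 = 0) :
    OriginHasOrderSeventeen (b1 α) (c1 α) := by
  have hN := noncuspidal_alpha hα
  have h17 := raw17_rOf_sOf (regularParameters_alpha hα) (onModel_alpha hα)
  rw [rOf_alpha hα, sOf_alpha hα] at h17
  rw [← b1_eq hα, ← c1_eq hα]
  exact ⟨hN.Δ_ne_zero, addOrderOf_tateOrigin_eq hN h17 _⟩

theorem hasTorsionSeventeen_alpha {α : QBar} (hα : 2 * α ^ 4 - 5 * α ^ 3 - 7 * α ^ 2 + 10 * α + 8
    = 0) :
    HasTorsionSeventeen (b1 (AdjoinSimple.gen ℚ α)) (c1 (AdjoinSimple.gen ℚ α)) := by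
  -- The quartic has the simple roots 16 modulo 53 and 22 modulo 43. The exponents 6 and 5 clear the
  -- powers of 2 from the denominators of b₁ and c₁.
  refine hasTorsionSeventeen_of_residues (p := 53) (q := 43) (by norm_num) (by norm_num)
    irreducible_alphaPoly (aeval_alphaPoly_eq_zero hα) (addOrderOf_alpha (alpha_gen hα))
    b1Num c1Num 6 5 (b1_mul _) (c1_mul _) 16 ?_ ?_ ?_ ?_ noTwoTorsion_alpha
    card_affinePoints_alpha 22 ?_ ?_ ?_ ?_ noThreeTorsion_alpha
  · simp [alphaPoly]
  · simp [derivative_alphaPoly]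
  · simp [b1Num]; decide
  · simp [c1Num]; decide
  · simp [alphaPoly]
  · simp [derivative_alphaPoly]
  · simp [b1Num]; decide
  · simp [c1Num]; decide

theorem isCyclicQuartic_alpha {α : QBar} (hα : 2 * α ^ 4 - 5 * α ^ 3 - 7 * α ^ 2 + 10 * α + 8 = 0) :
    IsCyclicQuartic ℚ⟮α⟯ := by
  refine isCyclicQuartic_adjoin irreducible_alphaPoly natDegree_alphaPoly
    (aeval_alphaPoly_eq_zero hα) alphaConj ?_ ?_ ?_ ?_
  · intro σ x
    simp only [alphaConj, map_add, map_neg, map_mul, map_pow, map_div₀, map_ofNat]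
  all_goals
    intro x hx
    rw [aeval_alphaPoly_map] at hx
  · rw [aeval_alphaPoly_map]; exact alphaConj_root hx
  · exact alphaConj_alphaConj_ne hx
  · exact alphaConj_order_four hx

/-- The pair (16, 13) is the reduction of (b₂, c₂) at the root β ≡ 12 modulo 53. -/
lemma noTwoTorsion_beta : NoTwoTorsion (tateNormalForm (16 : ZMod 53) 13) := by
  have h : ∀ x y : ZMod 53, y ^ 2 + (1 - 13) * x * y - 16 * y = x ^ 3 - 16 * x ^ 2 →
      2 * y + (1 - 13) * x + -16 ≠ 0 := by decide +kernel
  exact fun x y hxy => h x y ((tateNormalForm_equation_iff _ _ x y).mp hxy)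

lemma card_affinePoints_beta : (affinePoints (16 : ZMod 53) 13).card ≤ 50 := by
  decide +kernel

/-- The pair (28, 21) is the reduction of (b₂, c₂) at the root β ≡ 2 modulo 43. -/
lemma noThreeTorsion_beta : NoThreeTorsion (tateNormalForm (28 : ZMod 43) 21) := by
  have h : ∀ x y : ZMod 43, y ^ 2 + (1 - 21) * x * y - 28 * y = x ^ 3 - 28 * x ^ 2 →
      (3 * x + -28) * (2 * y + (1 - 21) * x + -28) ^ 2 ≠
        (3 * x ^ 2 + 2 * -28 * x + 0 - (1 - 21) * y) ^ 2 +
          (1 - 21) * (3 * x ^ 2 + 2 * -28 * x + 0 - (1 - 21) * y) * (2 * y + (1 - 21) * x + -28) :=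
            by
    decide +kernel
  exact fun x y hxy => h x y ((tateNormalForm_equation_iff _ _ x y).mp hxy)

lemma aeval_betaPoly_eq_zero {β : QBar} (hβ : 8 * β ^ 4 + 14 * β ^ 3 - 11 * β ^ 2 - 11 * β
    - 2 = 0) :
    aeval β (betaPoly.map (algebraMap ℤ ℚ)) = 0 := by
  rw [aeval_betaPoly_map, hβ]

lemma beta_gen {β : QBar} (hβ : 8 * β ^ 4 + 14 * β ^ 3 - 11 * β ^ 2 - 11 * β - 2 = 0) :
    8 * AdjoinSimple.gen ℚ β ^ 4 + 14 * AdjoinSimple.gen ℚ β ^ 3 - 11 * AdjoinSimple.gen ℚ β ^ 2 -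
      11 * AdjoinSimple.gen ℚ β - 2 = 0 := by
  rw [← aeval_betaPoly_map]
  exact aeval_gen (aeval_betaPoly_eq_zero hβ)

/-- The numerator of `b2`. -/
def b2Num : ℤ[X] := -55208 * X ^ 3 - 82774 * X ^ 2 + 91011 * X + 39449

/-- The numerator of `c2`. -/
def c2Num : ℤ[X] := -1112 * X ^ 3 - 1450 * X ^ 2 + 2301 * X + 871

lemma aeval_b2Num {A : Type*} [CommRing A] (t : A) :
    aeval t b2Num = -55208 * t ^ 3 - 82774 * t ^ 2 + 91011 * t + 39449 := by
  simp only [b2Num, map_add, map_sub, map_mul, map_pow, map_neg, aeval_X, map_ofNat]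

lemma aeval_c2Num {A : Type*} [CommRing A] (t : A) :
    aeval t c2Num = -1112 * t ^ 3 - 1450 * t ^ 2 + 2301 * t + 871 := by
  simp only [c2Num, map_add, map_sub, map_mul, map_pow, map_neg, aeval_X, map_ofNat]

lemma b2_mul {k : Type*} [Field k] [CharZero k] (t : k) : b2 t * 2 ^ 13 = aeval t b2Num := by
  rw [aeval_b2Num, b2]; ring

lemma c2_mul {k : Type*} [Field k] [CharZero k] (t : k) : c2 t * 2 ^ 7 = aeval t c2Num := by
  rw [aeval_c2Num, c2]; ring

lemma derivative_betaPoly : derivative betaPoly = 32 * X ^ 3 + 42 * X ^ 2 - 22 * X - 11 := by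
  refine Polynomial.funext fun t => ?_
  simp [betaPoly]
  ring

lemma addOrderOf_beta {k : Type*} [Field k] [CharZero k] {β : k} (hβ : 8 * β ^ 4 + 14 * β ^ 3 - 11
    * β ^ 2 - 11 * β - 2 = 0) :
    OriginHasOrderSeventeen (b2 β) (c2 β) := by
  have hN := noncuspidal_beta hβ
  have h17 := raw17_rOf_sOf (regularParameters_beta hβ) (onModel_beta hβ)
  rw [rOf_beta hβ, sOf_beta hβ] at h17
  rw [← b2_eq hβ, ← c2_eq hβ]
  exact ⟨hN.Δ_ne_zero, addOrderOf_tateOrigin_eq hN h17 _⟩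

theorem hasTorsionSeventeen_beta {β : QBar} (hβ : 8 * β ^ 4 + 14 * β ^ 3 - 11 * β ^ 2 - 11 * β - 2
    = 0) :
    HasTorsionSeventeen (b2 (AdjoinSimple.gen ℚ β)) (c2 (AdjoinSimple.gen ℚ β)) := by
  refine hasTorsionSeventeen_of_residues (p := 53) (q := 43) (by norm_num) (by norm_num)
    irreducible_betaPoly (aeval_betaPoly_eq_zero hβ) (addOrderOf_beta (beta_gen hβ))
    b2Num c2Num 13 7 (b2_mul _) (c2_mul _) 12 ?_ ?_ ?_ ?_ noTwoTorsion_beta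
    card_affinePoints_beta 2 ?_ ?_ ?_ ?_ noThreeTorsion_beta
  · simp [betaPoly]
  · simp [derivative_betaPoly]
  · simp [b2Num]; decide
  · simp [c2Num]; decide
  · simp [betaPoly]
  · simp [derivative_betaPoly]
  · simp [b2Num]; decide
  · simp [c2Num]; decide

theorem isCyclicQuartic_beta {β : QBar} (hβ : 8 * β ^ 4 + 14 * β ^ 3 - 11 * β ^ 2 - 11 * β
    - 2 = 0) :
    IsCyclicQuartic ℚ⟮β⟯ := by
  refine isCyclicQuartic_adjoin irreducible_betaPoly natDegree_betaPoly
    (aeval_betaPoly_eq_zero hβ) betaConj ?_ ?_ ?_ ?_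
  · intro σ x
    simp only [betaConj, map_add, map_sub, map_neg, map_mul, map_pow, map_div₀, map_ofNat]
  all_goals
    intro x hx
    rw [aeval_betaPoly_map] at hx
  · rw [aeval_betaPoly_map]; exact betaConj_root hx
  · exact betaConj_betaConj_ne hx
  · exact betaConj_order_four hx

end Torsion

/-! ### The points belonging to the roots, and the universal curve -/

section Points

open X1Point

variable {Q : X1Point}

/-- The second coordinate of the points over `P₁` as a polynomial in the first. -/
def alphaYPoly : ℚ[X] := C (1 / 2) * X ^ 2 - C (1 / 2) * X - 2

/-- The second coordinate of the points over `P₂` as a polynomial in the first. -/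
def betaYPoly : ℚ[X] := -2 * X - 1

lemma aeval_alphaYPoly (α : QBar) : aeval α alphaYPoly = alphaY α := by
  have h : algebraMap ℚ QBar (1 / 2) = 1 / 2 := by simp
  simp only [alphaYPoly, alphaY, map_sub, map_mul, map_pow, aeval_X, aeval_C, map_ofNat, h]
  ring

lemma aeval_betaYPoly (β : QBar) : aeval β betaYPoly = betaY β := by
  simp only [betaYPoly, betaY, map_sub, map_mul, map_neg, aeval_X, map_ofNat, map_one]

lemma isSmoothPoint_alpha {α : QBar} (hα : 2 * α ^ 4 - 5 * α ^ 3 - 7 * α ^ 2 + 10 * α + 8 = 0) :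
    IsSmoothPoint α alphaYPoly := by
  refine ⟨?_, ?_⟩
  · rw [aeval_alphaYPoly]; exact onModel_alpha hα
  · rw [aeval_alphaYPoly, derivative_f17]; exact derivative_alpha_ne_zero hα

lemma isSmoothPoint_beta {β : QBar} (hβ : 8 * β ^ 4 + 14 * β ^ 3 - 11 * β ^ 2 - 11 * β - 2 = 0) :
    IsSmoothPoint β betaYPoly := by
  refine ⟨?_, ?_⟩
  · rw [aeval_betaYPoly]; exact onModel_beta hβ
  · rw [aeval_betaYPoly, derivative_f17]; exact derivative_beta_ne_zero hβ

/-- The values of `r` and `s` at a point at which their denominators do not vanish. -/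
lemma hasValue_rFn_sFn {x y : QBar} (hQ : Q.HasCoords x y) (h : RegularParameters x y) :
    Q.HasValue rFn (rOf x y) ∧ Q.HasValue sFn (sOf x y) := by
  obtain ⟨hx, hy⟩ := hQ
  have hA : Q.HasValue (xFn ^ 2 + xFn * yFn + xFn - yFn ^ 2 - yFn)
      (x ^ 2 + x * y + x - y ^ 2 - y) :=
    ((((hx.pow 2).add (hx.mul hy)).add hx).sub (hy.pow 2)).sub hy
  have hB : Q.HasValue (xFn + yFn + 1) (x + y + 1) := (hx.add hy).add HasValue.one
  exact ⟨(((hx.pow 2).add hx).sub hy).div hA h.hA, (hx.add HasValue.one).div hB h.hB⟩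

lemma hasValue_cFn_bFn {r s : QBar} (hr : Q.HasValue rFn r) (hs : Q.HasValue sFn s) :
    Q.HasValue cFn (s * (r - 1)) ∧ Q.HasValue bFn (s * (r - 1) * r) := by
  have hc : Q.HasValue cFn (s * (r - 1)) := hs.mul (hr.sub HasValue.one)
  exact ⟨hc, hc.mul hr⟩

lemma regularParameters_of_hasCoords {x y : QBar} (hQ : Q.HasCoords x y)
    (h : RegularParameters x y) : RegularParameters xFn yFn := by
  obtain ⟨hx, hy⟩ := hQ
  refine ⟨HasValue.ne_zero (Q := Q) ?_ h.hA, HasValue.ne_zero (Q := Q) ?_ h.hB⟩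
  · exact ((((hx.pow 2).add (hx.mul hy)).add hx).sub (hy.pow 2)).sub hy
  · exact (hx.add hy).add HasValue.one

lemma hasValue_dup8 {r s : QBar} (hr : Q.HasValue rFn r) (hs : Q.HasValue sFn s) :
    Q.HasValue (dup8 rFn sFn) (dup8 r s) := by
  unfold dup8
  repeat' first
    | assumption
    | exact HasValue.one
    | exact HasValue.ofNat _
    | with_reducible refine HasValue.add ?_ ?_
    | with_reducible refine HasValue.sub ?_ ?_
    | with_reducible refine HasValue.mul ?_ ?_
    | with_reducible refine HasValue.neg ?_
    | with_reducible refine HasValue.pow ?_ _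

lemma hasValue_discFactor {r s : QBar} (hr : Q.HasValue rFn r) (hs : Q.HasValue sFn s) :
    Q.HasValue (discFactor rFn sFn) (discFactor r s) := by
  unfold discFactor
  repeat' first
    | assumption
    | exact HasValue.one
    | exact HasValue.ofNat _
    | with_reducible refine HasValue.add ?_ ?_
    | with_reducible refine HasValue.sub ?_ ?_
    | with_reducible refine HasValue.mul ?_ ?_
    | with_reducible refine HasValue.neg ?_
    | with_reducible refine HasValue.pow ?_ _

lemma noncuspidal_of_hasValue {r s : QBar} (hr : Q.HasValue rFn r) (hs : Q.HasValue sFn s)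
    (h : Noncuspidal r s) : Noncuspidal rFn sFn where
  hr := hr.ne_zero h.hr
  hs := hs.ne_zero h.hs
  hr1 := (hr.sub HasValue.one).ne_zero h.hr1
  hrs := (hr.sub hs).ne_zero h.hrs
  hd := (((hr.mul hs).sub ((HasValue.ofNat 2).mul hr)).add HasValue.one).ne_zero h.hd
  hm := (((hr.sub (hs.pow 2)).add hs).sub HasValue.one).ne_zero h.hm
  hdup := (hasValue_dup8 hr hs).ne_zero h.hdup
  hdisc := (hasValue_discFactor hr hs).ne_zero h.hdisc

lemma exists_alpha : ∃ α : QBar, 2 * α ^ 4 - 5 * α ^ 3 - 7 * α ^ 2 + 10 * α + 8 = 0 := by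
  obtain ⟨α, hα⟩ := IsAlgClosed.exists_aeval_eq_zero QBar (alphaPoly.map (algebraMap ℤ ℚ)) (by
    rw [degree_eq_natDegree irreducible_alphaPoly.ne_zero, natDegree_alphaPoly]
    norm_num)
  rw [aeval_alphaPoly_map] at hα
  exact ⟨α, hα⟩

lemma onModel_xFn_yFn : OnModel xFn yFn := f17_eq_zero

/-- Nonvanishing on the generic curve. -/
lemma generic_nonvanishing : RegularParameters xFn yFn ∧ Noncuspidal rFn sFn ∧
    rFn * sFn ^ 2 - 3 * rFn * sFn + rFn + sFn ^ 2 ≠ 0 := by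
  -- One point over P₁ suffices: each of these functions takes there a value already known to be
  -- nonzero.
  obtain ⟨α, hα⟩ := exists_alpha
  obtain ⟨Q, hQ, -⟩ := (isSmoothPoint_alpha hα).existsUnique
  rw [aeval_alphaYPoly] at hQ
  have hreg := regularParameters_alpha hα
  obtain ⟨hr, hs⟩ := hasValue_rFn_sFn hQ hreg
  rw [rOf_alpha hα] at hr
  rw [sOf_alpha hα] at hs
  refine ⟨regularParameters_of_hasCoords hQ hreg, noncuspidal_of_hasValue hr hs
    (noncuspidal_alpha hα), HasValue.ne_zero (Q := Q) ?_ (alpha_bcDenominator_factor_ne_zero hα)⟩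
  repeat' first
    | assumption
    | exact HasValue.one
    | exact HasValue.ofNat _
    | with_reducible refine HasValue.add ?_ ?_
    | with_reducible refine HasValue.sub ?_ ?_
    | with_reducible refine HasValue.mul ?_ ?_
    | with_reducible refine HasValue.neg ?_
    | with_reducible refine HasValue.pow ?_ _

lemma raw17_rFn_sFn : raw17 rFn sFn = 0 := raw17_rOf_sOf generic_nonvanishing.1 onModel_xFn_yFn

lemma originHasOrderSeventeen_bFn_cFn : OriginHasOrderSeventeen bFn cFn :=
  ⟨generic_nonvanishing.2.1.Δ_ne_zero,
    addOrderOf_tateOrigin_eq generic_nonvanishing.2.1 raw17_rFn_sFn _⟩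

lemma bcDenominator_bFn_cFn_ne_zero : bcDenominator bFn cFn ≠ 0 :=
  bcDenominator_ne_zero generic_nonvanishing.2.1.hs generic_nonvanishing.2.1.hr1
    generic_nonvanishing.2.2

lemma xFn_eq : xFn = -((-cFn ^ 2 + bFn - cFn) * (-cFn ^ 3 + bFn ^ 2 - bFn * cFn)) /
    bcDenominator bFn cFn :=
  x_eq_of_bc rfl rfl (x_mul_eq generic_nonvanishing.1) bcDenominator_bFn_cFn_ne_zero

lemma yFn_eq : yFn = -((-cFn ^ 2 + bFn - cFn) *
    (-bFn * cFn ^ 2 + 2 * bFn ^ 2 - 3 * bFn * cFn + cFn ^ 2)) / bcDenominator bFn cFn :=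
  y_eq_of_bc rfl rfl (y_mul_eq generic_nonvanishing.1) bcDenominator_bFn_cFn_ne_zero

/-- The functions `x` and `y` generate the function field. -/
lemma eq_top_of_xFn_yFn_mem (S : IntermediateField ℚ FunField) (hx : xFn ∈ S) (hy : yFn ∈ S) :
    S = ⊤ := by
  rw [eq_top_iff]
  intro g _
  have key : ∀ a : CoordRing, algebraMap CoordRing FunField a ∈ S := by
    intro a
    obtain ⟨g, rfl⟩ := AdjoinRoot.mk_surjective a
    have hX : ∀ g : ℚ[X], algebraMap CoordRing FunField (AdjoinRoot.of f17 g) ∈ S := by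
      intro g
      induction g using Polynomial.induction_on' with
      | add p q hp hq => rw [map_add, map_add]; exact add_mem hp hq
      | monomial n a =>
        rw [← C_mul_X_pow_eq_monomial]
        simp only [map_mul, map_pow]
        refine mul_mem ?_ (pow_mem hx n)
        have h : ((algebraMap CoordRing FunField).comp ((AdjoinRoot.of f17).comp C)) a =
            algebraMap ℚ FunField a := by rw [eq_ratCast, eq_ratCast]
        exact h ▸ S.algebraMap_mem a
    induction g using Polynomial.induction_on' with
    | add p q hp hq => rw [map_add, map_add]; exact add_mem hp hq
    | monomial n a =>
      rw [← C_mul_X_pow_eq_monomial]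
      simp only [map_mul, map_pow, AdjoinRoot.mk_C, AdjoinRoot.mk_X]
      exact mul_mem (hX a) (pow_mem hy n)
  obtain ⟨a, b, -, rfl⟩ := IsFractionRing.div_surjective (A := CoordRing) g
  exact div_mem (key a) (key b)

lemma adjoin_bFn_cFn : IntermediateField.adjoin ℚ {bFn, cFn} = ⊤ := by
  have hb : bFn ∈ IntermediateField.adjoin ℚ {bFn, cFn} :=
    IntermediateField.subset_adjoin _ _ (by simp)
  have hc : cFn ∈ IntermediateField.adjoin ℚ {bFn, cFn} :=
    IntermediateField.subset_adjoin _ _ (by simp)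
  -- The numerals 2 and 3 occur in the formulas for x and y, and `assumption` has to find their
  -- membership.
  have h2 := ofNat_mem (IntermediateField.adjoin ℚ {bFn, cFn}) 2
  have h3 := ofNat_mem (IntermediateField.adjoin ℚ {bFn, cFn}) 3
  refine eq_top_of_xFn_yFn_mem _ ?_ ?_
  · rw [xFn_eq, bcDenominator]
    repeat' first
      | assumption
      | with_reducible refine div_mem ?_ ?_
      | with_reducible refine add_mem ?_ ?_
      | with_reducible refine sub_mem ?_ ?_
      | with_reducible refine mul_mem ?_ ?_
      | with_reducible refine neg_mem ?_
      | with_reducible refine pow_mem ?_ _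
  · rw [yFn_eq, bcDenominator]
    repeat' first
      | assumption
      | with_reducible refine div_mem ?_ ?_
      | with_reducible refine add_mem ?_ ?_
      | with_reducible refine sub_mem ?_ ?_
      | with_reducible refine mul_mem ?_ ?_
      | with_reducible refine neg_mem ?_
      | with_reducible refine pow_mem ?_ _

/-- A nonzero polynomial in x alone has degree 0 in Y, so the monic quartic f₁₇ cannot divide it. -/
lemma transcendental_xFn : Transcendental ℚ xFn := by
  rw [transcendental_iff]
  intro g hg
  have h : aeval xFn g = algebraMap CoordRing FunField (AdjoinRoot.mk f17 (C g)) := by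
    rw [AdjoinRoot.mk_C]
    have e : (algebraMap ℚ FunField) =
        (algebraMap CoordRing FunField).comp ((AdjoinRoot.of f17).comp C) :=
      Subsingleton.elim _ _
    rw [aeval_def, e, xFn, ← hom_eval₂, ← hom_eval₂, eval₂_C_X]
  rw [h, FaithfulSMul.algebraMap_eq_zero_iff] at hg
  by_contra h0
  refine AdjoinRoot.mk_ne_zero_of_natDegree_lt f17_monic (C_ne_zero.mpr h0) ?_ hg
  rw [natDegree_C, f17_natDegree]
  norm_num

lemma isFunctionFieldOfX1_bFn_cFn : IsFunctionFieldOfX1 17 bFn cFn where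
  order_eq := originHasOrderSeventeen_bFn_cFn
  not_constant := by
    rintro ⟨hb, hc⟩
    -- If b and c were algebraic, so would be all of ℚ(b, c), and in particular x.
    have h : IntermediateField.adjoin ℚ {bFn, cFn} ≤ algebraicClosure ℚ FunField := by
      rw [IntermediateField.adjoin_le_iff]
      rintro z (rfl | rfl)
      · exact mem_algebraicClosure_iff.mpr hb
      · exact mem_algebraicClosure_iff.mpr hc
    rw [adjoin_bFn_cFn] at h
    exact transcendental_xFn (mem_algebraicClosure_iff.mp (h (x := xFn) trivial))
  adjoin_eq := adjoin_bFn_cFn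

end Points

/-! ### The fibres of `φ₁₇` -/

section Fibres

open X1Point

variable {Q : X1Point}

/-- The equation of the model in the coordinates `w = x / (y + 1)`, `t = y + 1`. -/
def modelWT {R : Type*} [CommRing R] (w t : R) : R :=
  w ^ 3 * t ^ 4 + (-w ^ 4 - 2 * w ^ 3 + w ^ 2) * t ^ 3 + (w ^ 4 + w ^ 3 - 3 * w ^ 2 - w + 1) * t ^ 2
    + (w ^ 3 + 3 * w ^ 2 - 2) * t + (w + 1)

/-- The numerator of the second coordinate of `φ₁₇` in the coordinates `w`, `t`. -/
def numeratorWT {R : Type*} [CommRing R] (w t : R) : R :=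
  -w ^ 4 * t ^ 3 + w ^ 3 * t ^ 4 - 2 * w ^ 3 * t ^ 2 + 2 * w ^ 2 * t ^ 3 - 3 * w ^ 2 * t ^ 2
    + w ^ 2 * t - w * t + w + t ^ 2 - 2 * t + 1

/-- The function `w = x / (y + 1)`. -/
def wFn : FunField := xFn / (yFn + 1)

/-- The function `t = y + 1`. -/
def tFn : FunField := yFn + 1

lemma tFn_ne_zero : tFn ≠ 0 := y_add_one_ne_zero

lemma xFn_eq_wt : xFn = wFn * tFn := by rw [wFn, tFn, div_mul_cancel₀ _ y_add_one_ne_zero]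

lemma yFn_eq_t : yFn = tFn - 1 := by rw [tFn]; ring

/-- In these coordinates f₁₇(wt, t - 1) = t² · `modelWT` w t, and t ≠ 0. -/
lemma modelWT_eq_zero : modelWT wFn tFn = 0 := by
  have hf := f17_eq_zero
  rw [xFn_eq_wt, yFn_eq_t] at hf
  refine (mul_eq_zero.mp (?_ : tFn ^ 2 * modelWT wFn tFn = 0)).resolve_left
    (pow_ne_zero 2 tFn_ne_zero)
  rw [modelWT]
  linear_combination hf

/-- The first coordinate depends on w alone and is monic in it, so w is integral over the ring
generated by p₁. This is the reason for choosing w. -/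
lemma p1_eq : p1 = wFn ^ 2 + wFn - 1 := by
  have h := tFn_ne_zero
  rw [p1, xFn_eq_wt, yFn_eq_t, sub_add_cancel, div_eq_iff (pow_ne_zero 2 h)]
  ring

/-- Multiplied out, the identity can be evaluated at any point where w, t and p₂ are regular,
without knowing that x - y is nonzero there. -/
lemma p2_mul : p2 * (tFn * (wFn * tFn - tFn + 1)) = numeratorWT wFn tFn := by
  have h := tFn_ne_zero
  have hxy := x_sub_y_ne_zero
  rw [xFn_eq_wt, yFn_eq_t] at hxy
  rw [p2, xFn_eq_wt, yFn_eq_t, sub_add_cancel, div_mul_eq_mul_div,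
    div_eq_iff (mul_ne_zero (pow_ne_zero 2 h) hxy), numeratorWT]
  ring

lemma hasValue_modelWT {w t : QBar} (hw : Q.HasValue wFn w) (ht : Q.HasValue tFn t) :
    Q.HasValue (modelWT wFn tFn) (modelWT w t) := by
  unfold modelWT
  repeat' first
    | assumption
    | exact HasValue.one
    | exact HasValue.ofNat _
    | with_reducible refine HasValue.add ?_ ?_
    | with_reducible refine HasValue.sub ?_ ?_
    | with_reducible refine HasValue.mul ?_ ?_
    | with_reducible refine HasValue.neg ?_
    | with_reducible refine HasValue.pow ?_ _

lemma hasValue_numeratorWT {w t : QBar} (hw : Q.HasValue wFn w) (ht : Q.HasValue tFn t) :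
    Q.HasValue (numeratorWT wFn tFn) (numeratorWT w t) := by
  unfold numeratorWT
  repeat' first
    | assumption
    | exact HasValue.one
    | exact HasValue.ofNat _
    | with_reducible refine HasValue.add ?_ ?_
    | with_reducible refine HasValue.sub ?_ ?_
    | with_reducible refine HasValue.mul ?_ ?_
    | with_reducible refine HasValue.neg ?_
    | with_reducible refine HasValue.pow ?_ _

/-- Where `p₁` is regular, so is `w`. -/
lemma exists_hasValue_wFn {u : QBar} (h : Q.HasValue p1 u) :
    ∃ w, Q.HasValue wFn w ∧ w ^ 2 + w - 1 = u := by
  rcases Q.exists_hasValue_or_inv wFn with ⟨w, hw⟩ | hw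
  · refine ⟨w, hw, HasValue.unique (Q := Q) (g := p1) ?_ h⟩
    rw [p1_eq]
    exact ((hw.pow 2).add hw).sub HasValue.one
  · exfalso
    have h0 : wFn ≠ 0 := by
      intro h0
      rw [wFn, div_eq_zero_iff] at h0
      have hx : xFn = 0 := h0.resolve_right y_add_one_ne_zero
      exact transcendental_xFn (hx ▸ isAlgebraic_zero)
    -- If w had a pole, evaluating this relation would give 0 = 1.
    have e : p1 * wFn⁻¹ ^ 2 = 1 + wFn⁻¹ - wFn⁻¹ ^ 2 := by
      rw [p1_eq]; field_simp
    have h1 := h.mul (hw.pow 2)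
    rw [e] at h1
    have := h1.unique ((HasValue.one.add hw).sub (hw.pow 2))
    norm_num at this

/-- Where `w` is regular and does not vanish, `t` is regular. -/
lemma exists_hasValue_tFn {w : QBar} (hw : Q.HasValue wFn w) (h0 : w ≠ 0) :
    ∃ t, Q.HasValue tFn t ∧ modelWT w t = 0 := by
  rcases Q.exists_hasValue_or_inv tFn with ⟨t, ht⟩ | ht
  · refine ⟨t, ht, (hasValue_modelWT hw ht).unique ?_⟩
    rw [modelWT_eq_zero]
    exact HasValue.zero
  · exfalso
    -- This is the model equation divided by t⁴. At a pole of t only the leading coefficient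
    -- survives, so w³ = 0.
    have e : wFn ^ 3 + (-wFn ^ 4 - 2 * wFn ^ 3 + wFn ^ 2) * tFn⁻¹
        + (wFn ^ 4 + wFn ^ 3 - 3 * wFn ^ 2 - wFn + 1) * tFn⁻¹ ^ 2
        + (wFn ^ 3 + 3 * wFn ^ 2 - 2) * tFn⁻¹ ^ 3 + (wFn + 1) * tFn⁻¹ ^ 4 = 0 := by
      have hm := modelWT_eq_zero
      have ht0 := tFn_ne_zero
      rw [modelWT] at hm
      field_simp
      linear_combination hm
    have hv : Q.HasValue (wFn ^ 3 + (-wFn ^ 4 - 2 * wFn ^ 3 + wFn ^ 2) * tFn⁻¹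
        + (wFn ^ 4 + wFn ^ 3 - 3 * wFn ^ 2 - wFn + 1) * tFn⁻¹ ^ 2
        + (wFn ^ 3 + 3 * wFn ^ 2 - 2) * tFn⁻¹ ^ 3 + (wFn + 1) * tFn⁻¹ ^ 4)
        (w ^ 3 + (-w ^ 4 - 2 * w ^ 3 + w ^ 2) * 0
        + (w ^ 4 + w ^ 3 - 3 * w ^ 2 - w + 1) * 0 ^ 2
        + (w ^ 3 + 3 * w ^ 2 - 2) * 0 ^ 3 + (w + 1) * 0 ^ 4) := by
      repeat' first
        | assumption
        | exact HasValue.one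
        | exact HasValue.ofNat _
        | with_reducible refine HasValue.add ?_ ?_
        | with_reducible refine HasValue.sub ?_ ?_
        | with_reducible refine HasValue.mul ?_ ?_
        | with_reducible refine HasValue.neg ?_
        | with_reducible refine HasValue.pow ?_ _
    rw [e] at hv
    have := hv.unique HasValue.zero
    norm_num at this
    exact h0 this

lemma hasCoords_of_wt {w t : QBar} (hw : Q.HasValue wFn w) (ht : Q.HasValue tFn t) :
    Q.HasCoords (w * t) (t - 1) := by
  refine ⟨?_, ?_⟩
  · rw [xFn_eq_wt]; exact hw.mul ht
  · rw [yFn_eq_t]; exact ht.sub HasValue.one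

lemma phi17_eq_iff {u v : QBar} (h : (E17 QBar).toAffine.Equation u v) :
    phi17 Q = .mk h ↔ Q.HasValue p1 u ∧ Q.HasValue p2 v := by
  constructor
  · intro e
    by_cases hreg : p1 ∈ Q.localRing ∧ p2 ∈ Q.localRing
    · rw [phi17, dif_pos hreg] at e
      have := WeierstrassCurve.Affine.Point.some.inj e
      exact ⟨⟨hreg.1, this.1⟩, ⟨hreg.2, this.2⟩⟩
    · rw [phi17, dif_neg hreg] at e
      exact absurd e.symm (WeierstrassCurve.Affine.Point.some_ne_zero _)
  · rintro ⟨⟨h1, rfl⟩, ⟨h2, rfl⟩⟩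
    rw [phi17, dif_pos ⟨h1, h2⟩]

lemma hasValue_p1 {x y : QBar} (hQ : Q.HasCoords x y) (h : y + 1 ≠ 0) :
    Q.HasValue p1 ((x ^ 2 + x * y - y ^ 2 + x - 2 * y - 1) / (y + 1) ^ 2) := by
  obtain ⟨hx, hy⟩ := hQ
  refine HasValue.div ?_ ((hy.add HasValue.one).pow 2) (pow_ne_zero 2 h)
  repeat' first
    | assumption
    | exact HasValue.one
    | exact HasValue.ofNat _
    | with_reducible refine HasValue.add ?_ ?_
    | with_reducible refine HasValue.sub ?_ ?_
    | with_reducible refine HasValue.mul ?_ ?_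
    | with_reducible refine HasValue.neg ?_
    | with_reducible refine HasValue.pow ?_ _

lemma hasValue_p2 {x y : QBar} (hQ : Q.HasCoords x y) (h : y + 1 ≠ 0) (hxy : x - y ≠ 0) :
    Q.HasValue p2 ((x ^ 3 * y ^ 2 - x ^ 4 + 2 * x ^ 3 * y + 2 * x ^ 2 * y ^ 2 - x ^ 3
      + x ^ 2 * y + y ^ 3 - x * y + y ^ 2) / ((y + 1) ^ 2 * (x - y))) := by
  obtain ⟨hx, hy⟩ := hQ
  refine HasValue.div ?_ (((hy.add HasValue.one).pow 2).mul (hx.sub hy))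
    (mul_ne_zero (pow_ne_zero 2 h) hxy)
  repeat' first
    | assumption
    | exact HasValue.one
    | exact HasValue.ofNat _
    | with_reducible refine HasValue.add ?_ ?_
    | with_reducible refine HasValue.sub ?_ ?_
    | with_reducible refine HasValue.mul ?_ ?_
    | with_reducible refine HasValue.neg ?_
    | with_reducible refine HasValue.pow ?_ _

/-- The points over `P₁`. -/
theorem phi17_eq_P1_iff : phi17 Q = P1 QBar ↔ ∃ α : QBar,
    2 * α ^ 4 - 5 * α ^ 3 - 7 * α ^ 2 + 10 * α + 8 = 0 ∧ Q.HasCoords α (alphaY α) := by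
  rw [P1, phi17_eq_iff]
  constructor
  · rintro ⟨h1, h2⟩
    obtain ⟨w, hw, hwu⟩ := exists_hasValue_wFn h1
    obtain ⟨t, ht, hwt⟩ := exists_hasValue_tFn hw (by rintro rfl; norm_num at hwu)
    have hm : w ^ 2 + w - 4 = 0 := by linear_combination hwu
    have hv : -2 * (t * (w * t - t + 1)) = numeratorWT w t := by
      have h3 := h2.mul (ht.mul (((hw.mul ht).sub ht).add HasValue.one))
      rw [p2_mul] at h3
      exact h3.unique (hasValue_numeratorWT hw ht)
    rw [modelWT] at hwt
    rw [numeratorWT] at hv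
    -- In terms of x = wt and y = t - 1 this is y = x²/2 - x/2 - 2. Call the left side g. Modulo w²
    -- + w - 4 the model equation is (w + 1)g², a square because the u-coordinate is ramified at a
    -- point of order 2. Combining it with the relation from p₂ yields g itself, and the
    -- coefficients record that elimination.
    have hg : w ^ 2 * t ^ 2 / 2 - w * t / 2 - t - 1 = 0 := by
      linear_combination ((5 / 34 - 7 / 34 * w) + (1 / 17 - 9 / 68 * w) * t) * hwt
        - ((-5 / 34 - 3 / 68 * w) + (-1 / 17 + 9 / 68 * w) * t) * hv
        + (-2 / 17 * w ^ 3 * t ^ 3 + 7 / 34 * w ^ 3 * t ^ 2 - 1 / 68 * w ^ 2 * t ^ 4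
          + 3 / 68 * w ^ 2 * t ^ 3 - 7 / 68 * w ^ 2 * t ^ 2 + 7 / 34 * w ^ 2 * t
          - 7 / 68 * w * t ^ 3 - 1 / 17 * w * t ^ 2 + 21 / 68 * w * t + 1 / 34 * t ^ 3
          + 3 / 68 * t ^ 2 + 3 / 17 * t + 1 / 4) * hm
    refine ⟨w * t, ?_, ?_⟩
    · linear_combination (-4 * w * t ^ 2 - 6 * w * t + 16 * t ^ 2 + 8 * t - 8) * hg
        + (2 * w ^ 2 * t ^ 4 - 2 * w * t ^ 3 - 4 * t ^ 3 - 6 * t ^ 2) * hm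
    · convert hasCoords_of_wt hw ht using 1
      rw [alphaY]
      linear_combination hg
  · rintro ⟨α, hα, hQ⟩
    have h1 := hasValue_p1 hQ (alphaY_add_one_ne_zero hα)
    have h2 := hasValue_p2 hQ (alphaY_add_one_ne_zero hα) (alpha_sub_alphaY_ne_zero hα)
    rw [alpha_p1_value hα] at h1
    rw [alpha_p2_value hα] at h2
    exact ⟨h1, h2⟩

/-- The points over `P₂`. -/
theorem phi17_eq_P2_iff : phi17 Q = P2 QBar ↔ ∃ β : QBar,
    8 * β ^ 4 + 14 * β ^ 3 - 11 * β ^ 2 - 11 * β - 2 = 0 ∧ Q.HasCoords β (betaY β) := by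
  rw [P2, phi17_eq_iff]
  constructor
  · rintro ⟨h1, h2⟩
    obtain ⟨w, hw, hwu⟩ := exists_hasValue_wFn h1
    -- Here u + 5/4 = (w + 1/2)², so w has a single possible value. The line y = -2x - 1 is w = -1/2
    -- rewritten, and the quartic for β is the model equation with t = -2β.
    obtain rfl : w = -1 / 2 := by
      have h : (w + 1 / 2) ^ 2 = 0 := by linear_combination hwu
      linear_combination pow_eq_zero_iff (two_ne_zero) |>.mp h
    obtain ⟨t, ht, hwt⟩ := exists_hasValue_tFn hw (by norm_num)
    rw [modelWT] at hwt
    refine ⟨-1 / 2 * t, ?_, ?_⟩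
    · linear_combination -4 * hwt
    · convert hasCoords_of_wt hw ht using 1
      rw [betaY]
      ring
  · rintro ⟨β, hβ, hQ⟩
    have h1 := hasValue_p1 hQ (betaY_add_one_ne_zero hβ)
    have h2 := hasValue_p2 hQ (betaY_add_one_ne_zero hβ) (beta_sub_betaY_ne_zero hβ)
    rw [beta_p1_value hβ] at h1
    rw [beta_p2_value hβ] at h2
    exact ⟨h1, h2⟩

end Fibres

/-! ### The points P₁ and P₂ have order two. -/

section OrderTwo

open WeierstrassCurve.Affine

lemma addOrderOf_eq_two {K : Type*} [Field K] [DecidableEq K] {W : WeierstrassCurve.Affine K} {x y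
    : K}
    (h : W.Nonsingular x y) (hy : y = W.negY x y) : addOrderOf (Point.some x y h) = 2 := by
  refine addOrderOf_eq_prime ?_ (Point.some_ne_zero h)
  rw [two_nsmul]
  exact Point.add_of_Y_eq rfl hy

lemma addOrderOf_P1 : addOrderOf (P1 ℚ) = 2 := by
  refine addOrderOf_eq_two _ ?_
  simp only [negY, E17]
  norm_num

lemma addOrderOf_P2 : addOrderOf (P2 ℚ) = 2 := by
  refine addOrderOf_eq_two _ ?_
  simp only [negY, E17]
  norm_num

end OrderTwo

/-! ### Arithmetic of the points in the two fibres. -/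

section RootPoints

open X1Point

variable {Q : X1Point}

lemma alphaRoots_ncard : alphaRoots.ncard = 4 := by
  rw [← natDegree_alphaPoly, ← ncard_roots irreducible_alphaPoly]
  simp only [aeval_alphaPoly_map]
  rfl

lemma betaRoots_ncard : betaRoots.ncard = 4 := by
  rw [← natDegree_betaPoly, ← ncard_roots irreducible_betaPoly]
  simp only [aeval_betaPoly_map]
  rfl

lemma point_alpha {α : QBar} (hα : 2 * α ^ 4 - 5 * α ^ 3 - 7 * α ^ 2 + 10 * α + 8 = 0)
    (hQ : Q.HasCoords α (alphaY α)) :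
    Q.IsQuartic ∧ Q.fieldOfDefinition = IntermediateField.adjoin ℚ {α} ∧
      Q.HasValue bFn (b1 α) ∧ Q.HasValue cFn (c1 α) := by
  have hfd := (isSmoothPoint_alpha hα).fieldOfDefinition_eq (Q := Q) (by rwa [aeval_alphaYPoly])
  obtain ⟨hr, hs⟩ := hasValue_rFn_sFn hQ (regularParameters_alpha hα)
  obtain ⟨hc, hb⟩ := hasValue_cFn_bFn hr hs
  rw [rOf_alpha hα, sOf_alpha hα] at hb hc
  rw [b1_eq hα] at hb
  rw [c1_eq hα] at hc
  refine ⟨?_, hfd, hb, hc⟩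
  rw [IsQuartic, hfd]
  exact (isCyclicQuartic_alpha hα).1

lemma point_beta {β : QBar} (hβ : 8 * β ^ 4 + 14 * β ^ 3 - 11 * β ^ 2 - 11 * β - 2 = 0)
    (hQ : Q.HasCoords β (betaY β)) :
    Q.IsQuartic ∧ Q.fieldOfDefinition = IntermediateField.adjoin ℚ {β} ∧
      Q.HasValue bFn (b2 β) ∧ Q.HasValue cFn (c2 β) := by
  have hfd := (isSmoothPoint_beta hβ).fieldOfDefinition_eq (Q := Q) (by rwa [aeval_betaYPoly])
  obtain ⟨hr, hs⟩ := hasValue_rFn_sFn hQ (regularParameters_beta hβ)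
  obtain ⟨hc, hb⟩ := hasValue_cFn_bFn hr hs
  rw [rOf_beta hβ, sOf_beta hβ] at hb hc
  rw [b2_eq hβ] at hb
  rw [c2_eq hβ] at hc
  refine ⟨?_, hfd, hb, hc⟩
  rw [IsQuartic, hfd]
  exact (isCyclicQuartic_beta hβ).1

lemma existsUnique_point_alpha {α : QBar}
    (hα : 2 * α ^ 4 - 5 * α ^ 3 - 7 * α ^ 2 + 10 * α + 8 = 0) :
    ∃! Q : X1Point, Q.HasCoords α (alphaY α) := by
  rw [← aeval_alphaYPoly]
  exact (isSmoothPoint_alpha hα).existsUnique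

lemma existsUnique_point_beta {β : QBar}
    (hβ : 8 * β ^ 4 + 14 * β ^ 3 - 11 * β ^ 2 - 11 * β - 2 = 0) :
    ∃! Q : X1Point, Q.HasCoords β (betaY β) := by
  rw [← aeval_betaYPoly]
  exact (isSmoothPoint_beta hβ).existsUnique

end RootPoints

end ModularSeventeen

end

theorem mainTheorem2 :
    -- the curve `f₁₇(x, y) = 0` is a model of `X₁(17)`, with universal Tate normal form `E(b, c)`
    IsFunctionFieldOfX1 17 bFn cFn ∧
    bFn * cFn ^ 4 + cFn ^ 5 - 3 * bFn ^ 2 * cFn ^ 2 + 3 * bFn * cFn ^ 3 + bFn ^ 3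
      - 2 * bFn ^ 2 * cFn + bFn * cFn ^ 2 ≠ 0 ∧
    xFn = -((-cFn ^ 2 + bFn - cFn) * (-cFn ^ 3 + bFn ^ 2 - bFn * cFn)) /
      (bFn * cFn ^ 4 + cFn ^ 5 - 3 * bFn ^ 2 * cFn ^ 2 + 3 * bFn * cFn ^ 3 + bFn ^ 3
        - 2 * bFn ^ 2 * cFn + bFn * cFn ^ 2) ∧
    yFn = -((-cFn ^ 2 + bFn - cFn) *
        (-bFn * cFn ^ 2 + 2 * bFn ^ 2 - 3 * bFn * cFn + cFn ^ 2)) /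
      (bFn * cFn ^ 4 + cFn ^ 5 - 3 * bFn ^ 2 * cFn ^ 2 + 3 * bFn * cFn ^ 3 + bFn ^ 3
        - 2 * bFn ^ 2 * cFn + bFn * cFn ^ 2) ∧
    -- `P₁` and `P₂` are rational torsion points of `E₁₇`
    addOrderOf (P1 ℚ) = 2 ∧ addOrderOf (P2 ℚ) = 2 ∧
    -- the fibre over `P₁` and the curves `E₁ᵢ`
    alphaRoots.ncard = 4 ∧
    (∀ α ∈ alphaRoots, ∃! Q : X1Point, Q.HasCoords α (α ^ 2 / 2 - α / 2 - 2)) ∧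
    (∀ Q : X1Point, phi17 Q = P1 QBar ↔ ∃ α ∈ alphaRoots, Q.HasCoords α (α ^ 2 / 2 - α / 2 - 2)) ∧
    (∀ α ∈ alphaRoots, ∀ Q : X1Point, Q.HasCoords α (α ^ 2 / 2 - α / 2 - 2) →
      Q.IsQuartic ∧ Q.fieldOfDefinition = IntermediateField.adjoin ℚ {α} ∧
      Q.HasValue bFn (b1 α) ∧ Q.HasValue cFn (c1 α)) ∧
    (∀ α ∈ alphaRoots,
      IsCyclicQuartic (IntermediateField.adjoin ℚ {α}) ∧
      HasTorsionSeventeen (b1 (IntermediateField.AdjoinSimple.gen ℚ α))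
        (c1 (IntermediateField.AdjoinSimple.gen ℚ α))) ∧
    -- the fibre over `P₂` and the curves `E₂ᵢ`
    betaRoots.ncard = 4 ∧
    (∀ β ∈ betaRoots, ∃! Q : X1Point, Q.HasCoords β (-2 * β - 1)) ∧
    (∀ Q : X1Point, phi17 Q = P2 QBar ↔ ∃ β ∈ betaRoots, Q.HasCoords β (-2 * β - 1)) ∧
    (∀ β ∈ betaRoots, ∀ Q : X1Point, Q.HasCoords β (-2 * β - 1) →
      Q.IsQuartic ∧ Q.fieldOfDefinition = IntermediateField.adjoin ℚ {β} ∧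
      Q.HasValue bFn (b2 β) ∧ Q.HasValue cFn (c2 β)) ∧
    (∀ β ∈ betaRoots,
      IsCyclicQuartic (IntermediateField.adjoin ℚ {β}) ∧
      HasTorsionSeventeen (b2 (IntermediateField.AdjoinSimple.gen ℚ β))
        (c2 (IntermediateField.AdjoinSimple.gen ℚ β))) := by
  refine ⟨isFunctionFieldOfX1_bFn_cFn, ?_, ?_, ?_, addOrderOf_P1, addOrderOf_P2, alphaRoots_ncard,
    ?_, ?_, ?_, ?_, betaRoots_ncard, ?_, ?_, ?_, ?_⟩
  · exact bcDenominator_bFn_cFn_ne_zero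
  · exact xFn_eq
  · exact yFn_eq
  · exact fun _ hα => existsUnique_point_alpha hα
  · exact fun _ => phi17_eq_P1_iff
  · exact fun _ hα _ hQ => point_alpha hα hQ
  · exact fun _ hα => ⟨isCyclicQuartic_alpha hα, hasTorsionSeventeen_alpha hα⟩
  · exact fun _ hβ => existsUnique_point_beta hβ
  · exact fun _ => phi17_eq_P2_iff
  · exact fun _ hβ _ hQ => point_beta hβ hQ
  · exact fun _ hβ => ⟨isCyclicQuartic_beta hβ, hasTorsionSeventeen_beta hβ⟩
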